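/- **Conventions.** Let $V$ be a real vector space and $P\subset V$ a polytope (convex hull of a finite set of points) of dimension $n$; $\mathrm{ver}(P)$ is its set of extreme points and $c(S)$ is the convex hull of $S$. A *triangulation* of $P$ is a finite set of $n$-dimensional simplices with vertices in $\mathrm{ver}(P)$ whose union is $P$ and any two of which meet in a (possibly empty) common face; it is *regular* if there is a concave function on $P$ that is affine on each of these simplices and whose domains of linearity are exactly these simplices. A *circuit* is a minimal affinely dependent set of points $Z=\{z_1,\dots,z_p\}$. If $Z\subset\mathrm{ver}(P)$, then $c(Z)$ has exactly two triangulations; the maximal simplices of each are of the form $c(Z-\omega)$, $\omega\in Z$. A triangulation $T_2$ is obtained from $T_1$ by a *flip along* $Z\subset \mathrm{ver}(P)$ if $T_1$ induces one of the two triangulations of $c(Z)$, say $T_+$, if for all maximal simplices $I,I'$ of $T_+$ and all finite sets $F\subset V$ with $F\cap Z=\emptyset$ one has $c(I\cup F)\in T_1\Leftrightarrow c(I'\cup F)\in T_1$, and if $T_2$ arises from $T_1$ by replacing all simplices $c(I\cup F)\in T_1$ ($I\in T_+$, $F\cap Z=\emptyset$) by all the simplices $c(J\cup F)$, with $J$ in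 the other triangulation $T_-$ of $c(Z)$ and the same sets $F$. Let $A_r$ be the free abelian group on symbols $(a_1,\dots,a_r)$, $a_i\in V$, modulo $(a_{\sigma(1)},\dots,a_{\sigma(r)})=\mathrm{sign}(\sigma)(a_1,\dots,a_r)$ for $\sigma\in S_r$. For an oriented $(r-1)$-simplex $s$, $s^*\in A_r$ is the symbol of its vertices listed in an order inducing the orientation of $s$. **Theorem.** Let $T_1,T_2$ be regular triangulations of an $n$-dimensional polytope $P$. (1) Suppose $T_2$ is obtained from $T_1$ by a flip along the circuit $Z=\{z_1,\dots,z_p\}$ (the $z_i$ distinct). Let $s_1,\dots,s_k$ be the maximal simplices of the triangulation of $c(Z)$ induced by $T_1$, and $u_1,\dots,u_l$ those of the one induced by $T_2$. Then these are distinct, $\{s_1,\dots,s_k,u_1,\dots,u_l\}=\{c(z_1,\dots,\widehat{z_i},\dots,z_p) : 1\le i\le p\}$ and, if $p=n+2$, the $s_i$ are exactly the simplices of $T_1$ removed by the flip and the $u_i$ exactly those added. If all of them are given the orientation induced from an orientation of the affine hull of $Z$, then in $A_{p-1}$ $$e\sum_{i=1}^p(-1)^i(z_1,\dots,\widehat{z_i},\dots,z_p)=(s_1^*+\dots+s_k^*)-(u_1^*+\dots+u_l^*)$$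 for some $e\in\{1,-1\}$. (2) In the situation of (1), orient the affine hull of $P$. Let $s_0\in T_1\setminus T_2$ and let $x_{p+1},\dots,x_{n+2}$ be an enumeration without repetition of the vertices of $s_0$ that are not in $Z$. Then in $A_{n+1}$ $$e\sum_{i=1}^p(-1)^i(z_1,\dots,\widehat{z_i},\dots,z_p,x_{p+1},\dots,x_{n+2})=\sum_w w^*-\sum_y y^*$$ for some $e\in\{1,-1\}$, where $w$ (respectively $y$) runs over the simplices removed (respectively added) by the flip whose set of vertices outside $Z$ is $\{x_{p+1},\dots,x_{n+2}\}$. (3) (No flip is assumed between $T_1$ and $T_2$.) Orient the affine hull of $P$. There are $k\ge 0$ and, for $1\le\alpha\le k$, distinct vertices $z_1^\alpha,\dots,z^\alpha_{p(\alpha)},x^\alpha_{p(\alpha)+1},\dots,x^\alpha_{n+2}$ of $P$ such that $\{z_1^\alpha,\dots,z_{p(\alpha)}^\alpha\}$ is a circuit for each $\alpha$, and in $A_{n+1}$ $$\sum_{\alpha}\sum_{i=1}^{p(\alpha)}(-1)^i(z_1^\alpha,\dots,\widehat{z_i^\alpha},\dots,z_{p(\alpha)}^\alpha,x_{p(\alpha)+1}^\alpha,\dots,x_{n+2}^\alpha)=\sum_{w\in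 T_1}w^*-\sum_{y\in T_2}y^*.$$ (4) Let $n\ge2$ and let $Y$ be the space of real symmetric $n\times n$ matrices, $d=\dim Y=n(n+1)/2$. For $0\ne v\in\mathbb Q^n$ put $v'=v\,{}^tv$. A *tile* is the closed convex cone generated by the $v'$ with $v$ a minimal vector (over $\mathbb Z^n\setminus\{0\}$) of a perfect form $Q$, i.e. of a positive definite form for which these $v'$ span $Y$; a *facet* $F$ is a codimension-one face of a tile. Let $H=\{\ell=1\}$ be a hyperplane, $\ell$ linear with $\ell(v')>0$ for all $0\ne v\in\mathbb Q^n$, and $v''=v'/\ell(v')\in H$. A *regular triangulation* of $F$ is a set of simplicial cones whose intersection with $H$ is a regular triangulation of the polytope $F\cap H$. The space of *sharblies* on $r$ vectors is the $\mathbb Q$-vector space on symbols $[v_1,\dots,v_r]$, $0\neq v_i\in\mathbb Q^n$, modulo antisymmetry, $[v_1,\dots,v_r]=0$ if the $v_i$ do not span $\mathbb Q^n$, and $[av_1,v_2,\dots,v_r]=[v_1,\dots,v_r]$ for $a\in\mathbb Q^\times$. A *flipon* is a symbol $[v_1,\dots,v_d]$ such that some $(d-2)$-dimensional affine subspace of $Y$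 contains all the $v_i'$. Fix an orientation of the linear span of $F$; for a $(d-1)$-dimensional simplicial cone $s\subset F$ generated by $v_1',\dots,v_{d-1}'$ let $[s]=[v_1,\dots,v_{d-1}]$, with the $v_i$ ordered so that $v'_1,\dots,v_{d-1}'$ is positively oriented. Then for any two regular triangulations $\{w\}$, $\{y\}$ of $F$ there are finitely many (possibly no) flipons $[v_1^\alpha,\dots,v_d^\alpha]$ and integers $3\le p(\alpha)\le d$ such that $$\sum_\alpha\sum_{i=1}^{p(\alpha)}(-1)^i[v_1^\alpha,\dots,\widehat{v_i^\alpha},\dots,v_d^\alpha]=\sum[w]-\sum[y],$$ and for each $\alpha$ the points $(v_1^\alpha)'',\dots,(v_d^\alpha)''$ are distinct vertices of $F\cap H$, the first $p(\alpha)$ of which form a circuit. -/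

import Mathlib

open Module

/-! ## Polytopes, regular triangulations, circuits and flips -/

section Polytopes

variable {V : Type*} [AddCommGroup V] [Module ℝ V]

/-- A polytope is the convex hull of a finite set of points. Its vertices are its extreme points
`P.extremePoints ℝ`. -/
def IsPolytope (P : Set V) : Prop :=
  ∃ S : Finset V, P = convexHull ℝ (S : Set V)

/-- A triangulation of `P`, given by the vertex sets of its maximal simplices: each of them is an
affinely independent set of `dim P + 1` vertices of `P`, the simplices cover `P`, and two of them
meet in their (possibly empty) common face. -/
structure IsTriangulation (P : Set V) (T : Finset (Finset V)) : Prop where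
  vertices : ∀ σ ∈ T, (σ : Set V) ⊆ P.extremePoints ℝ
  indep : ∀ σ ∈ T, AffineIndependent ℝ (Subtype.val : {x : V // x ∈ σ} → V)
  card_eq : ∀ σ ∈ T, σ.card = finrank ℝ (vectorSpan ℝ P) + 1
  cover : (⋃ σ ∈ T, convexHull ℝ (σ : Set V)) = P
  inter : ∀ σ ∈ T, ∀ τ ∈ T, σ ≠ τ →
    convexHull ℝ (σ : Set V) ∩ convexHull ℝ (τ : Set V) = convexHull ℝ ((σ : Set V) ∩ (τ : Set V))

/-- A triangulation of `P` is regular (coherent) if there is a concave function on `P` that is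
affine on each maximal simplex and whose domains of linearity are exactly the maximal simplices. -/
def IsRegularTriangulation (P : Set V) (T : Finset (Finset V)) : Prop :=
  IsTriangulation P T ∧ ∃ g : V → ℝ, ConcaveOn ℝ P g ∧
    ∀ σ ∈ T, ∃ l : V →ᵃ[ℝ] ℝ, ∀ x ∈ P, g x = l x ↔ x ∈ convexHull ℝ (σ : Set V)

/-- A circuit is a minimal affinely dependent set of points. -/
def IsCircuit (Z : Set V) : Prop :=
  ¬ AffineIndependent ℝ (Subtype.val : {x : V // x ∈ Z} → V) ∧
    ∀ z ∈ Z, AffineIndependent ℝ (Subtype.val : {x : V // x ∈ Z \ {z}} → V)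

/-- `T₂` is obtained from the triangulation `T₁` of `P` by a flip along the circuit `Z`:
`T₁` induces one (`Tp`) of the two triangulations of the convex hull of `Z`, all maximal simplices
of `Tp` have the same link in `T₁`, and every maximal simplex `I ∪ F` of `T₁` with `I` in `Tp` is
removed while the simplices `J ∪ F` with `J` in the other triangulation `Tm` are added. -/
structure IsFlip [DecidableEq V] (P : Set V) (T₁ T₂ : Finset (Finset V)) (Z : Finset V) :
    Prop where
  circuit : IsCircuit (Z : Set V)
  vertices : (Z : Set V) ⊆ P.extremePoints ℝ
  exchange : ∃ Tp Tm : Finset (Finset V),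
    IsTriangulation (convexHull ℝ (Z : Set V)) Tp ∧
    IsTriangulation (convexHull ℝ (Z : Set V)) Tm ∧
    Tp ≠ Tm ∧
    (∀ I ∈ Tp, ∃ σ ∈ T₁, I ⊆ σ) ∧
    (∀ I ∈ Tp, ∀ I' ∈ Tp, ∀ F : Finset V, Disjoint F Z → I ∪ F ∈ T₁ → I' ∪ F ∈ T₁) ∧
    ∀ σ : Finset V, σ ∈ T₂ ↔
      (σ ∈ T₁ ∧ ∀ I ∈ Tp, ¬ I ⊆ σ) ∨
      (∃ J ∈ Tm, ∃ F : Finset V, Disjoint F Z ∧ σ = J ∪ F ∧ ∃ I ∈ Tp, I ∪ F ∈ T₁)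

/-- The simplices `Z - ω` (`ω ∈ Z`) that are faces of the triangulation `T`: the maximal simplices
of the triangulation that `T` induces on the convex hull of the circuit `Z`. -/
def circuitSimplices [DecidableEq V] (Z : Finset V) (T : Finset (Finset V)) :
    Finset (Finset V) :=
  (Z.image fun w => Z.erase w).filter fun σ => ∃ τ ∈ T, σ ⊆ τ

end Polytopes

/-! ## The antisymmetrized chain groups -/

section Chains

variable (V : Type*)

/-- The relations `(a_{π(1)}, …, a_{π(r)}) = sign(π) (a_1, …, a_r)`. -/
noncomputable def antisymRelations (r : ℕ) : Submodule ℤ ((Fin r → V) →₀ ℤ) :=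
  Submodule.span ℤ {x | ∃ (a : Fin r → V) (π : Equiv.Perm (Fin r)),
    x = Finsupp.single (a ∘ π) 1 - Finsupp.single a (Equiv.Perm.sign π : ℤ)}

/-- The group `A_r`: the free abelian group on symbols `(a_1, …, a_r)` modulo antisymmetry. -/
abbrev AntisymChains (r : ℕ) : Type _ :=
  ((Fin r → V) →₀ ℤ) ⧸ antisymRelations V r

variable {V}

/-- The symbol `(a_1, …, a_r)` in `A_r`. -/
noncomputable def chainSymbol {r : ℕ} (a : Fin r → V) : AntisymChains V r :=
  (antisymRelations V r).mkQ (Finsupp.single a 1)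

/-- `∑_{i=1}^{p} (-1)^i (v_1, …, v̂_i, …, v_{r+1})`; the index `i : Fin (r + 1)` counts from `0`. -/
noncomputable def partialBoundary {r : ℕ} (p : ℕ) (v : Fin (r + 1) → V) : AntisymChains V r :=
  ∑ i ∈ Finset.univ.filter (fun i : Fin (r + 1) => (i : ℕ) < p),
    (-1 : ℤ) ^ ((i : ℕ) + 1) • chainSymbol (v ∘ i.succAbove)

variable [AddCommGroup V] [Module ℝ V]

/-- The order `a_0, …, a_m` of the vertices of an `m`-simplex induces the orientation `o`: the
vectors `a_1 - a_0, …, a_m - a_0` form a positively oriented basis of the direction `W` of the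
affine hull. -/
def InducesOrientation {W : Submodule ℝ V} {m : ℕ} (o : Orientation ℝ W (Fin m))
    (a : Fin (m + 1) → V) : Prop :=
  ∃ b : Basis (Fin m) ℝ W, b.orientation = o ∧ ∀ i, (b i : V) = a i.succ - a 0

open Classical in
/-- The symbol `σ^*` of a simplex with vertex set `σ`: the symbol of the vertices of `σ` in any
order that induces the orientation `o`. Two such orders differ by an even permutation. -/
noncomputable def orientedSymbol {W : Submodule ℝ V} {m : ℕ} (o : Orientation ℝ W (Fin m))
    (σ : Finset V) : AntisymChains V (m + 1) :=
  if h : ∃ a : Fin (m + 1) → V, Set.range a = (σ : Set V) ∧ InducesOrientation o a then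
    chainSymbol h.choose
  else 0

end Chains

/-! ## Sharblies -/

section Sharblies

/-- Nonzero column vectors in `ℚ^n`. -/
abbrev QVec (n : ℕ) : Type := {v : Fin n → ℚ // v ≠ 0}

/-- The relations defining the sharblies on `r` vectors in `ℚ^n`: antisymmetry, vanishing of
symbols whose entries do not span `ℚ^n`, and invariance under scaling the first entry. -/
noncomputable def sharblyRelations (n r : ℕ) : Submodule ℚ ((Fin r → QVec n) →₀ ℚ) :=
  Submodule.span ℚ
    ({x | ∃ (v : Fin r → QVec n) (π : Equiv.Perm (Fin r)),
        x = Finsupp.single (v ∘ π) 1 - Finsupp.single v ((Equiv.Perm.sign π : ℤ) : ℚ)} ∪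
     {x | ∃ v : Fin r → QVec n,
        Submodule.span ℚ (Set.range fun i => (v i : Fin n → ℚ)) ≠ ⊤ ∧ x = Finsupp.single v 1} ∪
     {x | ∃ (v w : Fin r → QVec n) (c : ℚ), c ≠ 0 ∧
        (∀ i : Fin r, (i : ℕ) = 0 → (w i : Fin n → ℚ) = c • (v i : Fin n → ℚ)) ∧
        (∀ i : Fin r, (i : ℕ) ≠ 0 → w i = v i) ∧
        x = Finsupp.single v 1 - Finsupp.single w 1})

/-- The `ℚ`-vector space of sharblies on `r` vectors in `ℚ^n`, that is, `Sh_{r-n}`. -/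
abbrev Sharbly (n r : ℕ) : Type :=
  ((Fin r → QVec n) →₀ ℚ) ⧸ sharblyRelations n r

/-- The basic sharbly `[v_1, …, v_r]`. -/
noncomputable def basicSharbly {n r : ℕ} (v : Fin r → QVec n) : Sharbly n r :=
  (sharblyRelations n r).mkQ (Finsupp.single v 1)

/-- `∑_{i=1}^{p} (-1)^i [v_1, …, v̂_i, …, v_{r+1}]`; the index `i : Fin (r + 1)` counts
from `0`. -/
noncomputable def partialSharblyBoundary {n r : ℕ} (p : ℕ) (v : Fin (r + 1) → QVec n) :
    Sharbly n r :=
  ∑ i ∈ Finset.univ.filter (fun i : Fin (r + 1) => (i : ℕ) < p),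
    (-1 : ℤ) ^ ((i : ℕ) + 1) • basicSharbly (v ∘ i.succAbove)

end Sharblies

/-! ## The perfect Voronoi cellulation -/

section Voronoi

variable {n : ℕ}

/-- The space `Y` of real symmetric `n × n` matrices. -/
def symmetricMatrices (n : ℕ) : Submodule ℝ (Matrix (Fin n) (Fin n) ℝ) where
  carrier := {A | A.IsSymm}
  add_mem' := fun ha hb => ha.add hb
  zero_mem' := Matrix.isSymm_zero
  smul_mem' := fun c _ h => h.smul c

/-- The rank one matrix `v' = v vᵗ` of a nonzero rational vector. -/
def rankOne (v : QVec n) : Matrix (Fin n) (Fin n) ℝ :=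
  Matrix.vecMulVec (fun i => (v.1 i : ℝ)) (fun i => (v.1 i : ℝ))

/-- The closed convex cone generated by `S`. -/
def coneHull (S : Set (Matrix (Fin n) (Fin n) ℝ)) : Set (Matrix (Fin n) (Fin n) ℝ) :=
  (Submodule.span NNReal S : Set (Matrix (Fin n) (Fin n) ℝ))

/-- The value of the quadratic form `Q` at a vector. -/
def quadValue (Q : Matrix (Fin n) (Fin n) ℝ) (v : Fin n → ℚ) : ℝ :=
  (fun i => (v i : ℝ)) ⬝ᵥ Q.mulVec (fun i => (v i : ℝ))

/-- The vector has integer coordinates. -/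
def HasIntCoords (v : QVec n) : Prop :=
  ∀ i, ∃ a : ℤ, v.1 i = a

/-- The minimal vectors of `Q`: the nonzero integral vectors at which `Q` attains its minimum over
the nonzero integral vectors. -/
def minimalVectors (Q : Matrix (Fin n) (Fin n) ℝ) : Set (QVec n) :=
  {v | HasIntCoords v ∧ ∀ w : QVec n, HasIntCoords w → quadValue Q v.1 ≤ quadValue Q w.1}

/-- A perfect form is a positive definite form whose minimal vectors `v` are such that the
matrices `v'` span `Y`. -/
def IsPerfect (Q : Matrix (Fin n) (Fin n) ℝ) : Prop :=
  Q.PosDef ∧ Submodule.span ℝ (rankOne '' minimalVectors Q) = symmetricMatrices n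

/-- The tile (top-dimensional Voronoi cone) of a perfect form. -/
def voronoiTile (Q : Matrix (Fin n) (Fin n) ℝ) : Set (Matrix (Fin n) (Fin n) ℝ) :=
  coneHull (rankOne '' minimalVectors Q)

/-- A facet of a tile: a face, cut out by a supporting hyperplane, of codimension one in `Y`. -/
def IsTileFacet (F : Set (Matrix (Fin n) (Fin n) ℝ)) : Prop :=
  ∃ Q : Matrix (Fin n) (Fin n) ℝ, IsPerfect Q ∧
    ∃ φ : Matrix (Fin n) (Fin n) ℝ →ₗ[ℝ] ℝ,
      (∀ A ∈ voronoiTile Q, 0 ≤ φ A) ∧ F = {A ∈ voronoiTile Q | φ A = 0} ∧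
      finrank ℝ (Submodule.span ℝ F) + 1 = finrank ℝ (symmetricMatrices n)

/-- The hyperplane `H = {l = 1}` meets every ray generated by a rank one matrix `v'`, `v ∈ ℚ^n`;
as an example, `l` may be the trace. -/
def IsTransversal (l : Matrix (Fin n) (Fin n) ℝ →ₗ[ℝ] ℝ) : Prop :=
  ∀ v : QVec n, 0 < l (rankOne v)

/-- The point `v''` where the ray through `v'` meets the hyperplane `{l = 1}`. -/
noncomputable def sectionPoint (l : Matrix (Fin n) (Fin n) ℝ →ₗ[ℝ] ℝ) (v : QVec n) :
    Matrix (Fin n) (Fin n) ℝ :=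
  (l (rankOne v))⁻¹ • rankOne v

/-- A finite set of simplicial cones is a regular triangulation of the cone `X` if its
intersection with the hyperplane `{l = 1}` is a regular triangulation of the polytope
`X ∩ {l = 1}`; the cones are then the cones over the simplices of that triangulation. -/
def IsRegularConeTriangulation (l : Matrix (Fin n) (Fin n) ℝ →ₗ[ℝ] ℝ)
    (X : Set (Matrix (Fin n) (Fin n) ℝ)) (𝒯 : Finset (Set (Matrix (Fin n) (Fin n) ℝ))) : Prop :=
  ∃ T : Finset (Finset (Matrix (Fin n) (Fin n) ℝ)),
    IsRegularTriangulation (X ∩ {A | l A = 1}) T ∧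
    (𝒯 : Set (Set (Matrix (Fin n) (Fin n) ℝ))) =
      (fun σ : Finset (Matrix (Fin n) (Fin n) ℝ) => coneHull (σ : Set _)) '' T

open Classical in
/-- The basic sharbly `[s] = [v_1, …, v_k]` of a `k`-dimensional simplicial cone
`s = s(v_1, …, v_k)` with linear span `W`, the `v_i` being listed in an order for which
`v_1', …, v_k'` is a basis of `W` that is positive for the orientation `o`. -/
noncomputable def coneSharbly {k : ℕ} {W : Submodule ℝ (Matrix (Fin n) (Fin n) ℝ)}
    (o : Orientation ℝ W (Fin k)) (s : Set (Matrix (Fin n) (Fin n) ℝ)) : Sharbly n k :=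
  if h : ∃ v : Fin k → QVec n, s = coneHull (Set.range fun i => rankOne (v i)) ∧
      ∃ b : Basis (Fin k) ℝ W, b.orientation = o ∧
        ∀ i, (b i : Matrix (Fin n) (Fin n) ℝ) = rankOne (v i) then
    basicSharbly h.choose
  else 0

/-- A flipon: a basic sharbly `[v_1, …, v_d]` on `d` vectors such that some affine subspace of `Y`
of dimension `d - 2` contains all the `v_i'`. -/
def IsFlipon {d : ℕ} (v : Fin d → QVec n) : Prop :=
  ∃ E : AffineSubspace ℝ (Matrix (Fin n) (Fin n) ℝ),
    (E : Set (Matrix (Fin n) (Fin n) ℝ)) ⊆ symmetricMatrices n ∧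
    finrank ℝ E.direction + 2 = d ∧ ∀ i, rankOne (v i) ∈ E

end Voronoi

/-! ## Relations between simplices and rational functions -/

section Relations

variable {X W : Type*} [AddCommGroup W] [Module ℝ W]

/-! Two triangulations of `P` are compared through an analytic invariant rather than through a path
of flips. In homogeneous coordinates a simplex with vertices `a_i` becomes a simplicial cone, and
the integral of `exp (-η x)` over it is `|det| / ∏ η (a_i)` when `η` is positive on the generators
(`integral_openCone`). The cones over the simplices of a triangulation are disjoint up to a null set
and fill the cone over `P`. Hence two triangulations, as chains weighted by the signs of
determinants, have the same Laplace transform for `η` near the height functional, and by rationality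
wherever it is defined (`simplexRatio_eq_zero_of_eventually`).

The algebraic core is `mem_simplexRelations_of_simplexRatio_eq_zero`: a chain with vanishing
transform is an integral combination of antisymmetry relations, degenerate simplices, and boundaries
of tuples of distinct labels. The argument is partial fractions organised as deletion and
contraction. Modulo relations a chain is `c₀ + v * c₁`, with neither part using a label parallel to
`v`. The residue along `η (f v) = 0` is the transform of `c₁` for the contracted form, so `c₁` is a
relation by induction. Coning it leaves a chain on fewer labels, to which induction applies again.

After degenerate simplices are dropped, the boundary of `n + 2` vertices keeps exactly the facets
opposite to the points of a circuit, so it is a partial boundary up to sign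
(`IsHomogenization.isCircuit`, `isFlipSum_of_mem_simplexRelations`). This proves the comparison of
two arbitrary triangulations.

For a single flip, a circuit carries an affine dependency unique up to scale. Simplices opposite to
weights of opposite signs both contain the Radon point and cannot coexist, so the two triangulations
of the circuit correspond to the two signs. Cramer's rule matches these signs with the orientations
of the facets (`exists_smul_sum_signedFace`).

For a facet `F` of a tile, coordinates on the span of `F` serve as homogeneous coordinates for the
section, and rational vectors on the vertex rays carry chains to sharblies (`coneSharbly_eq`). The
tuples are flipons because the minimal vectors all take the same value under the perfect form. -/

/-- The relations between the symbols of simplices with vertices in `S`: antisymmetry, vanishing of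
the simplices on which `D` vanishes, and the boundaries of tuples of distinct labels. -/
noncomputable def simplexRelations {d : ℕ} (S : Set X) (f : X → W) (D : W [⋀^Fin d]→ₗ[ℝ] ℝ) :
    Submodule ℤ ((Fin d → X) →₀ ℤ) :=
  Submodule.span ℤ
    ({x | ∃ (a : Fin d → X) (π : Equiv.Perm (Fin d)), (∀ i, a i ∈ S) ∧
        x = Finsupp.single (a ∘ π) 1 - Finsupp.single a (Equiv.Perm.sign π : ℤ)} ∪
     {x | ∃ a : Fin d → X, (∀ i, a i ∈ S) ∧ D (f ∘ a) = 0 ∧ x = Finsupp.single a 1} ∪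
     {x | ∃ w : Fin (d + 1) → X, (∀ i, w i ∈ S) ∧ Function.Injective w ∧
        x = ∑ i : Fin (d + 1), (-1 : ℤ) ^ (i : ℕ) • Finsupp.single (w ∘ i.succAbove) 1})

variable {d : ℕ} {S : Set X} {f : X → W} {D : W [⋀^Fin d]→ₗ[ℝ] ℝ}

theorem single_perm_sub_mem_simplexRelations {a : Fin d → X} (ha : ∀ i, a i ∈ S)
    (π : Equiv.Perm (Fin d)) :
    Finsupp.single (a ∘ π) (1 : ℤ) - Finsupp.single a (Equiv.Perm.sign π : ℤ) ∈
      simplexRelations S f D :=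
  Submodule.subset_span (Or.inl (Or.inl ⟨a, π, ha, rfl⟩))

theorem single_mem_simplexRelations {a : Fin d → X} (ha : ∀ i, a i ∈ S) (h : D (f ∘ a) = 0) :
    Finsupp.single a (1 : ℤ) ∈ simplexRelations S f D :=
  Submodule.subset_span (Or.inl (Or.inr ⟨a, ha, h, rfl⟩))

theorem boundary_mem_simplexRelations {w : Fin (d + 1) → X} (hw : ∀ i, w i ∈ S)
    (hi : Function.Injective w) :
    ∑ i : Fin (d + 1), (-1 : ℤ) ^ (i : ℕ) • Finsupp.single (w ∘ i.succAbove) (1 : ℤ) ∈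
      simplexRelations S f D :=
  Submodule.subset_span (Or.inr ⟨w, hw, hi, rfl⟩)

theorem simplexRelations_mono {S' : Set X} (h : S ⊆ S') :
    simplexRelations S f D ≤ simplexRelations S' f D := by
  refine Submodule.span_mono ?_
  rintro x ((⟨a, π, ha, rfl⟩ | ⟨a, ha, h0, rfl⟩) | ⟨w, hw, hi, rfl⟩)
  · exact Or.inl (Or.inl ⟨a, π, fun i => h (ha i), rfl⟩)
  · exact Or.inl (Or.inr ⟨a, fun i => h (ha i), h0, rfl⟩)
  · exact Or.inr ⟨w, fun i => h (hw i), hi, rfl⟩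

/-- The Laplace transform `D(a) / ∏ ξ(a_i)` of the cone over the simplex `a`, extended linearly. -/
noncomputable def simplexRatio (f : X → W) (D : W [⋀^Fin d]→ₗ[ℝ] ℝ) (ξ : W →ₗ[ℝ] ℝ) :
    ((Fin d → X) →₀ ℤ) →ₗ[ℤ] ℝ :=
  Finsupp.linearCombination ℤ fun a => D (f ∘ a) / ∏ i, ξ (f (a i))

theorem simplexRatio_single (ξ : W →ₗ[ℝ] ℝ) (a : Fin d → X) (c : ℤ) :
    simplexRatio f D ξ (Finsupp.single a c) = c * (D (f ∘ a) / ∏ i, ξ (f (a i))) := by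
  simp [simplexRatio]

/-- Multiplying the transform of a boundary by the product of all `ξ (f (w j))` leaves exactly the
left side of `hD`. For antisymmetry, the denominator is symmetric and the numerator alternating. -/
theorem simplexRatio_eq_zero_of_mem {ξ : W →ₗ[ℝ] ℝ} (hξ : ∀ s ∈ S, ξ (f s) ≠ 0)
    (hD : ∀ w : Fin (d + 1) → W,
      ∑ i : Fin (d + 1), (-1 : ℝ) ^ (i : ℕ) * D (w ∘ i.succAbove) * ξ (w i) = 0)
    {x : (Fin d → X) →₀ ℤ} (hx : x ∈ simplexRelations S f D) : simplexRatio f D ξ x = 0 := by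
  refine (Submodule.span_le (p := LinearMap.ker (simplexRatio f D ξ))).2 ?_ hx
  rintro x ((⟨a, π, ha, rfl⟩ | ⟨a, ha, h0, rfl⟩) | ⟨w, hw, hi, rfl⟩)
  · have h1 : ∏ i, ξ (f ((a ∘ π) i)) = ∏ i, ξ (f (a i)) :=
      Equiv.prod_comp π fun i => ξ (f (a i))
    have h2 : D (f ∘ (a ∘ π)) = ((Equiv.Perm.sign π : ℤ) : ℝ) * D (f ∘ a) := by
      rw [← Function.comp_assoc, D.map_perm, Units.smul_def, zsmul_eq_mul]
    simp only [SetLike.mem_coe, LinearMap.mem_ker, map_sub, simplexRatio_single, h1, h2]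
    push_cast; ring
  · simp [LinearMap.mem_ker, simplexRatio_single, h0]
  · have hne : ∀ i, ξ (f (w i)) ≠ 0 := fun i => hξ _ (hw i)
    simp only [SetLike.mem_coe, LinearMap.mem_ker, map_sum, map_smul, simplexRatio_single]
    have h1 : ∀ i : Fin (d + 1), ((-1 : ℤ) ^ (i : ℕ)) • (((1 : ℤ) : ℝ) *
        (D (f ∘ (w ∘ i.succAbove)) / ∏ j, ξ (f ((w ∘ i.succAbove) j)))) =
        ((-1 : ℝ) ^ (i : ℕ) * D ((f ∘ w) ∘ i.succAbove) * ξ ((f ∘ w) i)) /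
          ∏ j, ξ (f (w j)) := by
      intro i
      have h3 : ∏ j, ξ (f ((w ∘ i.succAbove) j)) ≠ 0 :=
        Finset.prod_ne_zero_iff.2 fun j _ => hne _
      rw [Fin.prod_univ_succAbove _ i, zsmul_eq_mul]
      simp only [Function.comp_apply] at h3 ⊢
      have := hne i
      push_cast
      field_simp
      rfl
    rw [Finset.sum_congr rfl fun i _ => h1 i, ← Finset.sum_div, hD, zero_div]

/-- Joining a label to all simplices of a chain. -/
noncomputable def coneMap (v : X) : ((Fin d → X) →₀ ℤ) →ₗ[ℤ] ((Fin (d + 1) → X) →₀ ℤ) :=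
  Finsupp.lmapDomain ℤ ℤ fun a => (Fin.cons v a : Fin (d + 1) → X)

theorem coneMap_single (v : X) (a : Fin d → X) (c : ℤ) :
    coneMap v (Finsupp.single a c) =
      Finsupp.single (Fin.cons v a : Fin (d + 1) → X) c := by
  simp [coneMap]

theorem comp_cons {X W : Type*} {d : ℕ} (f : X → W) (v : X) (a : Fin d → X) :
    f ∘ (Fin.cons v a : Fin (d + 1) → X) = Matrix.vecCons (f v) (f ∘ a) := by
  funext i
  refine Fin.cases ?_ (fun j => ?_) i <;> simp

theorem cons_comp_succ_succAbove (v : X) (w : Fin (d + 1) → X) (i : Fin (d + 1)) :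
    (Fin.cons v w : Fin (d + 2) → X) ∘ i.succ.succAbove =
      (Fin.cons v (w ∘ i.succAbove) : Fin (d + 1) → X) := by
  funext j
  refine Fin.cases ?_ (fun j => ?_) j <;> simp

/-- The cone formula `∂(v * w) = w - v * ∂w`, with indices counted from zero. -/
theorem boundary_cons (v : X) (w : Fin (d + 1) → X) :
    ∑ i : Fin (d + 2), (-1 : ℤ) ^ (i : ℕ) •
        Finsupp.single ((Fin.cons v w : Fin (d + 2) → X) ∘ i.succAbove) (1 : ℤ) =
      Finsupp.single w 1 - ∑ i : Fin (d + 1), (-1 : ℤ) ^ (i : ℕ) •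
        Finsupp.single (Fin.cons v (w ∘ i.succAbove) : Fin (d + 1) → X) (1 : ℤ) := by
  rw [Fin.sum_univ_succ]
  have h0 : (Fin.cons v w : Fin (d + 2) → X) ∘ (0 : Fin (d + 2)).succAbove = w := by
    funext j; simp
  simp only [h0, cons_comp_succ_succAbove, Fin.val_zero, pow_zero, one_smul, Fin.val_succ,
    pow_succ, mul_neg, mul_one, neg_smul, Finset.sum_neg_distrib, sub_eq_add_neg]

end Relations

/-! ### Deletion and contraction of a label in a chain -/

section Contraction

variable {X W : Type*} [AddCommGroup W] [Module ℝ W] {d : ℕ} {f : X → W}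

theorem cons_mem {S S₁ : Set X} (h : S₁ ⊆ S) {v : X} (hv : v ∈ S) {a : Fin d → X}
    (ha : ∀ i, a i ∈ S₁) (i : Fin (d + 1)) : (Fin.cons v a : Fin (d + 1) → X) i ∈ S := by
  refine Fin.cases ?_ (fun j => ?_) i
  · simpa using hv
  · simpa using h (ha j)

/-- Coning turns a boundary `∂w` into `w - ∂(v * w)`. The extra `w` has its labels in `S₁`, hence
the second summand of the conclusion; `v ∉ S₁` keeps the labels of `v * w` distinct. -/
theorem coneMap_mem_of_mem_simplexRelations {S S₁ : Set X} (h : S₁ ⊆ S) {v : X} (hv : v ∈ S)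
    (hv₁ : v ∉ S₁) {D : W [⋀^Fin (d + 1)]→ₗ[ℝ] ℝ} {x : (Fin d → X) →₀ ℤ}
    (hx : x ∈ simplexRelations S₁ f (D.curryLeft (f v))) :
    coneMap v x ∈ simplexRelations S f D ⊔ Finsupp.supported ℤ ℤ {a | ∀ i, a i ∈ S₁} := by
  refine (Submodule.span_le (p := (simplexRelations S f D ⊔
    Finsupp.supported ℤ ℤ {a | ∀ i, a i ∈ S₁}).comap (coneMap v))).2 ?_ hx
  rintro x ((⟨a, π, ha, rfl⟩ | ⟨a, ha, h0, rfl⟩) | ⟨w, hw, hi, rfl⟩)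
  · refine Submodule.mem_sup_left ?_
    have h1 : (Fin.cons v (a ∘ π) : Fin (d + 1) → X) =
        (Fin.cons v a : Fin (d + 1) → X) ∘ Equiv.Perm.decomposeFin.symm (0, π) := by
      funext i
      refine Fin.cases ?_ (fun j => ?_) i
      · simp
      · simp [Equiv.Perm.decomposeFin_symm_apply_succ]
    have h2 := single_perm_sub_mem_simplexRelations (f := f) (D := D) (cons_mem h hv ha)
      (Equiv.Perm.decomposeFin.symm (0, π))
    rw [Equiv.Perm.decomposeFin.symm_sign, if_pos rfl, one_mul, ← h1] at h2
    rw [map_sub, coneMap_single, coneMap_single]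
    exact h2
  · refine Submodule.mem_sup_left ?_
    rw [coneMap_single]
    refine single_mem_simplexRelations (cons_mem h hv ha) ?_
    rwa [comp_cons, ← AlternatingMap.curryLeft_apply_apply]
  · have hinj : Function.Injective (Fin.cons v w : Fin (d + 2) → X) :=
      Fin.cons_injective_iff.2 ⟨fun ⟨j, hj⟩ => hv₁ (hj ▸ hw j), hi⟩
    have h1 := boundary_mem_simplexRelations (f := f) (D := D) (cons_mem h hv hw) hinj
    rw [boundary_cons] at h1
    rw [SetLike.mem_coe, Submodule.mem_comap]
    simp only [map_sum, map_smul, coneMap_single]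
    have h2 : Finsupp.single w (1 : ℤ) ∈ Finsupp.supported ℤ ℤ {a | ∀ i, a i ∈ S₁} :=
      Finsupp.single_mem_supported ℤ _ hw
    have h3 := Submodule.sub_mem _
      (Submodule.mem_sup_right (S := simplexRelations S f D) h2) (Submodule.mem_sup_left h1)
    simpa using h3

/-- Modulo the relations, every chain is a chain avoiding the elements parallel to `v` plus a cone
with apex `v` over such a chain. -/
theorem exists_decomposition {S S₁ : Set X} {v : X} {U : Submodule ℝ W} (hv : v ∈ S)
    (hS₁ : S₁ = {s ∈ S | f s ∉ U ⊔ Submodule.span ℝ {f v}}) (hU : ∀ s ∈ S, f s ∉ U)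
    {D : W [⋀^Fin (d + 1)]→ₗ[ℝ] ℝ}
    (hD : ∀ w : Fin (d + 1) → W, (∃ i, w i ∈ U) → D w = 0)
    {c : (Fin (d + 1) → X) →₀ ℤ} (hc : c ∈ Finsupp.supported ℤ ℤ {a | ∀ i, a i ∈ S}) :
    ∃ c₀ ∈ Finsupp.supported ℤ ℤ {a : Fin (d + 1) → X | ∀ i, a i ∈ S₁},
      ∃ c₁ ∈ Finsupp.supported ℤ ℤ {a : Fin d → X | ∀ i, a i ∈ S₁},
        c - (c₀ + coneMap v c₁) ∈ simplexRelations S f D := by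
  have key : c ∈ simplexRelations S f D ⊔
      (Finsupp.supported ℤ ℤ {a : Fin (d + 1) → X | ∀ i, a i ∈ S₁} ⊔
        (Finsupp.supported ℤ ℤ {a : Fin d → X | ∀ i, a i ∈ S₁}).map (coneMap v)) := by
    have hS₁S : S₁ ⊆ S := by rw [hS₁]; exact fun s hs => hs.1
    have hpar : ∀ s ∈ S, s ∉ S₁ → ∃ t : ℝ, t ≠ 0 ∧ ∃ u ∈ U, f s = u + t • f v := by
      intro s hs hs1
      rw [hS₁] at hs1
      have h2 : f s ∈ U ⊔ Submodule.span ℝ {f v} := by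
        by_contra h; exact hs1 ⟨hs, h⟩
      obtain ⟨u, hu, y, hy, hsum⟩ := Submodule.mem_sup.1 h2
      obtain ⟨t, rfl⟩ := Submodule.mem_span_singleton.1 hy
      refine ⟨t, ?_, u, hu, hsum.symm⟩
      rintro rfl
      apply hU s hs
      rw [← hsum]; simpa using hu
    have hvS₁ : v ∉ S₁ := by
      rw [hS₁]
      exact fun h => h.2 (Submodule.mem_sup_right (Submodule.mem_span_singleton_self _))
    have hDu : ∀ (u : W) (y : Fin d → W), u ∈ U → D (Matrix.vecCons u y) = 0 :=
      fun u y hu => hD _ ⟨0, by simpa using hu⟩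
    have hDadd : ∀ (x₁ x₂ : W) (y : Fin d → W), D (Matrix.vecCons (x₁ + x₂) y) =
        D (Matrix.vecCons x₁ y) + D (Matrix.vecCons x₂ y) := fun x₁ x₂ y => D.map_vecCons_add _ _ _
    have hDsmul : ∀ (t : ℝ) (x₁ : W) (y : Fin d → W), D (Matrix.vecCons (t • x₁) y) =
        t * D (Matrix.vecCons x₁ y) := fun t x₁ y => D.map_vecCons_smul _ _ _
    have hcons : ∀ (s : X), s ∈ S → s ∉ S₁ → ∀ u : Fin d → X, (∀ i, u i ∈ S) →
        Finsupp.single (Fin.cons s u : Fin (d + 1) → X) (1 : ℤ) ∈ simplexRelations S f D ⊔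
      (Finsupp.supported ℤ ℤ {a : Fin (d + 1) → X | ∀ i, a i ∈ S₁} ⊔
        (Finsupp.supported ℤ ℤ {a : Fin d → X | ∀ i, a i ∈ S₁}).map (coneMap v)) := by
      intro s hs hs1 u hu
      have hsu : ∀ i, (Fin.cons s u : Fin (d + 1) → X) i ∈ S :=
        cons_mem (le_refl S) hs hu
      by_cases hDz : D (f ∘ (Fin.cons s u : Fin (d + 1) → X)) = 0
      · exact Submodule.mem_sup_left (single_mem_simplexRelations hsu hDz)
      obtain ⟨t, ht, u₀, hu₀, hst⟩ := hpar s hs hs1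
      -- A second label parallel to `v` modulo `U` would make `D` vanish on the simplex.
      have huS₁ : ∀ i, u i ∈ S₁ := by
        intro i
        by_contra hi
        apply hDz
        obtain ⟨t', ht', u₁, hu₁, hst'⟩ := hpar (u i) (hu i) hi
        rw [comp_cons, hst, hDadd, hDu _ _ hu₀, zero_add, hDsmul]
        have h1 : Function.update (Matrix.vecCons (f v) (f ∘ u)) i.succ (f (u i)) =
          Matrix.vecCons (f v) (f ∘ u) := Function.update_eq_self_iff.2 (by simp)
        rw [← h1, hst', D.map_update_add, D.map_update_smul, hD _ ⟨i.succ, by simpa using hu₁⟩,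
          D.map_eq_zero_of_eq (i := 0) (j := i.succ) _
            (by simp [Function.update_of_ne, Fin.succ_ne_zero, Ne.symm])
            (Fin.succ_ne_zero i).symm]
        simp
      have hcv : Finsupp.single (Fin.cons v u : Fin (d + 1) → X) (1 : ℤ) ∈
          (Finsupp.supported ℤ ℤ {a : Fin d → X | ∀ i, a i ∈ S₁}).map (coneMap v) :=
        ⟨Finsupp.single u 1, Finsupp.single_mem_supported ℤ _ huS₁, coneMap_single _ _ _⟩
      by_cases hsv : s = v
      · rw [hsv]
        exact Submodule.mem_sup_right (Submodule.mem_sup_right hcv)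
      have hinju : Function.Injective u := by
        intro i j hij
        by_contra hne
        refine hDz (D.map_eq_zero_of_eq (i := i.succ) (j := j.succ) _ (by simp [hij]) ?_)
        simpa using hne
      have hinj : Function.Injective (Fin.cons v (Fin.cons s u : Fin (d + 1) → X) :
          Fin (d + 2) → X) := by
        refine Fin.cons_injective_iff.2 ⟨?_, Fin.cons_injective_iff.2 ⟨?_, hinju⟩⟩
        · rintro ⟨j, hj⟩
          revert hj
          refine Fin.cases ?_ (fun j => ?_) j
          · simpa using hsv
          · simp only [Fin.cons_succ]; exact fun hj => hvS₁ (hj ▸ huS₁ j)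
        · rintro ⟨j, hj⟩
          exact hs1 (hj ▸ huS₁ j)
      -- In `∂(v, s, u)` every face that keeps both `v` and `s` is degenerate, so `(s, u)` and `(v,
      -- u)` agree modulo relations.
      have hb := boundary_mem_simplexRelations (f := f) (D := D)
        (cons_mem (le_refl S) hv hsu) hinj
      rw [boundary_cons, Fin.sum_univ_succ] at hb
      have h0 : (Fin.cons s u : Fin (d + 1) → X) ∘ (0 : Fin (d + 1)).succAbove = u := by
        funext j; simp
      rw [h0] at hb
      have hrest : ∑ i : Fin d, (-1 : ℤ) ^ (i.succ : ℕ) • Finsupp.single (Fin.cons v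
          ((Fin.cons s u : Fin (d + 1) → X) ∘ i.succ.succAbove) : Fin (d + 1) → X) (1 : ℤ) ∈
          simplexRelations S f D := by
        refine Submodule.sum_mem _ fun i _ => Submodule.smul_mem _ _ ?_
        obtain ⟨d, rfl⟩ : ∃ e, d = e + 1 := ⟨d - 1, by have := i.2; omega⟩
        rw [cons_comp_succ_succAbove]
        refine single_mem_simplexRelations (cons_mem (le_refl S) hv
          (cons_mem (le_refl S) hs fun j => hu _)) ?_
        rw [comp_cons, comp_cons, hst]
        have h1 : Function.update (Matrix.vecCons (f v) (Matrix.vecCons (u₀ + t • f v)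
            (f ∘ u ∘ i.succAbove))) 1 (u₀ + t • f v) = (Matrix.vecCons (f v)
            (Matrix.vecCons (u₀ + t • f v) (f ∘ u ∘ i.succAbove))) :=
          Function.update_eq_self_iff.2 (by simp)
        rw [← h1, D.map_update_add, D.map_update_smul, hD _ ⟨1, by simpa using hu₀⟩,
          D.map_eq_zero_of_eq (i := 0) (j := 1) _ (by simp [Function.update_of_ne]) (by simp)]
        simp
      have h3 : Finsupp.single (Fin.cons s u : Fin (d + 1) → X) (1 : ℤ) -
          Finsupp.single (Fin.cons v u : Fin (d + 1) → X) (1 : ℤ) ∈ simplexRelations S f D := by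
        have := Submodule.add_mem _ hb hrest
        simpa [sub_add_eq_sub_sub] using this
      have h4 := Submodule.add_mem _ (Submodule.mem_sup_left (T :=
        (Finsupp.supported ℤ ℤ {a : Fin (d + 1) → X | ∀ i, a i ∈ S₁} ⊔
        (Finsupp.supported ℤ ℤ {a : Fin d → X | ∀ i, a i ∈ S₁}).map (coneMap v))) h3)
        (Submodule.mem_sup_right (Submodule.mem_sup_right hcv))
      simpa using h4
    rw [Finsupp.supported_eq_span_single] at hc
    refine Submodule.span_le.2 ?_ hc
    rintro _ ⟨a, ha, rfl⟩
    by_cases hall : ∀ i, a i ∈ S₁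
    · exact Submodule.mem_sup_right (Submodule.mem_sup_left
        (Finsupp.single_mem_supported ℤ _ hall))
    push Not at hall
    obtain ⟨i, hi⟩ := hall
    -- A transposition brings the parallel label to the front, where `hcons` applies.
    have h1 := single_perm_sub_mem_simplexRelations (f := f) (D := D) ha (Equiv.swap 0 i)
    have h2 := hcons (a i) (ha i) hi (fun j => a (Equiv.swap 0 i j.succ)) (fun j => ha _)
    have h3 : (Fin.cons (a i) (fun j => a (Equiv.swap 0 i j.succ)) : Fin (d + 1) → X) =
        a ∘ Equiv.swap 0 i := by
      funext j; refine Fin.cases ?_ (fun j => ?_) j <;> simp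
    rw [h3] at h2
    have h4 := Submodule.sub_mem _ h2 (Submodule.mem_sup_left h1)
    rw [sub_sub_cancel] at h4
    have h5 := Submodule.smul_mem _ (Equiv.Perm.sign (Equiv.swap 0 i) : ℤ) h4
    rw [Finsupp.smul_single, smul_eq_mul, ← Units.val_mul, Int.units_mul_self,
      Units.val_one] at h5
    exact h5
  obtain ⟨r, hr, y, hy, hry⟩ := Submodule.mem_sup.1 key
  obtain ⟨c₀, hc₀, _, ⟨c₁, hc₁, rfl⟩, hsum⟩ := Submodule.mem_sup.1 hy
  refine ⟨c₀, hc₀, c₁, hc₁, ?_⟩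
  rw [hsum, ← hry, add_sub_cancel_right]
  exact hr

end Contraction

/-! ### The kernel of the Laplace transform on chains -/

section Kernel

variable {X W : Type*} [AddCommGroup W] [Module ℝ W] {d : ℕ} {f : X → W}

/-- The apex contributes one factor `(ξ (f v))⁻¹` and the rest is a transform for the contracted
form. This isolates the pole along `ξ (f v) = 0`. -/
theorem simplexRatio_coneMap (D : W [⋀^Fin (d + 1)]→ₗ[ℝ] ℝ) (ξ : W →ₗ[ℝ] ℝ) (v : X)
    (c : (Fin d → X) →₀ ℤ) :
    simplexRatio f D ξ (coneMap v c) =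
      (ξ (f v))⁻¹ * simplexRatio f (D.curryLeft (f v)) ξ c := by
  induction c using Finsupp.induction_linear with
  | zero => simp
  | add a b ha hb => rw [map_add, map_add, ha, hb, map_add, mul_add]
  | single a k =>
    rw [coneMap_single, simplexRatio_single, simplexRatio_single, comp_cons,
      AlternatingMap.curryLeft_apply_apply, Fin.prod_univ_succ]
    simp only [Fin.cons_zero, Fin.cons_succ]
    rw [div_mul_eq_div_div_swap, div_eq_mul_inv _ (ξ (f v))]
    ring

-- No denominator vanishes at `ξ`, so the transform is continuous along the line. It is meant for
-- the chains `c₀` and `c₁`, whose labels are not parallel to `v`.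
open Filter Topology in
theorem tendsto_simplexRatio {S : Set X} (D : W [⋀^Fin d]→ₗ[ℝ] ℝ) {ξ η : W →ₗ[ℝ] ℝ}
    (hξ : ∀ s ∈ S, ξ (f s) ≠ 0) {c : (Fin d → X) →₀ ℤ}
    (hc : c ∈ Finsupp.supported ℤ ℤ {a : Fin d → X | ∀ i, a i ∈ S}) :
    Tendsto (fun t : ℝ => simplexRatio f D (ξ + t • η) c) (𝓝[≠] 0) (𝓝 (simplexRatio f D ξ c)) := by
  simp only [simplexRatio, Finsupp.linearCombination_apply, Finsupp.sum]
  refine tendsto_finsetSum _ fun a ha => ?_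
  refine Tendsto.const_smul (Tendsto.div tendsto_const_nhds ?_ ?_) _
  · refine tendsto_finsetProd _ fun i _ => ?_
    have h : Continuous fun t : ℝ => (ξ + t • η) (f (a i)) := by
      simp only [LinearMap.add_apply, LinearMap.smul_apply, smul_eq_mul]
      fun_prop
    have := h.tendsto 0
    simp only [zero_smul, add_zero] at this
    exact this.mono_left nhdsWithin_le_nhds
  · exact Finset.prod_ne_zero_iff.2 fun i _ => hξ _ (hc ha i)

/-- Over an infinite field one functional on `W ⧸ U` is nonzero at finitely many given nonzero
classes. -/
theorem exists_generic_functional {U : Submodule ℝ W} {B : Finset X} (hB : ∀ b ∈ B, f b ∉ U) :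
    ∃ ξ : W →ₗ[ℝ] ℝ, U ≤ LinearMap.ker ξ ∧ ∀ b ∈ B, ξ (f b) ≠ 0 := by
  obtain ⟨ξ, hξ⟩ := Module.exists_dual_forall_apply_ne_zero (K := ℝ)
    (fun b : B => U.mkQ (f b)) (fun b => by simpa using hB b b.2)
  refine ⟨ξ.comp U.mkQ, fun u hu => ?_, fun b hb => hξ ⟨b, hb⟩⟩
  simp [LinearMap.mem_ker, (Submodule.Quotient.mk_eq_zero U).2 hu]

theorem mem_simplexRelations_zero {S : Set X} (D : W [⋀^Fin 0]→ₗ[ℝ] ℝ) (ξ : W →ₗ[ℝ] ℝ)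
    {c : (Fin 0 → X) →₀ ℤ} (hc : simplexRatio f D ξ c = 0) : c ∈ simplexRelations S f D := by
  have h1 : c = Finsupp.single default (c default) := Finsupp.unique_single c
  rw [h1, simplexRatio_single] at hc
  rcases mul_eq_zero.1 hc with h | h
  · have h2 : c default = 0 := by exact_mod_cast h
    rw [h1, h2, Finsupp.single_zero]
    exact Submodule.zero_mem _
  · have h2 : Finsupp.single (default : Fin 0 → X) (1 : ℤ) ∈ simplexRelations S f D :=
      single_mem_simplexRelations (fun i => i.elim0) (by simpa using h)
    rw [h1]
    simpa using Submodule.smul_mem _ (c default) h2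

open Filter Topology in
/-- If the Laplace transform of a chain vanishes, then the chain is a combination of the relations
between simplices. -/
theorem mem_simplexRelations_of_simplexRatio_eq_zero (f : X → W) (S : Finset X) :
    ∀ (d : ℕ) (D : W [⋀^Fin d]→ₗ[ℝ] ℝ) (U : Submodule ℝ W)
      (B : Finset X), S ⊆ B → (∀ b ∈ B, f b ∉ U) →
      (∀ w : Fin d → W, (∃ i, w i ∈ U) → D w = 0) →
      (∀ ξ : W →ₗ[ℝ] ℝ, U ≤ LinearMap.ker ξ → ∀ w : Fin (d + 1) → W,
        ∑ i : Fin (d + 1), (-1 : ℝ) ^ (i : ℕ) * D (w ∘ i.succAbove) * ξ (w i) = 0) →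
      ∀ c ∈ Finsupp.supported ℤ ℤ {a : Fin d → X | ∀ i, a i ∈ (S : Set X)},
        (∀ ξ : W →ₗ[ℝ] ℝ, U ≤ LinearMap.ker ξ → (∀ b ∈ B, ξ (f b) ≠ 0) →
          simplexRatio f D ξ c = 0) →
        c ∈ simplexRelations (S : Set X) f D := by
  classical
  induction S using Finset.strongInduction with
  | H S ih =>
  -- `B` may exceed `S`: after labels are deleted, vanishing is still known only at functionals that
  -- are nonzero on the original labels.
  intro d D U B hSB hB hDU hcoc c hc hR
  rcases d with _ | d
  · obtain ⟨ξ, h1, h2⟩ := exists_generic_functional hB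
    exact mem_simplexRelations_zero D ξ (hR ξ h1 h2)
  rcases S.eq_empty_or_nonempty with rfl | ⟨v, hv⟩
  · have : c = 0 := by
      rw [← Finsupp.support_eq_empty, Finset.eq_empty_iff_forall_notMem]
      intro a ha
      simpa using hc ha 0
    rw [this]; exact Submodule.zero_mem _
  -- Contraction enlarges `U` by `f v`; deletion removes every label parallel to `v` modulo `U`, and
  -- `v` itself, so `S₁` is strictly smaller.
  set U' := U ⊔ Submodule.span ℝ {f v} with hU'
  set S₁ := S.filter fun s => f s ∉ U' with hS₁
  have hvU' : f v ∈ U' := Submodule.mem_sup_right (Submodule.mem_span_singleton_self _)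
  have hS₁S : S₁ ⊂ S := Finset.filter_ssubset.2 ⟨v, hv, by simpa using hvU'⟩
  have hvS₁ : v ∉ (S₁ : Set X) := by simp [hS₁, hvU']
  obtain ⟨c₀, hc₀, c₁, hc₁, hdec⟩ := exists_decomposition (S := (S : Set X)) (S₁ := (S₁ : Set X))
    (v := v) (U := U) hv (by ext; simp [hS₁, hU']) (fun s hs => hB s (hSB hs)) hDU hc
  have hR' : ∀ ξ : W →ₗ[ℝ] ℝ, U ≤ LinearMap.ker ξ → (∀ b ∈ B, ξ (f b) ≠ 0) →
      simplexRatio f D ξ (c₀ + coneMap v c₁) = 0 := by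
    intro ξ hξU hξ
    have h1 := simplexRatio_eq_zero_of_mem (ξ := ξ) (fun s hs => hξ s (hSB hs)) (hcoc ξ hξU) hdec
    rw [map_sub, hR ξ hξU hξ, zero_sub, neg_eq_zero] at h1
    exact h1
  -- The direction transversal to the pole: if `ξ (f v) = 0`, then `(ξ + t • η) (f v) = t`.
  obtain ⟨η, hηU, hηv⟩ : ∃ η : W →ₗ[ℝ] ℝ, U ≤ LinearMap.ker η ∧ η (f v) = 1 := by
    obtain ⟨η, h1, h2⟩ := Submodule.exists_le_ker_of_notMem (hB v (hSB hv))
    refine ⟨(η (f v))⁻¹ • η, fun u hu => ?_, by simp [h1]⟩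
    have : η u = 0 := h2 hu
    simp [LinearMap.mem_ker, this]
  -- Contraction: the residue of the transform along `ξ (f v) = 0` is that of `c₁` for `D.curryLeft
  -- (f v)`, and it vanishes.
  have hc₁rel : c₁ ∈ simplexRelations (S₁ : Set X) f (D.curryLeft (f v)) := by
    refine ih S₁ hS₁S d (D.curryLeft (f v)) U' (B.filter fun b => f b ∉ U')
      (Finset.filter_subset_filter _ hSB) (fun b hb => (Finset.mem_filter.1 hb).2) ?_ ?_ c₁ hc₁ ?_
    · rintro w ⟨i, hi⟩
      obtain ⟨u, hu, y, hy, hsum⟩ := Submodule.mem_sup.1 hi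
      obtain ⟨t, rfl⟩ := Submodule.mem_span_singleton.1 hy
      rw [← Function.update_eq_self i w, ← hsum, AlternatingMap.map_update_add,
        AlternatingMap.map_update_smul, AlternatingMap.curryLeft_apply_apply,
        AlternatingMap.curryLeft_apply_apply, hDU _ ⟨i.succ, by simpa using hu⟩,
        D.map_eq_zero_of_eq (i := 0) (j := i.succ) _ (by simp) (Fin.succ_ne_zero i).symm]
      simp
    -- The cocycle identity is inherited by prepending `f v`: the new first term contains `ξ (f v) =
    -- 0`.
    · intro ξ hξ w
      have h1 := hcoc ξ (le_sup_left.trans hξ) (Matrix.vecCons (f v) w)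
      have h0 : ξ (f v) = 0 := hξ hvU'
      rw [Fin.sum_univ_succ] at h1
      have h2 : ∀ i : Fin (d + 1), Matrix.vecCons (f v) w ∘ i.succ.succAbove =
        Matrix.vecCons (f v) (w ∘ i.succAbove) := fun i => cons_comp_succ_succAbove _ _ _
      simp only [Matrix.cons_val_zero, h0, mul_zero, zero_add, h2, Matrix.cons_val_succ,
        Fin.val_succ, pow_succ, ← AlternatingMap.curryLeft_apply_apply] at h1
      simpa [Finset.sum_neg_distrib] using h1
    · intro ξ hξU hξ
      have h0 : ξ (f v) = 0 := hξU hvU'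
      have hS₁ξ : ∀ s ∈ (S₁ : Set X), ξ (f s) ≠ 0 := fun s hs =>
        hξ s (Finset.filter_subset_filter _ hSB hs)
      have hgen : ∀ᶠ t : ℝ in 𝓝[≠] 0, ∀ b ∈ B, (ξ + t • η) (f b) ≠ 0 := by
        rw [Filter.eventually_all_finset]
        intro b hb
        by_cases hbU : f b ∈ U'
        · obtain ⟨u, hu, y, hy, hsum⟩ := Submodule.mem_sup.1 hbU
          obtain ⟨r, rfl⟩ := Submodule.mem_span_singleton.1 hy
          have hr : r ≠ 0 := by
            rintro rfl
            apply hB b hb; rw [← hsum]; simpa using hu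
          filter_upwards [self_mem_nhdsWithin] with t ht
          have h1 : ξ u = 0 := hξU (Submodule.mem_sup_left hu)
          have h2 : η u = 0 := hηU hu
          rw [← hsum]
          simpa [h0, h1, h2, hηv] using ⟨ht, hr⟩
        · have h : Continuous fun t : ℝ => (ξ + t • η) (f b) := by
            simp only [LinearMap.add_apply, LinearMap.smul_apply, smul_eq_mul]
            fun_prop
          refine (h.continuousAt.eventually_ne ?_).filter_mono nhdsWithin_le_nhds
          simpa using hξ b (Finset.mem_filter.2 ⟨hb, hbU⟩)
      have hlim₀ := tendsto_simplexRatio (η := η) D hS₁ξ hc₀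
      have hlim₁ := tendsto_simplexRatio (η := η) (D.curryLeft (f v)) hS₁ξ hc₁
      have hid : Tendsto (fun t : ℝ => t) (𝓝[≠] 0) (𝓝 0) := nhdsWithin_le_nhds
      -- Multiplied by `t`, the identity reads `t * R(c₀) + R(c₁) = 0`; the limit `t → 0` leaves the
      -- residue.
      have hlim := (hid.mul hlim₀).add hlim₁
      rw [zero_mul, zero_add] at hlim
      refine tendsto_nhds_unique hlim ?_
      refine tendsto_const_nhds.congr' ?_
      filter_upwards [hgen, self_mem_nhdsWithin] with t ht ht0
      have h1 := hR' (ξ + t • η) (fun u hu => by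
        have h2 : ξ u = 0 := hξU (Submodule.mem_sup_left hu)
        have h3 : η u = 0 := hηU hu
        simp [LinearMap.mem_ker, h2, h3]) ht
      have ht0' : t ≠ 0 := ht0
      rw [map_add, simplexRatio_coneMap] at h1
      have h4 : (ξ + t • η) (f v) = t := by simp [h0, hηv]
      rw [h4] at h1
      field_simp at h1
      linarith
  -- Deletion: coning the relation `c₁` costs a chain `e` on `S₁`. Then `c₀ + e` has fewer labels
  -- and still vanishing transform, with `D`, `U` and `B` unchanged.
  obtain ⟨r, hr, e, he, hre⟩ := Submodule.mem_sup.1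
    (coneMap_mem_of_mem_simplexRelations (Finset.coe_subset.2 hS₁S.1) hv hvS₁ hc₁rel)
  have hc' : c - (c₀ + e) ∈ simplexRelations (S : Set X) f D := by
    have := Submodule.add_mem _ hdec hr
    rw [← hre] at this
    convert this using 1
    abel
  have hfin : c₀ + e ∈ simplexRelations (S₁ : Set X) f D := by
    refine ih S₁ hS₁S (d + 1) D U B (hS₁S.1.trans hSB) hB hDU hcoc _
      (Submodule.add_mem _ hc₀ he) fun ξ hξU hξ => ?_
    have h1 := simplexRatio_eq_zero_of_mem (ξ := ξ) (fun s hs => hξ s (hSB hs)) (hcoc ξ hξU) hc'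
    rw [map_sub, hR ξ hξU hξ, zero_sub, neg_eq_zero] at h1
    exact h1
  simpa using Submodule.add_mem _ hc' (simplexRelations_mono (Finset.coe_subset.2 hS₁S.1) hfin)

end Kernel

/-! ### Laplace transforms of simplicial cones -/

section LaplaceTransform

open MeasureTheory

variable {m : ℕ}

/-- The open simplicial cone spanned by `y`. -/
def openCone (y : Fin m → Fin m → ℝ) : Set (Fin m → ℝ) :=
  {x | ∃ t : Fin m → ℝ, (∀ i, 0 < t i) ∧ x = ∑ i, t i • y i}

/-- The closed simplicial cone spanned by `y`. -/
def closedCone (y : Fin m → Fin m → ℝ) : Set (Fin m → ℝ) :=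
  {x | ∃ t : Fin m → ℝ, (∀ i, 0 ≤ t i) ∧ x = ∑ i, t i • y i}

/-- The linear map sending the standard basis to `y`. -/
noncomputable def coneLinearMap (y : Fin m → Fin m → ℝ) : (Fin m → ℝ) →L[ℝ] (Fin m → ℝ) :=
  (Matrix.toLin' (Matrix.of y).transpose).toContinuousLinearMap

theorem coneLinearMap_apply (y : Fin m → Fin m → ℝ) (t : Fin m → ℝ) :
    coneLinearMap y t = ∑ i, t i • y i := by
  simp only [coneLinearMap, LinearMap.coe_toContinuousLinearMap', Matrix.toLin'_apply,
    Matrix.mulVec_transpose, Matrix.vecMul_eq_sum]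
  rfl

theorem det_coneLinearMap (y : Fin m → Fin m → ℝ) :
    (coneLinearMap y).det = Matrix.detRowAlternating y := by
  rw [coneLinearMap, LinearMap.det_toContinuousLinearMap, LinearMap.det_toLin',
    Matrix.det_transpose]
  rfl

theorem openCone_eq_image (y : Fin m → Fin m → ℝ) :
    openCone y = coneLinearMap y '' Set.univ.pi fun _ => Set.Ioi 0 := by
  ext x
  simp only [openCone, Set.mem_ofPred_eq, Set.mem_image, Set.mem_univ_pi, Set.mem_Ioi,
    coneLinearMap_apply, eq_comm (a := x)]

theorem coneLinearMap_injective {y : Fin m → Fin m → ℝ} (hy : Matrix.detRowAlternating y ≠ 0) :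
    Function.Injective (coneLinearMap y) := by
  rw [← det_coneLinearMap] at hy
  exact (LinearMap.equivOfDetNeZero (coneLinearMap y : (Fin m → ℝ) →ₗ[ℝ] _) hy).injective

theorem measurableSet_openCone {y : Fin m → Fin m → ℝ} (hy : Matrix.detRowAlternating y ≠ 0) :
    MeasurableSet (openCone y) := by
  rw [openCone_eq_image]
  refine MeasurableSet.image_of_continuousOn_injOn
    (MeasurableSet.univ_pi fun _ => measurableSet_Ioi) (coneLinearMap y).continuous.continuousOn
    (coneLinearMap_injective hy).injOn

/-- A linear change of variables moves the integral to the positive orthant, where the exponential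
splits into one-variable factors, each integrating to `1 / ξ (y i)`. -/
theorem integral_openCone {y : Fin m → Fin m → ℝ} (hy : Matrix.detRowAlternating y ≠ 0)
    {ξ : (Fin m → ℝ) →ₗ[ℝ] ℝ} (hξ : ∀ i, 0 < ξ (y i)) :
    ∫ x in openCone y, Real.exp (-ξ x) =
      |Matrix.detRowAlternating y| / ∏ i, ξ (y i) := by
  rw [openCone_eq_image, integral_image_eq_integral_abs_det_fderiv_smul volume
    (MeasurableSet.univ_pi fun _ => measurableSet_Ioi)
    (fun x _ => (coneLinearMap y).hasFDerivAt.hasFDerivWithinAt) (coneLinearMap_injective hy).injOn,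
    det_coneLinearMap, integral_smul, smul_eq_mul, div_eq_mul_inv]
  congr 1
  rw [← integral_indicator (MeasurableSet.univ_pi fun _ => measurableSet_Ioi)]
  have h1 : (Set.univ.pi fun _ : Fin m => Set.Ioi (0 : ℝ)).indicator
      (fun t => Real.exp (-ξ (coneLinearMap y t))) =
      fun t => ∏ i, (Set.Ioi (0 : ℝ)).indicator (fun r => Real.exp (-ξ (y i) * r)) (t i) := by
    funext t
    by_cases ht : t ∈ Set.univ.pi fun _ : Fin m => Set.Ioi (0 : ℝ)
    · rw [Set.indicator_of_mem ht, coneLinearMap_apply, map_sum, ← Finset.sum_neg_distrib,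
        Real.exp_sum]
      refine Finset.prod_congr rfl fun i _ => ?_
      rw [Set.indicator_of_mem (ht i (Set.mem_univ i)), map_smul, smul_eq_mul]
      ring_nf
    · rw [Set.indicator_of_notMem ht]
      simp only [Set.mem_univ_pi, not_forall] at ht
      obtain ⟨i, hi⟩ := ht
      exact (Finset.prod_eq_zero (Finset.mem_univ i) (Set.indicator_of_notMem hi _)).symm
  rw [h1, integral_fintype_prod_volume_eq_prod
    fun i => (Set.Ioi (0 : ℝ)).indicator (fun r => Real.exp (-ξ (y i) * r)),
    ← Finset.prod_inv_distrib]
  refine Finset.prod_congr rfl fun i _ => ?_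
  rw [integral_indicator measurableSet_Ioi, integral_exp_mul_Ioi (by simpa using hξ i)]
  simp

/-- The integral of a non-integrable function is zero by convention, whereas the value computed
above is positive. -/
theorem integrableOn_openCone {y : Fin m → Fin m → ℝ} (hy : Matrix.detRowAlternating y ≠ 0)
    {ξ : (Fin m → ℝ) →ₗ[ℝ] ℝ} (hξ : ∀ i, 0 < ξ (y i)) :
    IntegrableOn (fun x => Real.exp (-ξ x)) (openCone y) := by
  by_contra h
  have h1 := integral_openCone hy hξ
  rw [integral_undef h] at h1
  have h2 : 0 < |Matrix.detRowAlternating y| / ∏ i, ξ (y i) :=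
    div_pos (abs_pos.2 hy) (Finset.prod_pos fun i _ => hξ i)
  exact h2.ne h1

theorem openCone_subset_closedCone (y : Fin m → Fin m → ℝ) : openCone y ⊆ closedCone y :=
  fun _ ⟨t, ht, hx⟩ => ⟨t, fun i => (ht i).le, hx⟩

/-- The difference is covered by linear images of coordinate hyperplanes, which are null. -/
theorem volume_closedCone_diff_openCone (y : Fin m → Fin m → ℝ) :
    volume (closedCone y \ openCone y) = 0 := by
  have h1 : closedCone y \ openCone y ⊆ ⋃ i, coneLinearMap y '' {t | t i = 0} := by
    rintro x ⟨⟨t, ht, hx⟩, hx'⟩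
    have h2 : ∃ i, ¬ 0 < t i := by
      by_contra h
      push Not at h
      exact hx' ⟨t, h, hx⟩
    obtain ⟨i, hi⟩ := h2
    refine Set.mem_iUnion.2 ⟨i, t, le_antisymm (not_lt.1 hi) (ht i), ?_⟩
    rw [coneLinearMap_apply, hx]
  refine measure_mono_null h1 (measure_iUnion_null fun i => ?_)
  rw [Measure.addHaar_image_continuousLinearMap]
  have h3 : volume {t : Fin m → ℝ | t i = 0} = 0 := by
    have := Measure.pi_hyperplane (fun _ : Fin m => (volume : Measure ℝ)) i 0
    exact this
  rw [h3, mul_zero]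

end LaplaceTransform

/-! ### Rational continuation along a line of functionals -/

section GenericExtension

variable {X W : Type*} [AddCommGroup W] [Module ℝ W] {d : ℕ} {f : X → W}

open Polynomial Filter Topology in
/-- If the Laplace transform of a chain vanishes near `ξ₀`, then it vanishes wherever it is
defined. -/
theorem simplexRatio_eq_zero_of_eventually {S : Finset X} (D : W [⋀^Fin d]→ₗ[ℝ] ℝ)
    {c : (Fin d → X) →₀ ℤ} (hc : c ∈ Finsupp.supported ℤ ℤ {a : Fin d → X | ∀ i, a i ∈ S})
    {ξ₀ ξ : W →ₗ[ℝ] ℝ} (hξ₀ : ∀ s ∈ S, ξ₀ (f s) ≠ 0)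
    (h : ∀ᶠ t : ℝ in 𝓝[≠] 0, simplexRatio f D (ξ₀ + t • (ξ - ξ₀)) c = 0)
    (hξ : ∀ s ∈ S, ξ (f s) ≠ 0) : simplexRatio f D ξ c = 0 := by
  classical
  set η := ξ - ξ₀ with hη
  -- The transform along the line from `ξ₀` to `ξ`, multiplied by all linear factors from `S`. The
  -- cofactor over `S \ image a` is correct for injective `a`; for other symbols `D` vanishes.
  set q : ℝ[X] := ∑ a ∈ c.support, C ((c a : ℝ) * D (f ∘ a)) *
    ∏ s ∈ S \ Finset.univ.image a, (C (ξ₀ (f s)) + Polynomial.X * C (η (f s))) with hq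
  have heval : ∀ t : ℝ, (∀ s ∈ S, (ξ₀ + t • η) (f s) ≠ 0) →
      q.eval t = (∏ s ∈ S, (ξ₀ + t • η) (f s)) * simplexRatio f D (ξ₀ + t • η) c := by
    intro t ht
    rw [hq, eval_finsetSum, simplexRatio, Finsupp.linearCombination_apply, Finsupp.sum,
      Finset.mul_sum]
    refine Finset.sum_congr rfl fun a ha => ?_
    rw [eval_mul, eval_C, eval_prod]
    by_cases hD : D (f ∘ a) = 0
    · simp [hD]
    have hinj : Function.Injective a := by
      intro i j hij
      by_contra hne
      exact hD (D.map_eq_zero_of_eq (i := i) (j := j) _ (by simp [hij]) hne)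
    have hsub : Finset.univ.image a ⊆ S := by
      intro s hs
      obtain ⟨i, -, rfl⟩ := Finset.mem_image.1 hs
      exact hc ha i
    rw [← Finset.prod_sdiff hsub, Finset.prod_image fun i _ j _ hij => hinj hij]
    have h0 : ∏ i, (ξ₀ + t • η) (f (a i)) ≠ 0 := Finset.prod_ne_zero_iff.2 fun i _ => ht _ (hc ha i)
    have h1 : ∏ s ∈ S \ Finset.univ.image a, eval t (C (ξ₀ (f s)) + Polynomial.X * C (η (f s))) =
        ∏ s ∈ S \ Finset.univ.image a, (ξ₀ + t • η) (f s) := by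
      refine Finset.prod_congr rfl fun s _ => ?_
      simp only [eval_add, eval_C, eval_mul, eval_X, LinearMap.add_apply, LinearMap.smul_apply,
        smul_eq_mul]
    rw [h1, zsmul_eq_mul]
    field_simp
  have hgen : ∀ᶠ t : ℝ in 𝓝[≠] 0, ∀ s ∈ S, (ξ₀ + t • η) (f s) ≠ 0 := by
    rw [Filter.eventually_all_finset]
    intro b hb
    have hcont : Continuous fun t : ℝ => (ξ₀ + t • η) (f b) := by
      simp only [LinearMap.add_apply, LinearMap.smul_apply, smul_eq_mul]
      fun_prop
    refine (hcont.continuousAt.eventually_ne ?_).filter_mono nhdsWithin_le_nhds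
    simpa using hξ₀ b hb
  have hq0 : q = 0 := by
    refine Polynomial.eq_zero_of_infinite_isRoot q ?_
    have h2 : ∀ᶠ t : ℝ in 𝓝[≠] 0, q.IsRoot t := by
      filter_upwards [h, hgen] with t h3 h4
      rw [IsRoot, heval t h4, h3, mul_zero]
    intro hfin
    have h3 : insert 0 {x | q.IsRoot x} ∈ 𝓝 (0 : ℝ) := insert_mem_nhds_iff.2 h2
    exact infinite_of_mem_nhds 0 h3 (hfin.insert 0)
  -- The line reaches `ξ` at `t = 1`.
  have h1 := heval 1 (by simpa [hη] using hξ)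
  rw [hq0, eval_zero, one_smul, hη, add_sub_cancel] at h1
  exact (mul_eq_zero.1 h1.symm).resolve_left (Finset.prod_ne_zero_iff.2 hξ)

end GenericExtension

/-! ### Enumerations of finite vertex sets -/

theorem sum_range_eq {V : Type*} {m : ℕ} {M : Type*} [AddCommMonoid M] {σ : Finset V}
    {a : Fin m → V}
    (ha : Function.Injective a) (hσ : Set.range a = (σ : Set V)) (g : V → M) :
    ∑ i, g (a i) = ∑ x ∈ σ, g x := by
  classical
  have : σ = Finset.univ.image a := by
    rw [← Finset.coe_inj, ← hσ]; simp
  rw [this, Finset.sum_image fun i _ j _ h => ha h]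

theorem exists_enumeration {V : Type*} {m : ℕ} {σ : Finset V} (h : σ.card = m) :
    ∃ a : Fin m → V, Function.Injective a ∧ Set.range a = (σ : Set V) := by
  refine ⟨fun i => (σ.equivFinOfCardEq h).symm i, fun i j hij => ?_, ?_⟩
  · exact (σ.equivFinOfCardEq h).symm.injective (Subtype.ext hij)
  · ext x
    constructor
    · rintro ⟨i, rfl⟩; exact ((σ.equivFinOfCardEq h).symm i).2
    · intro hx
      exact ⟨σ.equivFinOfCardEq h ⟨x, hx⟩, by simp⟩

/-! ### Homogeneous coordinates and affine dependencies -/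

section Homogenization

variable {V : Type*} [AddCommGroup V] [Module ℝ V]

/-- Homogeneous coordinates for the affine hull of `P`. -/
structure IsHomogenization {n : ℕ} (P : Set V) (f : V →ᵃ[ℝ] (Fin (n + 1) → ℝ))
    (ξ : (Fin (n + 1) → ℝ) →ₗ[ℝ] ℝ) : Prop where
  height : ∀ x ∈ P, ξ (f x) = 1
  inj : ∀ x ∈ vectorSpan ℝ P, f.linear x = 0 → x = 0

/-- The affine independence of the points of a finite set, in terms of weights. -/
theorem affineIndependent_finset_iff {σ : Finset V} :
    AffineIndependent ℝ (Subtype.val : {x : V // x ∈ σ} → V) ↔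
      ∀ w : V → ℝ, ∑ x ∈ σ, w x = 0 → ∑ x ∈ σ, w x • x = 0 → ∀ x ∈ σ, w x = 0 := by
  classical
  rw [affineIndependent_iff]
  constructor
  · intro h w h1 h2 x hx
    refine h σ.attach (fun y => w y) ?_ ?_ ⟨x, hx⟩ (Finset.mem_attach _ _)
    · rw [← h1]; exact Finset.sum_attach σ w
    · rw [← h2]; exact Finset.sum_attach σ fun x => w x • x
  · intro h s w h1 h2 e he
    set w' : V → ℝ := fun x => if hx : x ∈ σ then (if ⟨x, hx⟩ ∈ s then w ⟨x, hx⟩ else 0) else 0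
      with hw'
    have h3 : ∀ y : {x : V // x ∈ σ}, w' y = if y ∈ s then w y else 0 := fun y => by
      simp [hw', y.2]
    have h4 := h w' ?_ ?_ e e.2
    · rw [h3, if_pos he] at h4; exact h4
    · rw [← Finset.sum_attach, Finset.sum_congr rfl fun y _ => h3 y, ← Finset.sum_filter]
      rw [← h1]; congr 1; ext y; simp
    · rw [← Finset.sum_attach σ fun x => w' x • x,
        Finset.sum_congr rfl fun y _ => by rw [h3 y, ite_smul, zero_smul], ← Finset.sum_filter]
      rw [← h2]; congr 1; ext y; simp

theorem affineIndependent_subset {σ τ : Finset V} (h : τ ⊆ σ)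
    (hσ : AffineIndependent ℝ (Subtype.val : {x : V // x ∈ σ} → V)) :
    AffineIndependent ℝ (Subtype.val : {x : V // x ∈ τ} → V) :=
  AffineIndependent.mono (s := (τ : Set V)) (t := (σ : Set V)) hσ h

/-- A point of a simplex in the hull of some of the vertices has its support among them. -/
theorem mem_of_weight_ne_zero {σ τ : Finset V}
    (hσ : AffineIndependent ℝ (Subtype.val : {x : V // x ∈ σ} → V)) (hτ : τ ⊆ σ) {w : V → ℝ}
    (hw : ∑ x ∈ σ, w x = 1) (hmem : ∑ x ∈ σ, w x • x ∈ convexHull ℝ (τ : Set V)) {x : V}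
    (hx : x ∈ σ) (hx0 : w x ≠ 0) : x ∈ τ := by
  classical
  obtain ⟨w', -, h1, h2⟩ := Finset.mem_convexHull'.1 hmem
  have e1 : ∑ x ∈ σ, (if x ∈ τ then w' x else 0) = 1 := by
    rw [← Finset.sum_filter, Finset.filter_mem_eq_inter, Finset.inter_eq_right.2 hτ, h1]
  have e2 : ∑ x ∈ σ, (if x ∈ τ then w' x else 0) • x = ∑ x ∈ σ, w x • x := by
    rw [← h2]
    simp only [ite_smul, zero_smul]
    rw [← Finset.sum_filter, Finset.filter_mem_eq_inter, Finset.inter_eq_right.2 hτ]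
  have h3 := affineIndependent_finset_iff.1 hσ (fun x => w x - if x ∈ τ then w' x else 0)
    (by rw [Finset.sum_sub_distrib, hw, e1, sub_self])
    (by simp only [sub_smul]; rw [Finset.sum_sub_distrib, e2, sub_self]) x hx
  by_contra h
  simp only [h, if_false, sub_zero] at h3
  exact hx0 h3

theorem affineIndependent_comp_iff {m : ℕ} {σ : Finset V} {a : Fin m → V}
    (ha : Function.Injective a) (hσ : Set.range a = (σ : Set V)) :
    AffineIndependent ℝ a ↔ AffineIndependent ℝ (Subtype.val : {x : V // x ∈ σ} → V) := by
  have h1 := affineIndependent_equiv (k := ℝ) ((Equiv.ofInjective a ha).trans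
    (Equiv.setCongr hσ)) (p := (Subtype.val : {x : V // x ∈ (σ : Set V)} → V))
  exact h1

theorem IsTriangulation.subset {P : Set V} {T : Finset (Finset V)} (hT : IsTriangulation P T)
    {σ : Finset V} (hσ : σ ∈ T) : (σ : Set V) ⊆ P :=
  (hT.vertices σ hσ).trans extremePoints_subset

variable {n : ℕ} {P : Set V} {f : V →ᵃ[ℝ] (Fin (n + 1) → ℝ)} {ξ : (Fin (n + 1) → ℝ) →ₗ[ℝ] ℝ}

theorem map_sum_smul_of_height (f : V →ᵃ[ℝ] (Fin (n + 1) → ℝ)) {ι : Type*} (s : Finset ι)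
    (w : ι → ℝ) (a : ι → V) : ∑ i ∈ s, w i • f (a i) =
      f.linear (∑ i ∈ s, w i • a i) + (∑ i ∈ s, w i) • f 0 := by
  have h : ∀ x, f x = f.linear x + f 0 := fun x => by rw [AffineMap.decomp' f]; simp
  rw [map_sum, Finset.sum_smul, ← Finset.sum_add_distrib]
  refine Finset.sum_congr rfl fun i _ => ?_
  rw [h (a i), smul_add, map_smul]

theorem sum_smul_mem_vectorSpan {ι : Type*} (s : Finset ι) (w : ι → ℝ) (a : ι → V)
    (ha : ∀ i ∈ s, a i ∈ P) (hw : ∑ i ∈ s, w i = 0) : ∑ i ∈ s, w i • a i ∈ vectorSpan ℝ P := by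
  rcases s.eq_empty_or_nonempty with rfl | ⟨j, hj⟩
  · simp
  have h1 : ∑ i ∈ s, w i • a i = ∑ i ∈ s, w i • (a i - a j) := by
    simp only [smul_sub]
    rw [Finset.sum_sub_distrib, ← Finset.sum_smul, hw, zero_smul, sub_zero]
  rw [h1]
  exact Submodule.sum_mem _ fun i hi => Submodule.smul_mem _ _
    (vsub_mem_vectorSpan ℝ (ha i hi) (ha j hj))

/-- Since `ξ` equals one on all the points, applying it to a linear relation shows that the weights
sum to zero, so linear relations upstairs are affine relations downstairs. -/
theorem IsHomogenization.linearIndependent_iff (hf : IsHomogenization P f ξ) {m : ℕ}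
    {a : Fin m → V} (ha : ∀ i, a i ∈ P) :
    LinearIndependent ℝ (f ∘ a) ↔ AffineIndependent ℝ a := by
  rw [linearIndependent_iff', affineIndependent_iff]
  constructor
  · intro h s w h1 h2
    refine h s w ?_
    simp only [Function.comp_apply]
    rw [map_sum_smul_of_height, h1, h2]; simp
  · intro h s w h1
    simp only [Function.comp_apply] at h1
    have h2 : ∑ i ∈ s, w i = 0 := by
      have := congrArg ξ h1
      simpa [map_sum, hf.height _ (ha _)] using this
    refine h s w h2 (hf.inj _ (sum_smul_mem_vectorSpan s w a (fun i _ => ha i) h2) ?_)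
    rw [map_sum_smul_of_height, h2] at h1
    simpa using h1

theorem IsHomogenization.det_ne_zero_iff (hf : IsHomogenization P f ξ) {a : Fin (n + 1) → V}
    (ha : ∀ i, a i ∈ P) :
    Matrix.detRowAlternating (f ∘ a) ≠ 0 ↔ AffineIndependent ℝ a := by
  rw [← hf.linearIndependent_iff ha]
  have := Matrix.linearIndependent_rows_iff_isUnit (A := (Matrix.of (f ∘ a)))
  rw [Matrix.isUnit_iff_isUnit_det, isUnit_iff_ne_zero] at this
  exact this.symm

/-- Comparing heights gives equal total weights. The difference of the two combinations then lies in
`vectorSpan ℝ P`, where `f.linear` is injective. -/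
theorem IsHomogenization.sum_eq (hf : IsHomogenization P f ξ) {ι κ : Type*} {s : Finset ι}
    {t : Finset κ} {w : ι → ℝ} {u : κ → ℝ} {a : ι → V} {b : κ → V} (ha : ∀ i ∈ s, a i ∈ P)
    (hb : ∀ i ∈ t, b i ∈ P) (h : ∑ i ∈ s, w i • f (a i) = ∑ i ∈ t, u i • f (b i)) :
    ∑ i ∈ s, w i = ∑ i ∈ t, u i ∧ ∑ i ∈ s, w i • a i = ∑ i ∈ t, u i • b i := by
  have h1 : ∑ i ∈ s, w i = ∑ i ∈ t, u i := by
    have := congrArg ξ h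
    rw [map_sum, map_sum] at this
    rw [Finset.sum_congr rfl fun i hi => by rw [map_smul, hf.height _ (ha i hi)]] at this
    rw [Finset.sum_congr (s₁ := t) rfl fun i hi => by rw [map_smul, hf.height _ (hb i hi)]] at this
    simpa using this
  refine ⟨h1, ?_⟩
  rw [← sub_eq_zero]
  refine hf.inj _ ?_ ?_
  · have h2 := sum_smul_mem_vectorSpan (P := P) (s.disjSum t) (Sum.elim w fun i => -u i)
      (Sum.elim a b) ?_ ?_
    · rw [Finset.sum_disjSum] at h2
      simpa [sub_eq_add_neg] using h2
    · intro i hi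
      rcases i with i | i
      · exact ha i (Finset.inl_mem_disjSum.1 hi)
      · exact hb i (Finset.inr_mem_disjSum.1 hi)
    · rw [Finset.sum_disjSum]; simp [h1]
  · rw [map_sum_smul_of_height, map_sum_smul_of_height, h1] at h
    rw [map_sub, sub_eq_zero]
    exact add_right_cancel h

end Homogenization

/-! ### Triangulations as chains of cones -/

section TriangulationChains

variable {V : Type*} [AddCommGroup V] [Module ℝ V] {n : ℕ} {P : Set V}
  {f : V →ᵃ[ℝ] (Fin (n + 1) → ℝ)} {ξ : (Fin (n + 1) → ℝ) →ₗ[ℝ] ℝ} {T T' : Finset (Finset V)}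

/-- A choice of an order of the vertices of each simplex of `T`. -/
def IsEnumeration {V : Type*} {n : ℕ} (T : Finset (Finset V))
    (a : Finset V → Fin (n + 1) → V) : Prop :=
  ∀ σ ∈ T, Function.Injective (a σ) ∧ Set.range (a σ) = (σ : Set V)

theorem IsEnumeration.mem {V : Type*} {n : ℕ} {T : Finset (Finset V)}
    {a : Finset V → Fin (n + 1) → V} (h : IsEnumeration T a) {σ : Finset V} (hσ : σ ∈ T) (i : Fin (n + 1)) : a σ i ∈ σ := by
  have : a σ i ∈ (σ : Set V) := (h σ hσ).2 ▸ Set.mem_range_self i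
  exact this

theorem IsTriangulation.det_ne_zero (hT : IsTriangulation P T) (hf : IsHomogenization P f ξ)
    {a : Finset V → Fin (n + 1) → V} (ha : IsEnumeration T a) {σ : Finset V} (hσ : σ ∈ T) :
    Matrix.detRowAlternating (f ∘ a σ) ≠ 0 :=
  (hf.det_ne_zero_iff fun i => hT.subset hσ (ha.mem hσ i)).2
    ((affineIndependent_comp_iff (ha σ hσ).1 (ha σ hσ).2).2 (hT.indep σ hσ))

theorem exists_weights {V : Type*} {m : ℕ} {a : Fin m → V} (ha : Function.Injective a)
    (t : Fin m → ℝ) : ∃ w : V → ℝ, ∀ i, w (a i) = t i :=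
  ⟨Function.extend a t 0, fun i => ha.extend_apply t 0 i⟩

/-- A common point of the open cones rescales to a point of both simplices with all coordinates in
`σ` positive. It lies in the common face, so `σ ⊆ τ`, and equal cardinalities force `σ = τ`. -/
theorem IsTriangulation.disjoint_openCone (hT : IsTriangulation P T)
    (hf : IsHomogenization P f ξ) {a : Finset V → Fin (n + 1) → V} (ha : IsEnumeration T a)
    {σ τ : Finset V} (hσ : σ ∈ T) (hτ : τ ∈ T) (hne : σ ≠ τ) :
    Disjoint (openCone (f ∘ a σ)) (openCone (f ∘ a τ)) := by
  classical
  rw [Set.disjoint_left]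
  rintro x ⟨t, ht, hx⟩ ⟨u, hu, hx'⟩
  obtain ⟨w, hw⟩ := exists_weights (ha σ hσ).1 t
  have hmemσ : ∀ i, a σ i ∈ P := fun i => hT.subset hσ (ha.mem hσ i)
  have hmemτ : ∀ i, a τ i ∈ P := fun i => hT.subset hτ (ha.mem hτ i)
  obtain ⟨h1, h2⟩ := hf.sum_eq (s := Finset.univ) (t := Finset.univ) (w := t) (u := u)
    (fun i _ => hmemσ i) (fun i _ => hmemτ i) (hx.symm.trans hx')
  set r := ∑ i, t i with hr
  have hr0 : 0 < r := Finset.sum_pos (fun i _ => ht i) Finset.univ_nonempty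
  have hp1 : r⁻¹ • ∑ i, t i • a σ i ∈ convexHull ℝ (σ : Set V) := by
    have := Finset.centerMass_mem_convexHull (R := ℝ) Finset.univ (w := t) (z := a σ)
      (s := (σ : Set V)) (fun i _ => (ht i).le) hr0 (fun i _ => ha.mem hσ i)
    exact this
  have hp2 : r⁻¹ • ∑ i, t i • a σ i ∈ convexHull ℝ (τ : Set V) := by
    have := Finset.centerMass_mem_convexHull (R := ℝ) Finset.univ (w := u) (z := a τ)
      (s := (τ : Set V)) (fun i _ => (hu i).le) (h1 ▸ hr0) (fun i _ => ha.mem hτ i)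
    rw [h2, h1]
    exact this
  have hp3 : r⁻¹ • ∑ i, t i • a σ i ∈ convexHull ℝ ((σ ∩ τ : Finset V) : Set V) := by
    rw [Finset.coe_inter, ← hT.inter σ hσ τ hτ hne]; exact ⟨hp1, hp2⟩
  have hsub : σ ⊆ τ := by
    intro y hy
    have hy' : y ∈ (σ : Set V) := hy
    rw [← (ha σ hσ).2] at hy'
    obtain ⟨i, rfl⟩ := hy'
    have h3 := mem_of_weight_ne_zero (hT.indep σ hσ) (Finset.inter_subset_left (s₂ := τ))
      (w := fun x => r⁻¹ * w x) ?_ ?_ hy ?_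
    · exact (Finset.mem_inter.1 h3).2
    · rw [← Finset.mul_sum, ← sum_range_eq (ha σ hσ).1 (ha σ hσ).2]
      simp only [hw]
      rw [← hr, inv_mul_cancel₀ hr0.ne']
    · simp only [mul_smul]
      rw [← Finset.smul_sum, ← sum_range_eq (ha σ hσ).1 (ha σ hσ).2 fun x => w x • x]
      simp only [hw]
      exact hp3
    · simp only [hw]
      exact mul_ne_zero (inv_ne_zero hr0.ne') (ht i).ne'
  exact hne (Finset.eq_of_subset_of_card_le hsub (by rw [hT.card_eq σ hσ, hT.card_eq τ hτ]))

/-- Both unions are the cone over `P`: a point of the left side is `r • f p` with `r ≥ 0` and `p ∈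
P`, and `p` lies in a simplex of `T'`. -/
theorem IsTriangulation.closedCone_subset (hT : IsTriangulation P T) (hT' : IsTriangulation P T')
    (hP : Convex ℝ P) {a : Finset V → Fin (n + 1) → V}
    (ha : IsEnumeration T a) (ha' : IsEnumeration T' a) :
    (⋃ σ ∈ T, closedCone (f ∘ a σ)) ⊆ ⋃ σ ∈ T', closedCone (f ∘ a σ) := by
  intro x hx
  obtain ⟨σ, hσ, t, ht, hx⟩ := Set.mem_iUnion₂.1 hx
  have hmemσ : ∀ i, a σ i ∈ P := fun i => hT.subset hσ (ha.mem hσ i)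
  have h1 : ∃ r : ℝ, 0 ≤ r ∧ ∃ p ∈ P, x = r • f p := by
    set r := ∑ i, t i with hr
    rcases (Finset.sum_nonneg fun i (_ : i ∈ Finset.univ) => ht i).eq_or_lt with h0 | h0
    · have h2 := (Finset.sum_eq_zero_iff_of_nonneg fun i _ => ht i).1 h0.symm
      -- At the apex the scalar is zero, so any point of `P` serves.
      refine ⟨0, le_refl _, a σ 0, hmemσ 0, ?_⟩
      rw [hx, zero_smul]
      exact Finset.sum_eq_zero fun i hi => by rw [h2 i hi, zero_smul]
    · refine ⟨r, h0.le, ∑ i, (r⁻¹ * t i) • a σ i, hP.sum_mem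
        (fun i _ => mul_nonneg (inv_nonneg.2 h0.le) (ht i))
        (by rw [← Finset.mul_sum, ← hr, inv_mul_cancel₀ h0.ne']) (fun i _ => hmemσ i), ?_⟩
      have h2 := map_sum_smul_of_height f Finset.univ (fun i => r⁻¹ * t i) (a σ)
      have h3 : ∀ x, f x = f.linear x + f 0 := fun x => by rw [AffineMap.decomp' f]; simp
      have h4 : ∑ i, r⁻¹ * t i = 1 := by
        rw [← Finset.mul_sum, ← hr, inv_mul_cancel₀ h0.ne']
      rw [h4, one_smul, ← h3] at h2
      rw [← h2, hx, Finset.smul_sum]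
      refine Finset.sum_congr rfl fun i _ => ?_
      rw [smul_smul, mul_inv_cancel_left₀ h0.ne']; rfl
  obtain ⟨r, hr, p, hp, rfl⟩ := h1
  rw [← hT'.cover] at hp
  obtain ⟨τ, hτ, hpτ⟩ := Set.mem_iUnion₂.1 hp
  obtain ⟨w, hw0, hw1, rfl⟩ := Finset.mem_convexHull'.1 hpτ
  refine Set.mem_iUnion₂.2 ⟨τ, hτ, fun i => r * w (a τ i),
    fun i => mul_nonneg hr (hw0 _ (ha'.mem hτ i)), ?_⟩
  have h2 := map_sum_smul_of_height f τ w id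
  have h3 : ∀ x, f x = f.linear x + f 0 := fun x => by rw [AffineMap.decomp' f]; simp
  simp only [id] at h2
  rw [hw1, one_smul, ← h3] at h2
  rw [← h2, Finset.smul_sum, ← sum_range_eq (ha' τ hτ).1 (ha' τ hτ).2 fun x => r • w x • f x]
  exact Finset.sum_congr rfl fun i _ => by rw [smul_smul]; rfl

open MeasureTheory in
theorem IsTriangulation.ae_eq_openCone (hT : IsTriangulation P T) (hT' : IsTriangulation P T')
    (hP : Convex ℝ P) {a : Finset V → Fin (n + 1) → V}
    (ha : IsEnumeration T a) (ha' : IsEnumeration T' a) :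
    (⋃ σ ∈ T, openCone (f ∘ a σ) : Set (Fin (n + 1) → ℝ)) =ᵐ[volume]
      (⋃ σ ∈ T', openCone (f ∘ a σ) : Set (Fin (n + 1) → ℝ)) := by
  have h1 : ∀ S : Finset (Finset V), (⋃ σ ∈ S, openCone (f ∘ a σ) : Set (Fin (n + 1) → ℝ))
      =ᵐ[volume] (⋃ σ ∈ S, closedCone (f ∘ a σ) : Set (Fin (n + 1) → ℝ)) := fun S => by
    refine Filter.EventuallyEq.countable_bUnion (S := (S : Set (Finset V))) S.countable_toSet
      fun σ _ => ?_
    refine (LE.le.eventuallyLE (openCone_subset_closedCone _)).antisymm ?_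
    exact ae_le_set.2 (volume_closedCone_diff_openCone _)
  refine (h1 T).trans (Filter.EventuallyEq.trans ?_ (h1 T').symm)
  rw [(hT.closedCone_subset hT' hP ha ha').antisymm (hT'.closedCone_subset hT hP ha' ha)]
  exact ae_eq_refl _


open MeasureTheory in
theorem IsTriangulation.sum_div_prod (hT : IsTriangulation P T)
    (hf : IsHomogenization P f ξ) {a : Finset V → Fin (n + 1) → V} (ha : IsEnumeration T a)
    {η : (Fin (n + 1) → ℝ) →ₗ[ℝ] ℝ} (hη : ∀ σ ∈ T, ∀ x ∈ σ, 0 < η (f x)) :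
    ∑ σ ∈ T, |Matrix.detRowAlternating (f ∘ a σ)| / ∏ i, η (f (a σ i)) =
      ∫ x in ⋃ σ ∈ T, openCone (f ∘ a σ), Real.exp (-η x) := by
  rw [integral_biUnion_finset]
  · refine Finset.sum_congr rfl fun σ hσ => ?_
    rw [integral_openCone (hT.det_ne_zero hf ha hσ) fun i => hη σ hσ _ (ha.mem hσ i)]
    rfl
  · exact fun σ hσ => measurableSet_openCone (hT.det_ne_zero hf ha hσ)
  · exact fun σ hσ τ hτ hne => hT.disjoint_openCone hf ha hσ hτ hne
  · exact fun σ hσ => integrableOn_openCone (hT.det_ne_zero hf ha hσ)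
      fun i => hη σ hσ _ (ha.mem hσ i)

/-- The chain of the positively oriented simplices of `T`. -/
noncomputable def triangulationChain (f : V →ᵃ[ℝ] (Fin (n + 1) → ℝ)) (T : Finset (Finset V))
    (a : Finset V → Fin (n + 1) → V) : (Fin (n + 1) → V) →₀ ℤ :=
  ∑ σ ∈ T, Finsupp.single (a σ) (SignType.sign (Matrix.detRowAlternating (f ∘ a σ)) : ℤ)

theorem simplexRatio_triangulationChain (a : Finset V → Fin (n + 1) → V)
    (η : (Fin (n + 1) → ℝ) →ₗ[ℝ] ℝ) :
    simplexRatio f Matrix.detRowAlternating η (triangulationChain f T a) =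
      ∑ σ ∈ T, |Matrix.detRowAlternating (f ∘ a σ)| / ∏ i, η (f (a σ i)) := by
  rw [triangulationChain, map_sum]
  refine Finset.sum_congr rfl fun σ _ => ?_
  rw [simplexRatio_single, ← mul_div_assoc, SignType.intCast_cast, sign_mul_self]

/-- The sum is an alternating function of `d + 1` vectors in a space of dimension `d`, hence of
dependent vectors. This is Cramer's identity. -/
theorem alternating_boundary_eq_zero {d : ℕ} (D : (Fin d → ℝ) [⋀^Fin d]→ₗ[ℝ] ℝ)
    (w : Fin (d + 1) → Fin d → ℝ) :
    ∑ i : Fin (d + 1), ((-1 : ℝ) ^ (i : ℕ) * D (w ∘ i.succAbove)) • w i = 0 := by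
  let g : (Fin d → ℝ) →ₗ[ℝ] (Fin d → ℝ) [⋀^Fin d]→ₗ[ℝ] (Fin d → ℝ) :=
    { toFun := fun x => (LinearMap.toSpanSingleton ℝ (Fin d → ℝ) x).compAlternatingMap D
      map_add' := fun x y => by ext; simp [mul_add]
      map_smul' := fun x y => by ext; simp; ring }
  have h1 := (AlternatingMap.alternatizeUncurryFin g).map_linearDependent w fun h => by
    have := h.fintype_card_le_finrank
    simp at this
  rw [AlternatingMap.alternatizeUncurryFin_apply] at h1
  rw [← h1]
  refine Finset.sum_congr rfl fun i _ => ?_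
  change _ = (-1) ^ (i : ℕ) • (D (i.removeNth w) • w i)
  rw [mul_smul]
  rcases Nat.even_or_odd (i : ℕ) with h | h
  · simp only [h.neg_one_pow, one_smul]; rfl
  · simp only [h.neg_one_pow, neg_smul, one_smul]; rfl

-- The Laplace transforms of `T` and `T'` are integrals of one function over almost equal sets, so
-- the difference has zero transform and the kernel theorem applies with `U = ⊥`.
open Filter Topology in
theorem triangulationChain_sub_mem (hT : IsTriangulation P T) (hT' : IsTriangulation P T')
    (hP : Convex ℝ P) (hf : IsHomogenization P f ξ) {a : Finset V → Fin (n + 1) → V}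
    (ha : IsEnumeration T a) (ha' : IsEnumeration T' a) :
    triangulationChain f T a - triangulationChain f T' a ∈
      simplexRelations (P.extremePoints ℝ) f Matrix.detRowAlternating := by
  classical
  set S : Finset V := (T ∪ T').biUnion id with hS
  have hST : ∀ σ ∈ T, ∀ x ∈ σ, x ∈ S := fun σ hσ x hx =>
    Finset.mem_biUnion.2 ⟨σ, Finset.mem_union_left _ hσ, hx⟩
  have hST' : ∀ σ ∈ T', ∀ x ∈ σ, x ∈ S := fun σ hσ x hx =>
    Finset.mem_biUnion.2 ⟨σ, Finset.mem_union_right _ hσ, hx⟩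
  have hSP : (S : Set V) ⊆ P.extremePoints ℝ := by
    intro x hx
    obtain ⟨σ, hσ, hxσ⟩ := Finset.mem_biUnion.1 (Finset.mem_coe.1 hx)
    rcases Finset.mem_union.1 hσ with h | h
    · exact hT.vertices σ h hxσ
    · exact hT'.vertices σ h hxσ
  have hξS : ∀ s ∈ S, ξ (f s) = 1 := fun s hs => hf.height s (hSP hs).1
  have hsupp : triangulationChain f T a - triangulationChain f T' a ∈
      Finsupp.supported ℤ ℤ {a : Fin (n + 1) → V | ∀ i, a i ∈ (S : Set V)} :=
    Submodule.sub_mem _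
      (Submodule.sum_mem _ fun σ hσ => Finsupp.single_mem_supported ℤ _
        fun i => hST σ hσ _ (ha.mem hσ i))
      (Submodule.sum_mem _ fun σ hσ => Finsupp.single_mem_supported ℤ _
        fun i => hST' σ hσ _ (ha'.mem hσ i))
  refine simplexRelations_mono hSP (mem_simplexRelations_of_simplexRatio_eq_zero f S (n + 1)
    Matrix.detRowAlternating ⊥ S (Finset.Subset.refl S) ?_ ?_ ?_ _ hsupp ?_)
  · intro s hs h0
    have h1 := hξS s hs
    rw [(Submodule.mem_bot ℝ).1 h0, map_zero] at h1
    exact zero_ne_one h1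
  · rintro w ⟨i, hi⟩
    exact AlternatingMap.map_coord_zero _ i ((Submodule.mem_bot ℝ).1 hi)
  · intro η _ w
    have := congrArg η (alternating_boundary_eq_zero Matrix.detRowAlternating w)
    simpa [map_sum] using this
  · intro η _ hη
    -- The height functional is one on every vertex, so nearby functionals are positive there and
    -- the integral formula holds; the rest is rational continuation.
    refine simplexRatio_eq_zero_of_eventually _ hsupp (ξ₀ := ξ)
      (fun s hs => by rw [hξS s hs]; exact one_ne_zero) ?_ hη
    have hpos : ∀ᶠ t : ℝ in 𝓝[≠] 0, ∀ s ∈ S, 0 < (ξ + t • (η - ξ)) (f s) := by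
      rw [Filter.eventually_all_finset]
      intro b hb
      have hcont : Continuous fun t : ℝ => (ξ + t • (η - ξ)) (f b) := by
        simp only [LinearMap.add_apply, LinearMap.smul_apply, smul_eq_mul]
        fun_prop
      refine (hcont.continuousAt.eventually (lt_mem_nhds ?_)).filter_mono nhdsWithin_le_nhds
      simp [hξS b hb]
    filter_upwards [hpos] with t ht
    rw [map_sub, simplexRatio_triangulationChain, simplexRatio_triangulationChain,
      hT.sum_div_prod hf ha fun σ hσ x hx => ht x (hST σ hσ x hx),
      hT'.sum_div_prod hf ha' fun σ hσ x hx => ht x (hST' σ hσ x hx), sub_eq_zero]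
    exact MeasureTheory.setIntegral_congr_set (hT.ae_eq_openCone hT' hP ha ha')

end TriangulationChains

/-! ### Signs of faces under permutations -/

section SignedFaces

variable {X : Type*} {r : ℕ}

theorem chainSymbol_comp_perm (a : Fin r → X) (π : Equiv.Perm (Fin r)) :
    chainSymbol (a ∘ π) = (Equiv.Perm.sign π : ℤ) • chainSymbol a := by
  have h : Finsupp.single (a ∘ π) (1 : ℤ) - Finsupp.single a (Equiv.Perm.sign π : ℤ) ∈
      antisymRelations X r := Submodule.subset_span ⟨a, π, rfl⟩
  rw [chainSymbol, chainSymbol, ← map_smul, ← sub_eq_zero, ← map_sub, Finsupp.smul_single,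
    smul_eq_mul, mul_one]
  exact (Submodule.Quotient.mk_eq_zero _).2 h

/-- The permutation induced by `τ` on the complement of `i`, with its sign. -/
theorem exists_perm_succAbove (τ : Equiv.Perm (Fin (r + 1))) (i : Fin (r + 1)) :
    ∃ τ' : Equiv.Perm (Fin r), (∀ j, τ (i.succAbove j) = (τ i).succAbove (τ' j)) ∧
      (Equiv.Perm.sign τ' : ℤ) = (-1) ^ ((i : ℕ) + (τ i : ℕ)) * Equiv.Perm.sign τ := by
  have h1 : ∀ j, ∃ k, (τ i).succAbove k = τ (i.succAbove j) := fun j =>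
    Fin.exists_succAbove_eq fun h => Fin.succAbove_ne i j (τ.injective h)
  choose g hg using h1
  have hinj : Function.Injective g := fun j k hjk => by
    have := congrArg (τ i).succAbove hjk
    rw [hg, hg] at this
    exact Fin.succAbove_right_injective (τ.injective this)
  let τ' : Equiv.Perm (Fin r) := Equiv.ofBijective g (Finite.injective_iff_bijective.1 hinj)
  refine ⟨τ', fun j => (hg j).symm, ?_⟩
  -- The sign comes from expanding the permutation matrix of `τ` along row `i`, whose only nonzero
  -- entry is in column `τ i`.
  have hM := Matrix.det_permutation (R := ℤ) τ
  have hM' := Matrix.det_permutation (R := ℤ) τ'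
  rw [Matrix.det_succ_row _ i, Finset.sum_eq_single (τ i)] at hM
  · have hsub : (τ.toPEquiv.toMatrix.submatrix i.succAbove (τ i).succAbove :
        Matrix (Fin r) (Fin r) ℤ) = τ'.toPEquiv.toMatrix := by
      ext j k
      simp only [Matrix.submatrix_apply, PEquiv.toMatrix_apply, Equiv.toPEquiv_apply,
        Option.mem_some_iff]
      rw [show τ (i.succAbove j) = (τ i).succAbove (τ' j) from (hg j).symm]
      simp
    rw [hsub, hM'] at hM
    simp only [PEquiv.toMatrix_apply, Equiv.toPEquiv_apply, Option.mem_some_iff, if_true,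
      mul_one, Int.cast_id] at hM
    rw [← hM, ← mul_assoc, ← pow_add, Even.neg_one_pow ⟨_, rfl⟩, one_mul]
  · intro k _ hk
    simp [PEquiv.toMatrix_apply, Equiv.toPEquiv_apply, hk.symm]
  · simp

/-- The `i`-th term of the boundary of a tuple. -/
noncomputable def signedFace (w : Fin (r + 1) → X) (i : Fin (r + 1)) : AntisymChains X r :=
  (-1 : ℤ) ^ ((i : ℕ) + 1) • chainSymbol (w ∘ i.succAbove)

theorem partialBoundary_eq (p : ℕ) (w : Fin (r + 1) → X) :
    partialBoundary p w =
      ∑ i ∈ Finset.univ.filter (fun i : Fin (r + 1) => (i : ℕ) < p), signedFace w i := rfl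

theorem signedFace_comp_perm (w : Fin (r + 1) → X) (τ : Equiv.Perm (Fin (r + 1)))
    (i : Fin (r + 1)) :
    signedFace (w ∘ τ) i = (Equiv.Perm.sign τ : ℤ) • signedFace w (τ i) := by
  obtain ⟨τ', h1, h2⟩ := exists_perm_succAbove τ i
  have h3 : (w ∘ τ) ∘ i.succAbove = (w ∘ (τ i).succAbove) ∘ τ' := by
    funext j; simp [h1 j]
  rw [signedFace, signedFace, h3, chainSymbol_comp_perm, h2, smul_smul, smul_smul]
  congr 1
  rw [pow_add, pow_add, pow_add]
  have h4 : ((-1 : ℤ) ^ (i : ℕ)) * (-1) ^ (i : ℕ) = 1 := by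
    rw [← pow_add, Even.neg_one_pow ⟨_, rfl⟩]
  linear_combination (-(-1 : ℤ) ^ ((τ i : ℕ)) * (Equiv.Perm.sign τ : ℤ)) * h4

theorem exists_perm_initial (A : Finset (Fin (r + 1))) :
    ∃ τ : Equiv.Perm (Fin (r + 1)), ∀ i, τ i ∈ A ↔ (i : ℕ) < A.card := by
  classical
  have hle : A.card ≤ r + 1 := by simpa using A.card_le_univ
  have hcard : Fintype.card {i : Fin (r + 1) // (i : ℕ) < A.card} = Fintype.card {i // i ∈ A} := by
    rw [Fintype.card_coe, Fintype.card_subtype]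
    exact (Fin.card_filter_val_lt (n := r + 1) (m := A.card)).trans (min_eq_right hle)
  let e := Fintype.equivOfCardEq hcard
  refine ⟨e.extendSubtype, fun i => ⟨fun h => ?_, fun h => ?_⟩⟩
  · by_contra h'
    exact e.extendSubtype_not_mem i h' h
  · exact e.extendSubtype_mem i h

/-- A partial boundary only sees an initial segment of indices; reordering the tuple lets it express
a sum over any set `A` of faces, up to one global sign. -/
theorem sum_signedFace_comp_perm (w : Fin (r + 1) → X) (A : Finset (Fin (r + 1)))
    (τ : Equiv.Perm (Fin (r + 1))) {p : ℕ} (hτ : ∀ i, τ i ∈ A ↔ (i : ℕ) < p) :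
    partialBoundary p (w ∘ τ) = (Equiv.Perm.sign τ : ℤ) • ∑ i ∈ A, signedFace w i := by
  rw [partialBoundary_eq, Finset.smul_sum]
  refine Finset.sum_equiv τ (fun i => ?_) fun i _ => signedFace_comp_perm w τ i
  simp [hτ]

end SignedFaces

/-! ### The size of a circuit -/

section Circuits

variable {V : Type*} [AddCommGroup V] [Module ℝ V]

/-- One point, or two distinct points, are affinely independent. -/
theorem IsCircuit.three_le_card {Z : Finset V} (h : IsCircuit (Z : Set V)) : 3 ≤ Z.card := by
  by_contra hlt
  refine h.1 (affineIndependent_finset_iff (σ := Z).2 fun w h1 h2 x hx => ?_)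
  have : Z.card = 1 ∨ Z.card = 2 := by
    have := Finset.card_pos.2 ⟨x, hx⟩
    omega
  classical
  rcases this with h3 | h3
  · obtain ⟨y, rfl⟩ := Finset.card_eq_one.1 h3
    rw [Finset.mem_singleton.1 hx]
    simpa using h1
  · obtain ⟨y, z, hyz, rfl⟩ := Finset.card_eq_two.1 h3
    rw [Finset.sum_pair hyz] at h1 h2
    have h4 : w z = - w y := by linarith
    rw [h4, neg_smul, ← sub_eq_add_neg, ← smul_sub, smul_eq_zero, sub_eq_zero] at h2
    have h5 : w y = 0 := h2.resolve_right hyz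
    rcases Finset.mem_insert.1 hx with rfl | h6
    · exact h5
    · rw [Finset.mem_singleton.1 h6, h4, h5, neg_zero]

theorem IsCircuit.three_le {r p : ℕ} {v : Fin r → V}
    (h : IsCircuit (v '' {i | (i : ℕ) < p})) : 3 ≤ p := by
  classical
  have h1 : v '' {i | (i : ℕ) < p} = ((Finset.univ.filter fun i : Fin r => (i : ℕ) < p).image v :
      Finset V) := by
    ext x; simp
  rw [h1] at h
  refine h.three_le_card.trans (Finset.card_image_le.trans ?_)
  exact (Fin.card_filter_val_lt (n := r) (m := p)).le.trans (min_le_right _ _)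

end Circuits

/-! ### From relations between simplices to partial boundaries of circuits -/

section FlipRelations

variable {V : Type*} [AddCommGroup V] [Module ℝ V] {n : ℕ} {P : Set V}
  {f : V →ᵃ[ℝ] (Fin (n + 1) → ℝ)} {ξ : (Fin (n + 1) → ℝ) →ₗ[ℝ] ℝ} {T T' : Finset (Finset V)}

/-- A tuple of distinct vertices of `P`, the first `p` of which form a circuit. -/
def IsFlipTuple (P : Set V) (n p : ℕ) (v : Fin (n + 2) → V) : Prop :=
  Function.Injective v ∧ (∀ i, v i ∈ P.extremePoints ℝ) ∧
    p ≤ n + 2 ∧ IsCircuit (v '' {i | (i : ℕ) < p})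

/-- The chains that are sums of partial boundaries of flip tuples. -/
def IsFlipSum (P : Set V) (n : ℕ) (x : AntisymChains V (n + 1)) : Prop :=
  ∃ L : List (ℕ × (Fin (n + 2) → V)), (∀ e ∈ L, IsFlipTuple P n e.1 e.2) ∧
    (L.map fun e => partialBoundary e.1 e.2).sum = x

/-- Flip sums carry no coefficients, so a sign has to be absorbed by the tuple. The first two
entries can be exchanged because both belong to the circuit, by `3 ≤ p`. -/
theorem IsFlipTuple.comp_swap {p : ℕ} {v : Fin (n + 2) → V} (h : IsFlipTuple P n p v) :
    IsFlipTuple P n p (v ∘ Equiv.swap 0 1) ∧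
      partialBoundary p (v ∘ Equiv.swap 0 1) = - partialBoundary p v := by
  have h3 : 3 ≤ p := h.2.2.2.three_le
  have hτ : ∀ i : Fin (n + 2), Equiv.swap 0 1 i ∈ (Finset.univ.filter fun i : Fin (n + 2) =>
      (i : ℕ) < p) ↔ (i : ℕ) < p := by
    intro i
    simp only [Finset.mem_filter, Finset.mem_univ, true_and]
    rcases eq_or_ne i 0 with rfl | h0
    · simp; omega
    rcases eq_or_ne i 1 with rfl | h1
    · simp; omega
    rw [Equiv.swap_apply_of_ne_of_ne h0 h1]
  refine ⟨⟨h.1.comp (Equiv.injective _), fun i => h.2.1 _, h.2.2.1, ?_⟩, ?_⟩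
  · have : (v ∘ Equiv.swap 0 1) '' {i | (i : ℕ) < p} = v '' {i | (i : ℕ) < p} := by
      rw [Set.image_comp]
      congr 1
      ext i
      simp only [Equiv.image_eq_preimage_symm, Set.mem_preimage, Equiv.symm_swap]
      simpa using hτ i
    rw [this]
    exact h.2.2.2
  · rw [sum_signedFace_comp_perm v _ _ hτ, Equiv.Perm.sign_swap (by simp), partialBoundary_eq]
    simp

theorem IsFlipSum.zero : IsFlipSum P n 0 := ⟨[], by simp, by simp⟩

theorem IsFlipSum.add {x y : AntisymChains V (n + 1)} (hx : IsFlipSum P n x)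
    (hy : IsFlipSum P n y) : IsFlipSum P n (x + y) := by
  obtain ⟨L, h1, h2⟩ := hx
  obtain ⟨L', h3, h4⟩ := hy
  refine ⟨L ++ L', fun e he => ?_, by rw [List.map_append, List.sum_append, h2, h4]⟩
  rcases List.mem_append.1 he with h | h
  · exact h1 e h
  · exact h3 e h

theorem IsFlipSum.neg {x : AntisymChains V (n + 1)} (hx : IsFlipSum P n x) :
    IsFlipSum P n (-x) := by
  obtain ⟨L, h1, rfl⟩ := hx
  induction L with
  | nil => simpa using IsFlipSum.zero
  | cons e L ih =>
    rw [List.map_cons, List.sum_cons, neg_add]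
    have he := (h1 e (by simp)).comp_swap
    refine IsFlipSum.add ⟨[(e.1, e.2 ∘ Equiv.swap 0 1)], ?_, ?_⟩
      (ih fun e' he' => h1 e' (by simp [he']))
    · simpa using he.1
    · simpa using he.2

theorem IsFlipSum.exists_fin {x : AntisymChains V (n + 1)} (hx : IsFlipSum P n x) :
    ∃ (k : ℕ) (p : Fin k → ℕ) (v : Fin k → Fin (n + 2) → V),
      (∀ α, IsFlipTuple P n (p α) (v α)) ∧ ∑ α, partialBoundary (p α) (v α) = x := by
  obtain ⟨L, h1, rfl⟩ := hx
  refine ⟨L.length, fun α => (L.get α).1, fun α => (L.get α).2,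
    fun α => h1 _ (List.get_mem L α), ?_⟩
  rw [← List.sum_ofFn]
  congr 1
  conv_rhs => rw [← List.ofFn_get L, List.map_ofFn]
  rfl

/-- The facets of a tuple with nonzero determinant are those opposite to the points of a circuit. -/
theorem IsHomogenization.isCircuit (hf : IsHomogenization P f ξ) {w : Fin (n + 2) → V}
    (hw : ∀ i, w i ∈ P) (hi : Function.Injective w) {A : Finset (Fin (n + 2))}
    (hA : ∀ i, i ∈ A ↔ Matrix.detRowAlternating (f ∘ w ∘ i.succAbove) ≠ 0) (hne : A.Nonempty) :
    IsCircuit (w '' A) := by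
  classical
  constructor
  · have h0 := alternating_boundary_eq_zero Matrix.detRowAlternating (f ∘ w)
    obtain ⟨h1, h2⟩ := hf.sum_eq (P := P) (t := (∅ : Finset (Fin 0))) (u := fun _ => 0)
      (b := fun i => i.elim0) (fun i _ => hw i) (fun i => i.elim0) (h0.trans (by simp))
    rw [Finset.sum_empty] at h1 h2
    have hz : ∀ i ∉ A, (-1 : ℝ) ^ (i : ℕ) *
        Matrix.detRowAlternating ((f ∘ w) ∘ i.succAbove) = 0 := fun i hiA => by
      have : Matrix.detRowAlternating (f ∘ w ∘ i.succAbove) = 0 := by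
        by_contra h; exact hiA ((hA i).2 h)
      rw [Function.comp_assoc, this, mul_zero]
    intro hind
    have hind' : AffineIndependent ℝ fun i : A => w i := by
      have := (affineIndependent_equiv (k := ℝ) (Equiv.Set.image w (A : Set (Fin (n + 2))) hi)
        (p := (Subtype.val : {x // x ∈ w '' A} → V))).2 hind
      exact this
    obtain ⟨j, hj⟩ := hne
    have h3 := (affineIndependent_iff.1 hind') Finset.univ
      (fun i => (-1 : ℝ) ^ ((i : Fin (n + 2)) : ℕ) *
        Matrix.detRowAlternating ((f ∘ w) ∘ (i : Fin (n + 2)).succAbove)) ?_ ?_ ⟨j, hj⟩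
        (Finset.mem_univ _)
    · refine mul_ne_zero (pow_ne_zero _ (by norm_num)) ?_ h3
      exact (hA j).1 hj
    · rw [← h1, Finset.sum_coe_sort A fun i => (-1 : ℝ) ^ (i : ℕ) *
        Matrix.detRowAlternating ((f ∘ w) ∘ i.succAbove)]
      exact Finset.sum_subset (Finset.subset_univ _) fun i _ hiA => hz i hiA
    · rw [← h2, Finset.sum_coe_sort A fun i => ((-1 : ℝ) ^ (i : ℕ) *
        Matrix.detRowAlternating ((f ∘ w) ∘ i.succAbove)) • w i]
      exact Finset.sum_subset (Finset.subset_univ _) fun i _ hiA => by rw [hz i hiA, zero_smul]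
  · rintro _ ⟨j, hj, rfl⟩
    -- Minimality: without `w j` the remaining points lie on a nondegenerate facet.
    have h1 : AffineIndependent ℝ (w ∘ j.succAbove) :=
      (hf.det_ne_zero_iff fun i => hw _).1 ((hA j).1 hj)
    refine AffineIndependent.mono h1.range ?_
    rintro _ ⟨⟨i, hiA, rfl⟩, hij⟩
    have : i ≠ j := fun h => hij (by rw [h]; rfl)
    obtain ⟨k, rfl⟩ := Fin.exists_succAbove_eq this
    exact ⟨k, rfl⟩

open Classical in
/-- Forgetting the degenerate simplices. -/
noncomputable def nondegenerateSymbol (f : V →ᵃ[ℝ] (Fin (n + 1) → ℝ)) :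
    ((Fin (n + 1) → V) →₀ ℤ) →ₗ[ℤ] AntisymChains V (n + 1) :=
  Finsupp.linearCombination ℤ fun a =>
    if Matrix.detRowAlternating (f ∘ a) = 0 then 0 else chainSymbol a

theorem nondegenerateSymbol_single (a : Fin (n + 1) → V) (c : ℤ) :
    nondegenerateSymbol f (Finsupp.single a c) =
      c • (if Matrix.detRowAlternating (f ∘ a) = 0 then 0 else chainSymbol a) := by
  simp [nondegenerateSymbol]

/-- Only the boundaries survive `nondegenerateSymbol`: antisymmetry already holds in the target and
degenerate simplices are sent to zero. The surviving faces of a boundary are opposite to a circuit,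
which a permutation places first. -/
theorem isFlipSum_of_mem_simplexRelations (hf : IsHomogenization P f ξ)
    {x : (Fin (n + 1) → V) →₀ ℤ}
    (hx : x ∈ simplexRelations (P.extremePoints ℝ) f Matrix.detRowAlternating) :
    IsFlipSum P n (nondegenerateSymbol f x) := by
  classical
  let G : AddSubgroup (AntisymChains V (n + 1)) :=
    { carrier := {x | IsFlipSum P n x}
      zero_mem' := IsFlipSum.zero
      add_mem' := IsFlipSum.add
      neg_mem' := IsFlipSum.neg }
  refine (Submodule.span_le (p := G.toIntSubmodule.comap (nondegenerateSymbol f))).2 ?_ hx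
  rintro x ((⟨a, π, ha, rfl⟩ | ⟨a, ha, h0, rfl⟩) | ⟨w, hw, hi, rfl⟩)
  · have h1 : Matrix.detRowAlternating (f ∘ (a ∘ π)) = 0 ↔
        Matrix.detRowAlternating (f ∘ a) = 0 := by
      rw [← Function.comp_assoc, AlternatingMap.map_perm, smul_eq_zero_iff_eq]
    have h2 : nondegenerateSymbol f (Finsupp.single (a ∘ π) 1 -
        Finsupp.single a (Equiv.Perm.sign π : ℤ)) = 0 := by
      rw [map_sub, nondegenerateSymbol_single, nondegenerateSymbol_single]
      simp only [h1]
      split_ifs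
      · simp
      · rw [chainSymbol_comp_perm, one_smul, sub_self]
    change IsFlipSum P n _
    rw [h2]; exact IsFlipSum.zero
  · change IsFlipSum P n _
    rw [nondegenerateSymbol_single, if_pos h0, smul_zero]
    exact IsFlipSum.zero
  · set A : Finset (Fin (n + 2)) := Finset.univ.filter fun i =>
      Matrix.detRowAlternating (f ∘ w ∘ i.succAbove) ≠ 0 with hA
    have hA' : ∀ i, i ∈ A ↔ Matrix.detRowAlternating (f ∘ w ∘ i.succAbove) ≠ 0 := fun i => by
      simp [hA]
    -- The minus sign compares `(-1)^i` in the boundary with `(-1)^(i + 1)` in `signedFace`.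
    have h1 : nondegenerateSymbol f (∑ i : Fin (n + 2), (-1 : ℤ) ^ (i : ℕ) •
        Finsupp.single (w ∘ i.succAbove) 1) = - ∑ i ∈ A, signedFace w i := by
      rw [map_sum, ← Finset.sum_subset (Finset.subset_univ A), ← Finset.sum_neg_distrib]
      · refine Finset.sum_congr rfl fun i hiA => ?_
        rw [map_smul, nondegenerateSymbol_single, if_neg ((hA' i).1 hiA), signedFace, pow_succ,
          one_smul, mul_neg_one, neg_smul, neg_neg]
      · intro i _ hiA
        have : Matrix.detRowAlternating (f ∘ w ∘ i.succAbove) = 0 := by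
          by_contra h; exact hiA ((hA' i).2 h)
        rw [map_smul, nondegenerateSymbol_single, if_pos this, smul_zero, smul_zero]
    change IsFlipSum P n _
    rw [h1]
    refine IsFlipSum.neg ?_
    rcases A.eq_empty_or_nonempty with hE | hne
    · rw [hE]; simpa using IsFlipSum.zero
    obtain ⟨τ, hτ⟩ := exists_perm_initial A
    have h2 := sum_signedFace_comp_perm w A τ hτ
    have h3 : IsFlipTuple P n A.card (w ∘ τ) := by
      refine ⟨hi.comp τ.injective, fun i => hw _, by simpa using A.card_le_univ, ?_⟩
      have h4 : (w ∘ τ) '' {i | (i : ℕ) < A.card} = w '' A := by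
        ext x
        constructor
        · rintro ⟨i, h, rfl⟩; exact ⟨τ i, (hτ i).2 h, rfl⟩
        · rintro ⟨i, h, rfl⟩
          exact ⟨τ.symm i, (hτ _).1 (by simpa using h), by simp⟩
      rw [h4]
      exact hf.isCircuit (fun i => (hw i).1) hi hA' hne
    have h5 : IsFlipSum P n (partialBoundary A.card (w ∘ τ)) :=
      ⟨[(A.card, w ∘ τ)], by simpa using h3, by simp⟩
    rw [h2] at h5
    rcases Int.units_eq_one_or (Equiv.Perm.sign τ) with hs | hs
    · rw [hs] at h5; simpa using h5
    · rw [hs] at h5; simpa using h5.neg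

/-- Two triangulations of the same polytope differ by a sum of partial boundaries of tuples
extending circuits. -/
theorem exists_flipTuples (hT : IsTriangulation P T) (hT' : IsTriangulation P T')
    (hP : Convex ℝ P) (hf : IsHomogenization P f ξ) {a : Finset V → Fin (n + 1) → V}
    (ha : IsEnumeration T a) (ha' : IsEnumeration T' a) :
    ∃ (k : ℕ) (p : Fin k → ℕ) (v : Fin k → Fin (n + 2) → V),
      (∀ α, IsFlipTuple P n (p α) (v α)) ∧ ∑ α, partialBoundary (p α) (v α) =
        ∑ σ ∈ T, (SignType.sign (Matrix.detRowAlternating (f ∘ a σ)) : ℤ) • chainSymbol (a σ) -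
        ∑ σ ∈ T', (SignType.sign (Matrix.detRowAlternating (f ∘ a σ)) : ℤ) •
          chainSymbol (a σ) := by
  have h := (isFlipSum_of_mem_simplexRelations hf
    (triangulationChain_sub_mem hT hT' hP hf ha ha')).exists_fin
  rw [map_sub, triangulationChain, triangulationChain, map_sum, map_sum,
    Finset.sum_congr rfl fun σ hσ => by
      rw [nondegenerateSymbol_single, if_neg (hT.det_ne_zero hf ha hσ)],
    Finset.sum_congr (s₁ := T') rfl fun σ hσ => by
      rw [nondegenerateSymbol_single, if_neg (hT'.det_ne_zero hf ha' hσ)]] at h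
  exact h

end FlipRelations

/-! ### Orientations as signs of determinants -/

section Orientation

variable {V : Type*} [AddCommGroup V] [Module ℝ V] {W : Submodule ℝ V} {n : ℕ}

/-- The homogeneous coordinates attached to a basis of the direction. -/
noncomputable def homogenization (b : Basis (Fin n) ℝ W) (q : V →ₗ[ℝ] W) :
    V →ᵃ[ℝ] (Fin (n + 1) → ℝ) :=
  { toFun := fun x => Fin.cons 1 (b.equivFun (q x))
    linear :=
      { toFun := fun x => Fin.cons 0 (b.equivFun (q x))
        map_add' := fun x y => by
          funext i; refine Fin.cases ?_ (fun j => ?_) i <;> simp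
        map_smul' := fun c x => by
          funext i; refine Fin.cases ?_ (fun j => ?_) i <;> simp }
    map_vadd' := fun x y => by
      funext i; refine Fin.cases ?_ (fun j => ?_) i <;> simp }

theorem isHomogenization_homogenization {P : Set V} (hP : vectorSpan ℝ P ≤ W)
    (b : Basis (Fin n) ℝ W) {q : V →ₗ[ℝ] W} (hq : ∀ x : W, q x = x) :
    IsHomogenization P (homogenization b q) (LinearMap.proj 0) where
  height x _ := by simp [homogenization]
  inj x hx h := by
    have h1 : ∀ i, b.equivFun (q x) i = 0 := fun i => by
      have := congrFun h i.succ
      simpa [homogenization] using this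
    have h2 : q x = 0 := b.equivFun.map_eq_zero_iff.1 (funext h1)
    have h3 := hq ⟨x, hP hx⟩
    rw [h2] at h3
    exact (congrArg Subtype.val h3).symm

/-- Subtracting the first row from the others makes the first column a unit vector; expansion leaves
the matrix of edge vectors in the basis `b`. -/
theorem det_homogenization (b : Basis (Fin n) ℝ W) {q : V →ₗ[ℝ] W} (hq : ∀ x : W, q x = x)
    {a : Fin (n + 1) → V} {c : Fin n → W} (hc : ∀ i, (c i : V) = a i.succ - a 0) :
    Matrix.detRowAlternating (homogenization b q ∘ a) = b.det c := by
  have h1 : Matrix.det (Matrix.of (homogenization b q ∘ a)) = Matrix.det (Matrix.of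
      (Fin.cons (homogenization b q (a 0)) (fun i => Fin.cons 0 (b.equivFun (c i))) :
        Fin (n + 1) → Fin (n + 1) → ℝ)) := by
    refine Matrix.det_eq_of_forall_row_eq_smul_add_const (Fin.cons 0 fun _ => 1) 0 (by simp) ?_
    intro i j
    have h2 : ∀ i, c i = q (a i.succ) - q (a 0) := fun i => by
      rw [← map_sub, ← hc, hq]
    refine Fin.cases ?_ (fun i => ?_) i
    · simp
    · refine Fin.cases ?_ (fun j => ?_) j <;> simp [homogenization, h2]
  change Matrix.det (Matrix.of (homogenization b q ∘ a)) = _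
  rw [h1, Matrix.det_succ_column_zero, Fin.sum_univ_succ, Finset.sum_eq_zero, add_zero,
    Basis.det_apply, ← Matrix.det_transpose (b.toMatrix c)]
  · simp only [Fin.val_zero, pow_zero, one_mul, Matrix.of_apply, Fin.cons_zero, homogenization,
      AffineMap.coe_mk]
    congr 1
  · intro i _
    simp

theorem exists_projection (W : Submodule ℝ V) : ∃ q : V →ₗ[ℝ] W, ∀ x : W, q x = x := by
  obtain ⟨q, hq⟩ := (LinearMap.id : W →ₗ[ℝ] W).exists_extend
  exact ⟨q, fun x => LinearMap.congr_fun hq x⟩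

theorem exists_perm_of_range_eq {X : Type*} {m : ℕ} {a a' : Fin m → X}
    (ha : Function.Injective a) (h : Set.range a' = Set.range a) :
    ∃ π : Equiv.Perm (Fin m), a' = a ∘ π := by
  have h1 : ∀ i, ∃ j, a j = a' i := fun i => by
    have : a' i ∈ Set.range a := h ▸ Set.mem_range_self i
    exact this
  choose g hg using h1
  have hsurj : Function.Surjective g := fun j => by
    have : a j ∈ Set.range a' := h.symm ▸ Set.mem_range_self j
    obtain ⟨i, hi⟩ := this
    exact ⟨i, ha ((hg i).trans hi)⟩
  exact ⟨Equiv.ofBijective g (Finite.surjective_iff_bijective.1 hsurj), funext fun i => (hg i).symm⟩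

theorem inducesOrientation_iff (b : Basis (Fin n) ℝ W) {q : V →ₗ[ℝ] W} (hq : ∀ x : W, q x = x)
    {a : Fin (n + 1) → V} (ha : ∀ i, a i - a 0 ∈ W) :
    InducesOrientation b.orientation a ↔
      0 < Matrix.detRowAlternating (homogenization b q ∘ a) := by
  let c : Fin n → W := fun i => ⟨a i.succ - a 0, ha _⟩
  rw [det_homogenization b hq (c := c) fun i => rfl]
  constructor
  · rintro ⟨b', h1, h2⟩
    have h3 : (b' : Fin n → W) = c := funext fun i => Subtype.ext (h2 i)
    rw [← h3]
    exact (Basis.orientation_eq_iff_det_pos b b').1 h1.symm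
  · intro h
    obtain ⟨h1, h2⟩ := (Module.Basis.is_basis_iff_det b).2 (isUnit_iff_ne_zero.2 h.ne')
    refine ⟨Basis.mk h1 h2.ge, ?_, fun i => by simp [c]⟩
    refine ((Basis.orientation_eq_iff_det_pos b (Basis.mk h1 h2.ge)).2 ?_).symm
    rwa [Basis.coe_mk]

/-- The chosen positive order is `a ∘ π` with `sign π` equal to the sign of the determinant of `a`,
so the symbol does not depend on the choice. -/
theorem orientedSymbol_eq (hn : 0 < n) (b : Basis (Fin n) ℝ W) {q : V →ₗ[ℝ] W}
    (hq : ∀ x : W, q x = x) {a : Fin (n + 1) → V} (hinj : Function.Injective a)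
    (ha : ∀ i j, a i - a j ∈ W)
    (hdet : Matrix.detRowAlternating (homogenization b q ∘ a) ≠ 0) {σ : Finset V}
    (hσ : Set.range a = (σ : Set V)) :
    orientedSymbol b.orientation σ =
      (SignType.sign (Matrix.detRowAlternating (homogenization b q ∘ a)) : ℤ) •
        chainSymbol a := by
  set D := Matrix.detRowAlternating (homogenization b q ∘ a) with hD
  have hperm : ∀ π : Equiv.Perm (Fin (n + 1)), InducesOrientation b.orientation (a ∘ π) ↔
      0 < ((Equiv.Perm.sign π : ℤ) : ℝ) * D := fun π => by
    rw [inducesOrientation_iff b hq (a := a ∘ π) fun i => ha _ _, ← Function.comp_assoc,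
      AlternatingMap.map_perm, Units.smul_def, zsmul_eq_mul]
  have hex : ∃ a' : Fin (n + 1) → V, Set.range a' = (σ : Set V) ∧
      InducesOrientation b.orientation a' := by
    rcases lt_or_gt_of_ne hdet with h | h
    -- A negative order is repaired by a transposition, for which two vertices are needed: this is
    -- where `0 < n` enters.
    · obtain ⟨m, rfl⟩ : ∃ m, n = m + 1 := ⟨n - 1, by omega⟩
      refine ⟨a ∘ Equiv.swap 0 1, by rw [(Equiv.surjective _).range_comp, hσ], (hperm _).2 ?_⟩
      rw [Equiv.Perm.sign_swap (by simp)]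
      push_cast
      linarith
    · exact ⟨a, hσ, (hperm 1).2 (by simpa using h)⟩
  rw [orientedSymbol, dif_pos hex]
  obtain ⟨h1, h2⟩ := hex.choose_spec
  obtain ⟨π, hπ⟩ := exists_perm_of_range_eq hinj (h1.trans hσ.symm)
  rw [hπ] at h2 ⊢
  rw [chainSymbol_comp_perm]
  have h3 := (hperm π).1 h2
  rcases Int.units_eq_one_or (Equiv.Perm.sign π) with hs | hs
  · rw [hs] at h3 ⊢
    rw [sign_pos (by simpa using h3)]; rfl
  · rw [hs] at h3 ⊢
    rw [sign_neg (by push_cast at h3; linarith)]; rfl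

end Orientation

/-! ### Comparison of two triangulations of an oriented polytope -/

section RegularTriangulations

variable {V : Type*} [AddCommGroup V] [Module ℝ V] {n : ℕ} {P : Set V} {T T' : Finset (Finset V)}

theorem IsPolytope.convex (hP : IsPolytope P) : Convex ℝ P := by
  obtain ⟨S, rfl⟩ := hP
  exact convex_convexHull ℝ _

theorem vectorSpan_convexHull (S : Set V) : vectorSpan ℝ (convexHull ℝ S) = vectorSpan ℝ S := by
  rw [← direction_affineSpan, affineSpan_convexHull, direction_affineSpan]

theorem IsPolytope.finiteDimensional (hP : IsPolytope P) :
    FiniteDimensional ℝ (vectorSpan ℝ P) := by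
  obtain ⟨S, rfl⟩ := hP
  rw [vectorSpan_convexHull]
  exact finiteDimensional_vectorSpan_of_finite ℝ S.finite_toSet

theorem IsTriangulation.exists_isEnumeration [DecidableEq V] (hT : IsTriangulation P T)
    (hT' : IsTriangulation P T') (hn : finrank ℝ (vectorSpan ℝ P) = n) :
    ∃ a : Finset V → Fin (n + 1) → V, IsEnumeration T a ∧ IsEnumeration T' a := by
  have h : ∀ σ : Finset V, ∃ a : Fin (n + 1) → V, σ ∈ T ∪ T' →
      Function.Injective a ∧ Set.range a = (σ : Set V) := by
    intro σ
    by_cases hσ : σ ∈ T ∪ T'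
    · have hcard : σ.card = n + 1 := by
        rcases Finset.mem_union.1 hσ with h | h
        · rw [hT.card_eq σ h, hn]
        · rw [hT'.card_eq σ h, hn]
      obtain ⟨a, ha⟩ := exists_enumeration hcard
      exact ⟨a, fun _ => ha⟩
    · have : σ ∈ T ∪ T' → False := hσ
      exact ⟨fun _ => 0, fun h => (hσ h).elim⟩
  choose a ha using h
  exact ⟨a, fun σ hσ => ha σ (Finset.mem_union_left _ hσ),
    fun σ hσ => ha σ (Finset.mem_union_right _ hσ)⟩

theorem IsTriangulation.subset_of_finrank_eq_zero (hT : IsTriangulation P T)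
    (hT' : IsTriangulation P T') (hP : IsPolytope P) (hn : finrank ℝ (vectorSpan ℝ P) = 0) :
    T ⊆ T' := by
  have := hP.finiteDimensional
  have hsub : P.Subsingleton := by
    rw [Submodule.finrank_eq_zero, vectorSpan_eq_bot_iff_subsingleton] at hn
    exact hn
  have key : ∀ S, IsTriangulation P S → ∀ σ ∈ S, ∃ x, σ = {x} := fun S hS σ hσ =>
    Finset.card_eq_one.1 (by rw [hS.card_eq σ hσ, hn])
  intro σ hσ
  obtain ⟨x, rfl⟩ := key T hT σ hσ
  have hx : x ∈ P := hT.subset hσ (by simp)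
  have hx' := hx
  rw [← hT'.cover] at hx'
  obtain ⟨τ, hτ, -⟩ := Set.mem_iUnion₂.1 hx'
  obtain ⟨y, rfl⟩ := key T' hT' τ hτ
  rwa [hsub hx (hT'.subset hτ (Finset.mem_coe.2 (Finset.mem_singleton_self y)))]

theorem exists_flipTuples_of_orientation (hP : IsPolytope P)
    (hn : finrank ℝ (vectorSpan ℝ P) = n) (hT : IsTriangulation P T) (hT' : IsTriangulation P T')
    (o : Orientation ℝ (vectorSpan ℝ P) (Fin n)) :
    ∃ (k : ℕ) (p : Fin k → ℕ) (v : Fin k → Fin (n + 2) → V),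
      (∀ α, IsFlipTuple P n (p α) (v α)) ∧ ∑ α, partialBoundary (p α) (v α) =
        ∑ w ∈ T, orientedSymbol o w - ∑ y ∈ T', orientedSymbol o y := by
  classical
  -- In dimension zero an orientation need not come from a basis, but both triangulations coincide
  -- and the empty sum works.
  rcases Nat.eq_zero_or_pos n with rfl | hpos
  · have : T = T' := (hT.subset_of_finrank_eq_zero hT' hP hn).antisymm
      (hT'.subset_of_finrank_eq_zero hT hP hn)
    exact ⟨0, fun _ => 0, fun α => α.elim0, fun α => α.elim0, by simp [this]⟩
  have := hP.finiteDimensional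
  obtain ⟨q, hq⟩ := exists_projection (vectorSpan ℝ P)
  have : Nonempty (Fin n) := ⟨⟨0, hpos⟩⟩
  obtain ⟨b, rfl⟩ : ∃ b : Basis (Fin n) ℝ (vectorSpan ℝ P), b.orientation = o :=
    ⟨o.someBasis (by simpa using hn.symm), o.someBasis_orientation _⟩
  have hf := isHomogenization_homogenization (le_refl (vectorSpan ℝ P)) b hq
  obtain ⟨a, ha, ha'⟩ := hT.exists_isEnumeration hT' hn
  have key : ∀ S, IsTriangulation P S → IsEnumeration S a → ∀ σ ∈ S,
      (SignType.sign (Matrix.detRowAlternating (homogenization b q ∘ a σ)) : ℤ) •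
        chainSymbol (a σ) = orientedSymbol b.orientation σ := fun S hS haS σ hσ =>
    (orientedSymbol_eq hpos b hq (haS σ hσ).1 (fun i j => vsub_mem_vectorSpan ℝ
      (hS.subset hσ (haS.mem hσ i)) (hS.subset hσ (haS.mem hσ j)))
      (hS.det_ne_zero hf haS hσ) (haS σ hσ).2).symm
  have h := exists_flipTuples hT hT' hP.convex hf ha ha'
  rwa [Finset.sum_congr rfl (key T hT ha), Finset.sum_congr rfl (key T' hT' ha')] at h

end RegularTriangulations

/-! ### Affine dependencies and the two triangulations of a circuit -/

section CircuitTriangulations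

variable {V : Type*} [AddCommGroup V] [Module ℝ V]

/-- An affine dependency of the points of `Z` with nonzero weights, unique up to scaling. -/
structure IsCircuitWeight (Z : Finset V) (w : V → ℝ) : Prop where
  sum_eq : ∑ x ∈ Z, w x = 0
  sum_smul_eq : ∑ x ∈ Z, w x • x = 0
  ne_zero : ∀ x ∈ Z, w x ≠ 0
  nonempty : Z.Nonempty
  unique : ∀ u : V → ℝ, ∑ x ∈ Z, u x = 0 → ∑ x ∈ Z, u x • x = 0 →
    ∃ t : ℝ, ∀ x ∈ Z, u x = t * w x

theorem IsCircuitWeight.neg {Z : Finset V} {w : V → ℝ} (h : IsCircuitWeight Z w) :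
    IsCircuitWeight Z (fun x => -w x) where
  sum_eq := by rw [Finset.sum_neg_distrib, h.sum_eq, neg_zero]
  sum_smul_eq := by simp only [neg_smul]; rw [Finset.sum_neg_distrib, h.sum_smul_eq, neg_zero]
  ne_zero x hx := neg_ne_zero.2 (h.ne_zero x hx)
  nonempty := h.nonempty
  unique u h1 h2 := by
    obtain ⟨t, ht⟩ := h.unique u h1 h2
    exact ⟨-t, fun x hx => by rw [ht x hx]; ring⟩

theorem IsTriangulation.not_subset {Z : Finset V} (h : IsCircuit (Z : Set V)) {P : Set V}
    {T : Finset (Finset V)} (hT : IsTriangulation P T) {σ : Finset V} (hσ : σ ∈ T) : ¬ Z ⊆ σ :=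
  fun hs => h.1 (affineIndependent_subset hs (hT.indep σ hσ))

variable [DecidableEq V]

theorem IsCircuit.erase_indep {Z : Finset V} (h : IsCircuit (Z : Set V)) {z : V} (hz : z ∈ Z) :
    AffineIndependent ℝ (Subtype.val : {x : V // x ∈ Z.erase z} → V) := by
  have h1 := h.2 z hz
  rw [← Finset.coe_erase] at h1
  exact h1

/-- A dependency with one vanishing weight is a dependency of a proper subset, hence zero. So all
weights are nonzero, and subtracting a multiple that kills one weight gives uniqueness. -/
theorem IsCircuit.exists_weight {Z : Finset V} (h : IsCircuit (Z : Set V)) :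
    ∃ w, IsCircuitWeight Z w := by
  have h1 : ¬ AffineIndependent ℝ (Subtype.val : {x : V // x ∈ Z} → V) := h.1
  rw [affineIndependent_finset_iff] at h1
  push Not at h1
  obtain ⟨w, hw1, hw2, x₀, hx₀, hne⟩ := h1
  have key : ∀ u : V → ℝ, ∑ x ∈ Z, u x = 0 → ∑ x ∈ Z, u x • x = 0 → ∀ z ∈ Z, u z = 0 →
      ∀ x ∈ Z, u x = 0 := by
    intro u h1 h2 z hz hz0 x hx
    rcases eq_or_ne x z with rfl | hxz
    · exact hz0
    refine affineIndependent_finset_iff.1 (h.erase_indep hz) u ?_ ?_ x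
      (Finset.mem_erase.2 ⟨hxz, hx⟩)
    · rw [← Finset.add_sum_erase _ _ hz, hz0, zero_add] at h1; exact h1
    · rw [← Finset.add_sum_erase _ _ hz, hz0, zero_smul, zero_add] at h2; exact h2
  have hnz : ∀ x ∈ Z, w x ≠ 0 := fun x hx h0 => hne (key w hw1 hw2 x hx h0 x₀ hx₀)
  refine ⟨w, hw1, hw2, hnz, ⟨x₀, hx₀⟩, fun u hu1 hu2 => ⟨u x₀ / w x₀, fun x hx => ?_⟩⟩
  have h3 := key (fun x => u x - u x₀ / w x₀ * w x) ?_ ?_ x₀ hx₀ ?_ x hx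
  · exact sub_eq_zero.1 h3
  · rw [Finset.sum_sub_distrib, ← Finset.mul_sum, hu1, hw1]; simp
  · simp only [sub_smul, mul_smul]
    rw [Finset.sum_sub_distrib, ← Finset.smul_sum, hu2, hw2]; simp
  · have := hnz x₀ hx₀
    field_simp
    simp

/-- Removing a point leaves an independent set, which bounds the dimension below. A maximal simplex
of `T` is a proper subset of `Z`, which bounds it above. -/
theorem IsCircuit.card_eq {Z : Finset V} (h : IsCircuit (Z : Set V)) {T : Finset (Finset V)}
    (hT : IsTriangulation (convexHull ℝ (Z : Set V)) T) :
    finrank ℝ (vectorSpan ℝ (Z : Set V)) + 2 = Z.card := by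
  have hcard := h.three_le_card
  obtain ⟨z, hz⟩ := Finset.card_pos.1 (by omega : 0 < Z.card)
  have hfd : FiniteDimensional ℝ (vectorSpan ℝ (Z : Set V)) :=
    finiteDimensional_vectorSpan_of_finite ℝ Z.finite_toSet
  have hz' : z ∈ convexHull ℝ (Z : Set V) := subset_convexHull ℝ _ hz
  rw [← hT.cover] at hz'
  obtain ⟨σ, hσ, -⟩ := Set.mem_iUnion₂.1 hz'
  have hσZ : σ ⊆ Z := fun x hx => extremePoints_convexHull_subset (hT.vertices σ hσ hx)
  have hσc := hT.card_eq σ hσ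
  rw [vectorSpan_convexHull] at hσc
  have hne : σ ≠ Z := fun he => h.1 (he ▸ hT.indep σ hσ)
  have h1 : σ.card < Z.card := Finset.card_lt_card (hσZ.ssubset_of_ne hne)
  have h2 : (Z.erase z).card = (Z.card - 2) + 1 := by
    rw [Finset.card_erase_of_mem hz]; omega
  have h3 := (h.erase_indep hz).finrank_vectorSpan (n := Z.card - 2) (by rw [Fintype.card_coe, h2])
  have h4 : Set.range (Subtype.val : {x : V // x ∈ Z.erase z} → V) ⊆ (Z : Set V) := by
    rintro _ ⟨x, rfl⟩; exact Finset.mem_of_mem_erase x.2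
  have h5 := Submodule.finrank_mono (vectorSpan_mono ℝ h4)
  omega

theorem IsCircuit.exists_eq_erase {Z : Finset V} (h : IsCircuit (Z : Set V))
    {T : Finset (Finset V)} (hT : IsTriangulation (convexHull ℝ (Z : Set V)) T) {σ : Finset V}
    (hσ : σ ∈ T) : ∃ z ∈ Z, σ = Z.erase z := by
  have h1 := h.card_eq hT
  have hσZ : σ ⊆ Z := fun x hx => extremePoints_convexHull_subset (hT.vertices σ hσ hx)
  have hσc := hT.card_eq σ hσ
  rw [vectorSpan_convexHull] at hσc
  have h2 : (Z \ σ).card = 1 := by rw [Finset.card_sdiff_of_subset hσZ]; omega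
  obtain ⟨z, hz⟩ := Finset.card_eq_one.1 h2
  have hzm : z ∈ Z \ σ := by rw [hz]; simp
  refine ⟨z, (Finset.mem_sdiff.1 hzm).1, ?_⟩
  rw [Finset.erase_eq, ← hz, Finset.sdiff_sdiff_eq_self hσZ]

/-- The simplices opposite to points of weights of different signs meet in the Radon point, so
they do not belong to the same triangulation. -/
theorem IsCircuitWeight.not_mem_of_sign {Z : Finset V} (h : IsCircuit (Z : Set V)) {w : V → ℝ}
    (hw : IsCircuitWeight Z w) {P : Set V} {T : Finset (Finset V)} (hT : IsTriangulation P T)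
    {σ τ : Finset V} (hσ : σ ∈ T) (hτ : τ ∈ T) {x y : V} (hx : x ∈ Z)
    (hxw : 0 < w x) (hyw : w y < 0) (hxσ : Z.erase x ⊆ σ) (hyτ : Z.erase y ⊆ τ) : False := by
  have hyx : y ≠ x := fun h => by rw [h] at hyw; linarith
  have hZ : ∀ ρ : Finset V, Z.erase x ⊆ ρ → x ∈ ρ → Z ⊆ ρ := fun ρ h1 h2 => by
    rw [← Finset.insert_erase hx]
    exact Finset.insert_subset h2 h1
  have hxτ : x ∈ τ := hyτ (Finset.mem_erase.2 ⟨hyx.symm, hx⟩)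
  by_cases hστ : σ = τ
  · exact hT.not_subset h hσ (hZ σ hxσ (hστ ▸ hxτ))
  -- The positive and negative parts of `w` have the same mass `s` and the same barycentre, the
  -- Radon point `r` below.
  set s := ∑ z ∈ Z with 0 < w z, w z with hs
  have hs0 : 0 < s := Finset.sum_pos (fun z hz => (Finset.mem_filter.1 hz).2)
    ⟨x, Finset.mem_filter.2 ⟨hx, hxw⟩⟩
  have hfilt : (Z.filter fun z => ¬ 0 < w z) = Z.filter fun z => w z < 0 := by
    refine Finset.filter_congr fun z hz => ?_
    have := hw.ne_zero z hz
    exact not_lt.trans (le_iff_lt_or_eq.trans (or_iff_left this))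
  have hs' : ∑ z ∈ Z with w z < 0, -w z = s := by
    have := hw.sum_eq
    rw [← Finset.sum_filter_add_sum_filter_not Z (fun z => 0 < w z), hfilt] at this
    rw [Finset.sum_neg_distrib]; linarith
  have hr : ∑ z ∈ Z with w z < 0, (-w z) • z = ∑ z ∈ Z with 0 < w z, w z • z := by
    have := hw.sum_smul_eq
    rw [← Finset.sum_filter_add_sum_filter_not Z (fun z => 0 < w z), hfilt] at this
    simp only [neg_smul]
    rw [Finset.sum_neg_distrib]; exact (eq_neg_of_add_eq_zero_left this).symm
  have hposτ : Z.filter (fun z => 0 < w z) ⊆ τ := fun z hz => hyτ (by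
    obtain ⟨h1, h2⟩ := Finset.mem_filter.1 hz
    exact Finset.mem_erase.2 ⟨fun h => by rw [h] at h2; linarith, h1⟩)
  have hnegσ : Z.filter (fun z => w z < 0) ⊆ σ := fun z hz => hxσ (by
    obtain ⟨h1, h2⟩ := Finset.mem_filter.1 hz
    exact Finset.mem_erase.2 ⟨fun h => by rw [h] at h2; linarith, h1⟩)
  set r := s⁻¹ • ∑ z ∈ Z with 0 < w z, w z • z with hrdef
  have hrτ : r ∈ convexHull ℝ (τ : Set V) := by
    have := Finset.centerMass_mem_convexHull (R := ℝ) (Z.filter fun z => 0 < w z) (w := w)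
      (z := id) (s := (τ : Set V)) (fun i hi => (Finset.mem_filter.1 hi).2.le) hs0
      (fun i hi => hposτ hi)
    exact this
  have hrσ : r ∈ convexHull ℝ (σ : Set V) := by
    have := Finset.centerMass_mem_convexHull (R := ℝ) (Z.filter fun z => w z < 0)
      (w := fun z => -w z) (z := id) (s := (σ : Set V))
      (fun i hi => by have := (Finset.mem_filter.1 hi).2; linarith) (hs'.symm ▸ hs0)
      (fun i hi => hnegσ hi)
    rw [Finset.centerMass, hs'] at this
    rw [hrdef, ← hr]
    exact this
  have hrστ : r ∈ convexHull ℝ ((σ ∩ τ : Finset V) : Set V) := by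
    rw [Finset.coe_inter, ← hT.inter σ hσ τ hτ hστ]; exact ⟨hrσ, hrτ⟩
  have hfτ : τ.filter (fun z => z ∈ Z ∧ 0 < w z) = Z.filter fun z => 0 < w z := by
    ext z
    simp only [Finset.mem_filter]
    exact ⟨fun h => h.2, fun h => ⟨hposτ (Finset.mem_filter.2 h), h⟩⟩
  -- `x` has positive weight in `r`, and `r` lies on the common face. So `x ∈ σ`, and `σ` would
  -- contain all of `Z`.
  have hxmem := mem_of_weight_ne_zero (hT.indep τ hτ) (Finset.inter_subset_right (s₁ := σ))
    (w := fun z => if z ∈ Z ∧ 0 < w z then s⁻¹ * w z else 0) ?_ ?_ hxτ ?_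
  · exact hT.not_subset h hσ (hZ σ hxσ (Finset.mem_inter.1 hxmem).1)
  · rw [← Finset.sum_filter, hfτ, ← Finset.mul_sum, ← hs, inv_mul_cancel₀ hs0.ne']
  · simp only [ite_smul, zero_smul]
    rw [← Finset.sum_filter, hfτ]
    simp only [mul_smul]
    rw [← Finset.smul_sum]
    exact hrστ
  · rw [if_pos ⟨hx, hxw⟩]
    exact mul_ne_zero (inv_ne_zero hs0.ne') hxw.ne'

/-- The triangulation of the convex hull of a circuit is determined by the sign of the weight of
the point opposite to one of its simplices. -/
theorem IsCircuitWeight.triangulation_eq {Z : Finset V} (h : IsCircuit (Z : Set V)) {w : V → ℝ}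
    (hw : IsCircuitWeight Z w) {T : Finset (Finset V)}
    (hT : IsTriangulation (convexHull ℝ (Z : Set V)) T) {x : V} (hx : x ∈ Z) (hxw : 0 < w x)
    (hxT : Z.erase x ∈ T) : T = (Z.filter fun z => 0 < w z).image fun z => Z.erase z := by
  have hpos : ∀ y ∈ Z, Z.erase y ∈ T → 0 < w y := fun y hy hyT => by
    rcases lt_or_gt_of_ne (hw.ne_zero y hy) with h1 | h1
    · exact (hw.not_mem_of_sign h hT hxT hyT hx hxw h1 (Finset.Subset.refl _)
        (Finset.Subset.refl _)).elim
    · exact h1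
  ext σ
  simp only [Finset.mem_image, Finset.mem_filter]
  constructor
  · intro hσ
    obtain ⟨y, hy, rfl⟩ := h.exists_eq_erase hT hσ
    exact ⟨y, ⟨hy, hpos y hy hσ⟩, rfl⟩
  · rintro ⟨y, ⟨hy, hyw⟩, rfl⟩
    have hc := h.three_le_card
    have hcard : 0 < (Z.erase y).card := by rw [Finset.card_erase_of_mem hy]; omega
    -- The barycentre of `Z.erase y` lies in some simplex `Z.erase y'` of `T`; the aim is `y' = y`.
    set c : ℝ := ((Z.erase y).card : ℝ)⁻¹ with hcdef
    have hc0 : 0 < c := inv_pos.2 (by exact_mod_cast hcard)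
    have hc1 : ∑ _z ∈ Z.erase y, c = 1 := by
      rw [Finset.sum_const, nsmul_eq_mul, hcdef, mul_inv_cancel₀]
      exact_mod_cast hcard.ne'
    have hmem : ∑ z ∈ Z.erase y, c • z ∈ convexHull ℝ (Z : Set V) :=
      (convex_convexHull ℝ _).sum_mem (fun _ _ => hc0.le) hc1 fun z hz =>
        subset_convexHull ℝ _ (Finset.mem_of_mem_erase hz)
    rw [← hT.cover] at hmem
    obtain ⟨σ, hσ, hmem⟩ := Set.mem_iUnion₂.1 hmem
    obtain ⟨y', hy', rfl⟩ := h.exists_eq_erase hT hσ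
    rcases eq_or_ne y' y with rfl | hne
    · exact hσ
    obtain ⟨u, hu0, hu1, hu2⟩ := Finset.mem_convexHull'.1 hmem
    -- If `y' ≠ y`, the two expressions for the barycentre differ by `t * w`. At `y'` this gives `c
    -- = t * w y'`, so `t > 0`; at `y` it gives `-u y = t * w y > 0`, a contradiction.
    have hdiff := hw.unique (fun z => (if z = y then 0 else c) - (if z = y' then 0 else u z))
      ?_ ?_
    · obtain ⟨t, ht⟩ := hdiff
      have h1 := ht y hy
      have h2 := ht y' hy'
      simp only [if_true, if_neg hne, if_neg hne.symm] at h1 h2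
      have h3 := hu0 y (Finset.mem_erase.2 ⟨hne.symm, hy⟩)
      have h4 := hpos y' hy' hσ
      have h5 : 0 < t := by
        by_contra ht0
        have := mul_nonpos_of_nonpos_of_nonneg (not_lt.1 ht0) h4.le
        linarith
      have := mul_pos h5 hyw
      linarith
    · rw [Finset.sum_sub_distrib, ← Finset.add_sum_erase _ _ hy,
        ← Finset.add_sum_erase (a := y') _ _ hy', if_pos rfl, if_pos rfl,
        Finset.sum_congr rfl fun z hz => if_neg (Finset.ne_of_mem_erase hz),
        Finset.sum_congr (s₁ := Z.erase y') rfl fun z hz => if_neg (Finset.ne_of_mem_erase hz),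
        hc1, hu1]
      simp
    · simp only [sub_smul, ite_smul, zero_smul]
      rw [Finset.sum_sub_distrib, ← Finset.add_sum_erase _ _ hy,
        ← Finset.add_sum_erase (a := y') _ _ hy', if_pos rfl, if_pos rfl,
        Finset.sum_congr rfl fun z hz => if_neg (Finset.ne_of_mem_erase hz),
        Finset.sum_congr (s₁ := Z.erase y') rfl fun z hz => if_neg (Finset.ne_of_mem_erase hz),
        hu2]
      simp

end CircuitTriangulations

/-! ### Splitting a simplex into its circuit part and its link -/

section Combinatorics

variable {V : Type*} [DecidableEq V] {Z : Finset V}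

theorem mem_circuitSimplices {T : Finset (Finset V)} {σ : Finset V} :
    σ ∈ circuitSimplices Z T ↔ (∃ z ∈ Z, Z.erase z = σ) ∧ ∃ τ ∈ T, σ ⊆ τ := by
  simp [circuitSimplices]

theorem erase_union_sdiff {F : Finset V} (hF : Disjoint F Z) (z : V) :
    (Z.erase z ∪ F) \ Z = F := by
  ext y
  simp only [Finset.mem_sdiff, Finset.mem_union, Finset.mem_erase]
  exact ⟨fun ⟨h1, h2⟩ => h1.resolve_left fun h => h2 h.2,
    fun h => ⟨Or.inr h, Finset.disjoint_left.1 hF h⟩⟩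

theorem eq_erase_union_sdiff {σ : Finset V} {z : V} (h : Z.erase z ⊆ σ) (hz : z ∉ σ) :
    σ = Z.erase z ∪ (σ \ Z) := by
  ext y
  simp only [Finset.mem_sdiff, Finset.mem_union, Finset.mem_erase]
  constructor
  · intro hy
    by_cases hyZ : y ∈ Z
    · exact Or.inl ⟨fun he => hz (he ▸ hy), hyZ⟩
    · exact Or.inr ⟨hy, hyZ⟩
  · rintro (hy | hy)
    · exact h (Finset.mem_erase.2 hy)
    · exact hy.1

end Combinatorics

/-! ### Flips in terms of the signs of a dependency -/

section Flips

variable {V : Type*} [AddCommGroup V] [Module ℝ V] [DecidableEq V] {P : Set V}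
  {T₁ T₂ : Finset (Finset V)} {Z : Finset V}

/-- If a triangulation contains the simplices opposite to the points of positive weight, then these
form the triangulation induced on the circuit. -/
theorem circuitSimplices_eq (h : IsCircuit (Z : Set V)) {w : V → ℝ} (hw : IsCircuitWeight Z w)
    {T : Finset (Finset V)} (hT : IsTriangulation P T) {x : V} (hx : x ∈ Z) (hxw : 0 < w x)
    (hsub : ∀ z ∈ Z, 0 < w z → ∃ τ ∈ T, Z.erase z ⊆ τ) :
    circuitSimplices Z T = (Z.filter fun z => 0 < w z).image fun z => Z.erase z := by
  ext σ
  rw [mem_circuitSimplices]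
  simp only [Finset.mem_image, Finset.mem_filter]
  constructor
  · rintro ⟨⟨z, hz, rfl⟩, τ, hτ, hzτ⟩
    refine ⟨z, ⟨hz, ?_⟩, rfl⟩
    rcases lt_or_gt_of_ne (hw.ne_zero z hz) with h1 | h1
    · obtain ⟨ρ, hρ, hxρ⟩ := hsub x hx hxw
      exact (hw.not_mem_of_sign h hT hρ hτ hx hxw h1 hxρ hzτ).elim
    · exact h1
  · rintro ⟨z, ⟨hz, hzw⟩, rfl⟩
    exact ⟨⟨z, hz, rfl⟩, hsub z hz hzw⟩

/-- The combinatorial content of a flip. -/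
structure IsWeightedFlip (T₁ T₂ : Finset (Finset V)) (Z : Finset V) (w : V → ℝ) : Prop where
  circuit : IsCircuit (Z : Set V)
  weight : IsCircuitWeight Z w
  left : circuitSimplices Z T₁ = (Z.filter fun z => 0 < w z).image fun z => Z.erase z
  right : circuitSimplices Z T₂ = (Z.filter fun z => w z < 0).image fun z => Z.erase z
  link : ∀ z ∈ Z, 0 < w z → ∀ y ∈ Z, 0 < w y → ∀ F : Finset V, Disjoint F Z →
    Z.erase z ∪ F ∈ T₁ → Z.erase y ∪ F ∈ T₁
  mem_iff : ∀ σ : Finset V, σ ∈ T₂ ↔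
      (σ ∈ T₁ ∧ ∀ z ∈ Z, 0 < w z → ¬ Z.erase z ⊆ σ) ∨
      (∃ y ∈ Z, w y < 0 ∧ ∃ F : Finset V, Disjoint F Z ∧ σ = Z.erase y ∪ F ∧
        ∃ z ∈ Z, 0 < w z ∧ Z.erase z ∪ F ∈ T₁)

/-- The dependency is scaled to be positive at a point opposite to a simplex of `Tp`. Its signs
determine a triangulation of the circuit, so `Tp ≠ Tm` makes the points opposite to simplices of
`Tm` negative. -/
theorem IsFlip.exists_weightedFlip (hF : IsFlip P T₁ T₂ Z) (hT₁ : IsTriangulation P T₁)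
    (hT₂ : IsTriangulation P T₂) : ∃ w, IsWeightedFlip T₁ T₂ Z w := by
  obtain ⟨hZ, -, Tp, Tm, hTp, hTm, hne, hsub, hlink, hmem⟩ := hF
  have hnonempty : ∀ T, IsTriangulation (convexHull ℝ (Z : Set V)) T → ∃ z ∈ Z, Z.erase z ∈ T := by
    intro T hT
    obtain ⟨z, hz⟩ := Finset.card_pos.1 (by have := hZ.three_le_card; omega : 0 < Z.card)
    have hz' : z ∈ convexHull ℝ (Z : Set V) := subset_convexHull ℝ _ hz
    rw [← hT.cover] at hz'
    obtain ⟨σ, hσ, -⟩ := Set.mem_iUnion₂.1 hz'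
    obtain ⟨y, hy, rfl⟩ := hZ.exists_eq_erase hT hσ
    exact ⟨y, hy, hσ⟩
  obtain ⟨x, hx, hxT⟩ := hnonempty Tp hTp
  obtain ⟨y, hy, hyT⟩ := hnonempty Tm hTm
  obtain ⟨w, hw, hxw⟩ : ∃ w, IsCircuitWeight Z w ∧ 0 < w x := by
    obtain ⟨w, hw⟩ := hZ.exists_weight
    rcases lt_or_gt_of_ne (hw.ne_zero x hx) with h | h
    · exact ⟨_, hw.neg, by linarith⟩
    · exact ⟨w, hw, h⟩
  have hTp' := hw.triangulation_eq hZ hTp hx hxw hxT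
  have hyw : w y < 0 := by
    rcases lt_or_gt_of_ne (hw.ne_zero y hy) with h | h
    · exact h
    · exact (hne (hTp'.trans (hw.triangulation_eq hZ hTm hy h hyT).symm)).elim
  have hTm' := hw.neg.triangulation_eq hZ hTm hy (by linarith) hyT
  simp only [Left.neg_pos_iff] at hTm'
  have hTpmem : ∀ z ∈ Z, 0 < w z → Z.erase z ∈ Tp := fun z hz hzw => by
    rw [hTp']; exact Finset.mem_image.2 ⟨z, Finset.mem_filter.2 ⟨hz, hzw⟩, rfl⟩
  have hTmmem : ∀ z ∈ Z, w z < 0 → Z.erase z ∈ Tm := fun z hz hzw => by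
    rw [hTm']; exact Finset.mem_image.2 ⟨z, Finset.mem_filter.2 ⟨hz, hzw⟩, rfl⟩
  have hleft : circuitSimplices Z T₁ = (Z.filter fun z => 0 < w z).image fun z => Z.erase z :=
    circuitSimplices_eq hZ hw hT₁ hx hxw fun z hz hzw => hsub _ (hTpmem z hz hzw)
  refine ⟨w, hZ, hw, hleft, ?_, ?_, ?_⟩
  · have h1 := circuitSimplices_eq hZ hw.neg hT₂ hy (by linarith) fun z hz hzw => by
      obtain ⟨σ, hσ, hxσ⟩ := hsub _ hxT
      have hxn : x ∉ σ := fun h => hT₁.not_subset hZ hσ (by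
        rw [← Finset.insert_erase hx]; exact Finset.insert_subset h hxσ)
      refine ⟨Z.erase z ∪ (σ \ Z), (hmem _).2 (Or.inr ⟨_, hTmmem z hz (by linarith), _,
        Finset.sdiff_disjoint, rfl, _, hxT, ?_⟩), Finset.subset_union_left⟩
      rwa [← eq_erase_union_sdiff hxσ hxn]
    simpa only [Left.neg_pos_iff] using h1
  · intro z hz hzw y hy hyw F hF h
    exact hlink _ (hTpmem z hz hzw) _ (hTpmem y hy hyw) F hF h
  · intro σ
    rw [hmem σ, hTp', hTm']
    simp only [Finset.mem_image, Finset.mem_filter]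
    refine or_congr (and_congr_right fun _ => ?_) ?_
    · exact ⟨fun h z hz hzw => h _ ⟨z, ⟨hz, hzw⟩, rfl⟩, fun h I ⟨z, hz, hI⟩ => hI ▸ h z hz.1 hz.2⟩
    · constructor
      · rintro ⟨_, ⟨y, ⟨hy, hyw⟩, rfl⟩, F, hF, hσ, _, ⟨z, ⟨hz, hzw⟩, rfl⟩, hzF⟩
        exact ⟨y, hy, hyw, F, hF, hσ, z, hz, hzw, hzF⟩
      · rintro ⟨y, hy, hyw, F, hF, hσ, z, hz, hzw, hzF⟩
        exact ⟨_, ⟨y, ⟨hy, hyw⟩, rfl⟩, F, hF, hσ, _, ⟨z, ⟨hz, hzw⟩, rfl⟩, hzF⟩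

theorem IsWeightedFlip.disjoint {w : V → ℝ} (h : IsWeightedFlip T₁ T₂ Z w) :
    Disjoint (circuitSimplices Z T₁) (circuitSimplices Z T₂) := by
  rw [h.left, h.right, Finset.disjoint_left]
  intro σ h1 h2
  obtain ⟨x, hx, rfl⟩ := Finset.mem_image.1 h1
  obtain ⟨y, hy, hxy⟩ := Finset.mem_image.1 h2
  obtain ⟨hx, hxw⟩ := Finset.mem_filter.1 hx
  obtain ⟨hy, hyw⟩ := Finset.mem_filter.1 hy
  have : y = x := Finset.erase_injOn Z hy hx hxy
  rw [this] at hyw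
  linarith

theorem IsWeightedFlip.union {w : V → ℝ} (h : IsWeightedFlip T₁ T₂ Z w) :
    circuitSimplices Z T₁ ∪ circuitSimplices Z T₂ = Z.image fun w => Z.erase w := by
  rw [h.left, h.right, ← Finset.image_union, ← Finset.filter_or]
  congr 1
  refine Finset.filter_true_of_mem fun z hz => ?_
  exact (lt_or_gt_of_ne (h.weight.ne_zero z hz)).symm

/-- The simplices removed by a flip with a given link. -/
theorem IsWeightedFlip.removed {w : V → ℝ} (h : IsWeightedFlip T₁ T₂ Z w)
    (hT₁ : IsTriangulation P T₁) {F : Finset V} (hF : Disjoint F Z)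
    (hex : ∃ z ∈ Z, 0 < w z ∧ Z.erase z ∪ F ∈ T₁) :
    (T₁ \ T₂).filter (fun s => s \ Z = F) =
      (Z.filter fun z => 0 < w z).image fun z => Z.erase z ∪ F := by
  ext σ
  simp only [Finset.mem_filter, Finset.mem_sdiff, Finset.mem_image]
  constructor
  · rintro ⟨⟨h1, h2⟩, h3⟩
    have h4 : ∃ z ∈ Z, 0 < w z ∧ Z.erase z ⊆ σ := by
      by_contra hcon
      push Not at hcon
      exact h2 ((h.mem_iff σ).2 (Or.inl ⟨h1, hcon⟩))
    obtain ⟨z, hz, hzw, hzσ⟩ := h4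
    have hzn : z ∉ σ := fun hm => hT₁.not_subset h.circuit h1 (by
        rw [← Finset.insert_erase hz]; exact Finset.insert_subset hm hzσ)
    refine ⟨z, ⟨hz, hzw⟩, ?_⟩
    rw [← h3, ← eq_erase_union_sdiff hzσ hzn]
  · rintro ⟨z, ⟨hz, hzw⟩, rfl⟩
    obtain ⟨y, hy, hyw, hyT⟩ := hex
    refine ⟨⟨h.link y hy hyw z hz hzw F hF hyT, fun h2 => ?_⟩, erase_union_sdiff hF z⟩
    have h3 : Z.erase z ∈ circuitSimplices Z T₂ :=
      mem_circuitSimplices.2 ⟨⟨z, hz, rfl⟩, _, h2, Finset.subset_union_left⟩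
    have h4 : Z.erase z ∈ circuitSimplices Z T₁ := by
      rw [h.left]; exact Finset.mem_image.2 ⟨z, Finset.mem_filter.2 ⟨hz, hzw⟩, rfl⟩
    exact Finset.disjoint_left.1 h.disjoint h4 h3

/-- The simplices added by a flip with a given link. -/
theorem IsWeightedFlip.added {w : V → ℝ} (h : IsWeightedFlip T₁ T₂ Z w)
    {F : Finset V} (hF : Disjoint F Z)
    (hex : ∃ z ∈ Z, 0 < w z ∧ Z.erase z ∪ F ∈ T₁) :
    (T₂ \ T₁).filter (fun s => s \ Z = F) =
      (Z.filter fun z => w z < 0).image fun z => Z.erase z ∪ F := by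
  ext σ
  simp only [Finset.mem_filter, Finset.mem_sdiff, Finset.mem_image]
  constructor
  · rintro ⟨⟨h1, h2⟩, h3⟩
    rcases (h.mem_iff σ).1 h1 with h4 | ⟨y, hy, hyw, F', hF', rfl, -⟩
    · exact (h2 h4.1).elim
    · rw [erase_union_sdiff hF' y] at h3
      exact ⟨y, ⟨hy, hyw⟩, by rw [h3]⟩
  · rintro ⟨z, ⟨hz, hzw⟩, rfl⟩
    refine ⟨⟨(h.mem_iff _).2 (Or.inr ⟨z, hz, hzw, F, hF, rfl, hex⟩), fun h2 => ?_⟩,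
      erase_union_sdiff hF z⟩
    have h3 : Z.erase z ∈ circuitSimplices Z T₁ :=
      mem_circuitSimplices.2 ⟨⟨z, hz, rfl⟩, _, h2, Finset.subset_union_left⟩
    have h4 : Z.erase z ∈ circuitSimplices Z T₂ := by
      rw [h.right]; exact Finset.mem_image.2 ⟨z, Finset.mem_filter.2 ⟨hz, hzw⟩, rfl⟩
    exact Finset.disjoint_left.1 h.disjoint h3 h4

end Flips

/-! ### Facets of an enumerated vertex set -/

section Enumerations

variable {V : Type*} [DecidableEq V] {n : ℕ} {Z : Finset V}

theorem range_comp_succAbove {v : Fin (n + 2) → V} (hv : Function.Injective v)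
    {R : Finset V} (hR : Set.range v = (R : Set V)) (i : Fin (n + 2)) :
    Set.range (v ∘ i.succAbove) = (R.erase (v i) : Set V) := by
  rw [Set.range_comp, Fin.range_succAbove, Finset.coe_erase, ← hR]
  ext x
  constructor
  · rintro ⟨j, hj, rfl⟩
    exact ⟨⟨j, rfl⟩, fun h => hj (hv h)⟩
  · rintro ⟨⟨j, rfl⟩, hj⟩
    exact ⟨j, fun h => hj (by rw [h]; rfl), rfl⟩

theorem card_of_range_eq {X : Type*} {m : ℕ} {z : Fin m → X} (hz : Function.Injective z)
    {Z : Finset X} (hZ : Set.range z = (Z : Set X)) : Z.card = m := by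
  have h := sum_range_eq hz hZ fun _ => 1
  simpa using h.symm

theorem erase_union_injOn {F : Finset V} (hF : Disjoint F Z) :
    Set.InjOn (fun z => Z.erase z ∪ F) (Z : Set V) := by
  intro x hx y hy hxy
  by_contra hne
  have h1 : x ∈ Z.erase y ∪ F := Finset.mem_union_left _ (Finset.mem_erase.2 ⟨hne, hx⟩)
  have hxy' : Z.erase x ∪ F = Z.erase y ∪ F := hxy
  rw [← hxy'] at h1
  rcases Finset.mem_union.1 h1 with h2 | h2
  · exact Finset.notMem_erase x Z h2
  · exact Finset.disjoint_left.1 hF h2 hx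

theorem sum_ite_mem_eq {m : ℕ} {M : Type*} [AddCommMonoid M] {v : Fin m → V}
    (hv : Function.Injective v) {R : Finset V} (hR : Set.range v = (R : Set V)) (hZR : Z ⊆ R)
    (g : V → M) : ∑ i, (if v i ∈ Z then g (v i) else 0) = ∑ z ∈ Z, g z := by
  rw [sum_range_eq hv hR fun x => if x ∈ Z then g x else 0, ← Finset.sum_filter,
    Finset.filter_mem_eq_inter, Finset.inter_eq_right.2 hZR]

end Enumerations

/-! ### Cramer's rule and the partial boundary of a circuit -/

section FlipFormula

variable {V : Type*} [AddCommGroup V] [Module ℝ V] {n : ℕ} {Q : Set V}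

/-- Cramer's rule: the signs of the facets of a tuple are those of an affine dependency. -/
theorem IsHomogenization.exists_sign {f : V →ᵃ[ℝ] (Fin (n + 1) → ℝ)}
    {ξ : (Fin (n + 1) → ℝ) →ₗ[ℝ] ℝ} (hf : IsHomogenization Q f ξ) {v : Fin (n + 2) → V}
    (hv : ∀ i, v i ∈ Q) {μ : Fin (n + 2) → ℝ} (h1 : ∑ i, μ i = 0) (h2 : ∑ i, μ i • v i = 0)
    {j : Fin (n + 2)} (hj : μ j ≠ 0) (hind : AffineIndependent ℝ (v ∘ j.succAbove)) :
    ∃ e : ℤˣ, ∀ i, μ i ≠ 0 → Matrix.detRowAlternating (f ∘ v ∘ i.succAbove) ≠ 0 ∧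
      (e : ℤ) * (-1) ^ ((i : ℕ) + 1) = (SignType.sign (μ i) : ℤ) *
        (SignType.sign (Matrix.detRowAlternating (f ∘ v ∘ i.succAbove)) : ℤ) := by
  set δ : Fin (n + 2) → ℝ := fun i =>
    (-1 : ℝ) ^ (i : ℕ) * Matrix.detRowAlternating ((f ∘ v) ∘ i.succAbove) with hδ
  have h3 : ∑ i, μ i • f (v i) = 0 := by
    rw [map_sum_smul_of_height, h1, h2]; simp
  have h4 : ∑ i, δ i • f (v i) = 0 := alternating_boundary_eq_zero _ (f ∘ v)
  have hδj : δ j ≠ 0 := mul_ne_zero (pow_ne_zero _ (by norm_num))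
    ((hf.det_ne_zero_iff fun i => hv _).2 hind)
  have hlin : LinearIndependent ℝ (f ∘ v ∘ j.succAbove) :=
    (hf.linearIndependent_iff fun i => hv _).2 hind
  -- The combination `δ j * μ - μ j * δ` is a dependency vanishing at `j`, hence zero since the
  -- other points are independent. So `δ` and `μ` are proportional.
  have h5 : ∀ i, δ j * μ i = μ j * δ i := by
    intro i
    rcases eq_or_ne i j with rfl | hij
    · ring
    obtain ⟨k, rfl⟩ := Fin.exists_succAbove_eq hij
    have h6 : ∑ i, (δ j * μ i - μ j * δ i) • f (v i) = 0 := by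
      simp only [sub_smul, mul_smul]
      rw [Finset.sum_sub_distrib, ← Finset.smul_sum, ← Finset.smul_sum, h3, h4]; simp
    rw [Fin.sum_univ_succAbove _ j, mul_comm, sub_self, zero_smul, zero_add] at h6
    exact sub_eq_zero.1 (Fintype.linearIndependent_iff.1 hlin _ h6 k)
  have h7 : ∃ c : ℝ, c ≠ 0 ∧ ∀ i, δ i = c * μ i := by
    refine ⟨δ j / μ j, div_ne_zero hδj hj, fun i => ?_⟩
    have := h5 i
    field_simp
    linarith
  obtain ⟨c, hc, hcμ⟩ := h7
  have hsq : ∀ i : ℕ, ((-1 : ℝ) ^ i) * (-1) ^ i = 1 := fun i => by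
    rw [← pow_add, Even.neg_one_pow ⟨_, rfl⟩]
  have hdet : ∀ i : Fin (n + 2), Matrix.detRowAlternating (f ∘ v ∘ i.succAbove) =
      (-1 : ℝ) ^ (i : ℕ) * (c * μ i) := fun i => by
    rw [← hcμ, hδ, ← mul_assoc, hsq, one_mul]; rfl
  have hpow : ∀ k : ℕ, (SignType.sign ((-1 : ℝ) ^ k) : ℤ) = (-1) ^ k := fun k => by
    rcases Nat.even_or_odd k with h | h
    · simp [h.neg_one_pow]
    · simp [h.neg_one_pow]
  have hsign : ∀ x : ℝ, x ≠ 0 → (SignType.sign x : ℤ) * SignType.sign x = 1 := fun x hx => by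
    rcases lt_or_gt_of_ne hx with h | h
    · simp [sign_neg h]
    · simp [sign_pos h]
  -- The unit is `-sign c`; the minus sign comes from the exponent `i + 1` as opposed to `i` in `δ`.
  refine ⟨if 0 < c then -1 else 1, fun i hi => ⟨?_, ?_⟩⟩
  · rw [hdet]
    exact mul_ne_zero (pow_ne_zero _ (by norm_num)) (mul_ne_zero hc hi)
  · rw [hdet, sign_mul, sign_mul, SignType.coe_mul, SignType.coe_mul, hpow]
    have hs := hsign _ hi
    have h8 : ((if 0 < c then -1 else 1 : ℤˣ) : ℤ) = - SignType.sign c := by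
      split_ifs with h
      · simp [sign_pos h]
      · simp [sign_neg (lt_of_le_of_ne (not_lt.1 h) hc)]
    rw [h8, pow_succ]
    linear_combination (-(SignType.sign c : ℤ) * (-1) ^ (i : ℕ)) * hs

/-- The partial boundary of a tuple extending a circuit, in terms of the two triangulations. -/
theorem exists_smul_sum_signedFace [DecidableEq V] [FiniteDimensional ℝ (vectorSpan ℝ Q)]
    (hn : finrank ℝ (vectorSpan ℝ Q) = n) (hpos : 0 < n)
    (o : Orientation ℝ (vectorSpan ℝ Q) (Fin n)) {v : Fin (n + 2) → V}
    (hv : Function.Injective v) {R Z : Finset V} (hR : Set.range v = (R : Set V))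
    (hRQ : (R : Set V) ⊆ Q) (hZR : Z ⊆ R) {w : V → ℝ} (hw : IsCircuitWeight Z w) {z₀ : V}
    (hz₀ : z₀ ∈ Z)
    (hind : AffineIndependent ℝ (Subtype.val : {x : V // x ∈ R.erase z₀} → V)) :
    ∃ e : ℤˣ, (e : ℤ) • ∑ i with v i ∈ Z, signedFace v i =
      ∑ z ∈ Z with 0 < w z, orientedSymbol o (R.erase z) -
        ∑ z ∈ Z with w z < 0, orientedSymbol o (R.erase z) := by
  obtain ⟨q, hq⟩ := exists_projection (vectorSpan ℝ Q)
  have : Nonempty (Fin n) := ⟨⟨0, hpos⟩⟩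
  obtain ⟨b, rfl⟩ : ∃ b : Basis (Fin n) ℝ (vectorSpan ℝ Q), b.orientation = o :=
    ⟨o.someBasis (by simpa using hn.symm), o.someBasis_orientation _⟩
  have hf := isHomogenization_homogenization (le_refl (vectorSpan ℝ Q)) b hq
  have hvR : ∀ i, v i ∈ R := fun i => by
    have : v i ∈ (R : Set V) := hR ▸ Set.mem_range_self i
    exact this
  have hvQ : ∀ i, v i ∈ Q := fun i => hRQ (hvR i)
  obtain ⟨j, rfl⟩ : ∃ j, v j = z₀ := by
    have : z₀ ∈ (R : Set V) := hZR hz₀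
    rw [← hR] at this
    exact this
  -- The dependency of the circuit is extended by zero to the larger tuple.
  obtain ⟨e, he⟩ := hf.exists_sign hvQ (μ := fun i => if v i ∈ Z then w (v i) else 0) (j := j)
    (by rw [sum_ite_mem_eq hv hR hZR, hw.sum_eq])
    (by
      simp only [ite_smul, zero_smul]
      rw [sum_ite_mem_eq hv hR hZR fun x => w x • x, hw.sum_smul_eq])
    (by rw [if_pos hz₀]; exact hw.ne_zero _ hz₀)
    ((affineIndependent_comp_iff (hv.comp Fin.succAbove_right_injective)
      (range_comp_succAbove hv hR j)).2 hind)
  refine ⟨e, ?_⟩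
  have hterm : ∀ i, v i ∈ Z → (e : ℤ) • signedFace v i =
      (SignType.sign (w (v i)) : ℤ) • orientedSymbol b.orientation (R.erase (v i)) := by
    intro i hi
    obtain ⟨h1, h2⟩ := he i (by rw [if_pos hi]; exact hw.ne_zero _ hi)
    rw [if_pos hi] at h2
    rw [orientedSymbol_eq hpos b hq (hv.comp Fin.succAbove_right_injective)
      (fun k l => vsub_mem_vectorSpan ℝ (hvQ _) (hvQ _)) h1 (range_comp_succAbove hv hR i),
      signedFace, smul_smul, smul_smul, h2]
  rw [Finset.smul_sum, Finset.sum_congr rfl fun i hi => hterm i (Finset.mem_filter.1 hi).2,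
    Finset.sum_filter, sum_ite_mem_eq hv hR hZR fun x =>
      (SignType.sign (w x) : ℤ) • orientedSymbol b.orientation (R.erase x),
    ← Finset.sum_filter_add_sum_filter_not Z (fun z => 0 < w z), sub_eq_add_neg,
    ← Finset.sum_neg_distrib]
  congr 1
  · refine Finset.sum_congr rfl fun z hz => ?_
    rw [sign_pos (Finset.mem_filter.1 hz).2]; simp
  · refine Finset.sum_congr (Finset.filter_congr fun z hz => ?_) fun z hz => ?_
    · have := hw.ne_zero z hz
      exact not_lt.trans (le_iff_lt_or_eq.trans (or_iff_left this))
    · have h1 := Finset.mem_filter.1 hz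
      rw [sign_neg h1.2]; simp

end FlipFormula

/-! ### The identities for a single flip -/

section FlipTheorem

variable {V : Type*} [AddCommGroup V] [Module ℝ V] [DecidableEq V] {P : Set V} {n : ℕ}
  {T₁ T₂ : Finset (Finset V)} {Z : Finset V} {w : V → ℝ}

theorem IsWeightedFlip.exists_link (h : IsWeightedFlip T₁ T₂ Z w) (hT₁ : IsTriangulation P T₁)
    {σ : Finset V} (hσ : σ ∈ T₁) (hσ₂ : σ ∉ T₂) :
    ∃ z ∈ Z, 0 < w z ∧ Z.erase z ∪ (σ \ Z) ∈ T₁ := by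
  have h4 : ∃ z ∈ Z, 0 < w z ∧ Z.erase z ⊆ σ := by
    by_contra hcon
    push Not at hcon
    exact hσ₂ ((h.mem_iff σ).2 (Or.inl ⟨hσ, hcon⟩))
  obtain ⟨z, hz, hzw, hzσ⟩ := h4
  have hzn : z ∉ σ := fun hm => hT₁.not_subset h.circuit hσ (by
    rw [← Finset.insert_erase hz]; exact Finset.insert_subset hm hzσ)
  exact ⟨z, hz, hzw, by rwa [← eq_erase_union_sdiff hzσ hzn]⟩

theorem IsWeightedFlip.finrank_add_two {Tp : Finset (Finset V)}
    (h : IsWeightedFlip T₁ T₂ Z w) (hTp : IsTriangulation (convexHull ℝ (Z : Set V)) Tp) {m : ℕ}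
    (hm : Z.card = m + 2) : finrank ℝ (vectorSpan ℝ (Z : Set V)) = m := by
  have := h.circuit.card_eq hTp
  omega

/-- The general sign formula with no vertices outside the circuit, taken in the affine hull of `Z`.
-/
theorem IsWeightedFlip.circuit_formula {Tp : Finset (Finset V)} (h : IsWeightedFlip T₁ T₂ Z w)
    (hTp : IsTriangulation (convexHull ℝ (Z : Set V)) Tp) {m : ℕ} {z : Fin (m + 2) → V}
    (hz : Function.Injective z) (hzZ : Set.range z = (Z : Set V))
    (o : Orientation ℝ (vectorSpan ℝ (Z : Set V)) (Fin m)) :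
    ∃ e : ℤˣ, (e : ℤ) • ∑ i : Fin (m + 2), (-1 : ℤ) ^ ((i : ℕ) + 1) •
        chainSymbol (z ∘ i.succAbove) =
      ∑ s ∈ circuitSimplices Z T₁, orientedSymbol o s -
        ∑ u ∈ circuitSimplices Z T₂, orientedSymbol o u := by
  have hcard := card_of_range_eq hz hzZ
  have h3 := h.circuit.three_le_card
  have : FiniteDimensional ℝ (vectorSpan ℝ (Z : Set V)) :=
    finiteDimensional_vectorSpan_of_finite ℝ Z.finite_toSet
  obtain ⟨z₀, hz₀⟩ := h.weight.nonempty
  obtain ⟨e, he⟩ := exists_smul_sum_signedFace (h.finrank_add_two hTp hcard) (by omega) o hz hzZ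
    (Set.Subset.refl _) (Finset.Subset.refl Z) h.weight hz₀ (h.circuit.erase_indep hz₀)
  refine ⟨e, ?_⟩
  have hall : (Finset.univ.filter fun i => z i ∈ Z) = Finset.univ := by
    refine Finset.filter_true_of_mem fun i _ => ?_
    have : z i ∈ (Z : Set V) := hzZ ▸ Set.mem_range_self i
    exact this
  rw [hall] at he
  rw [h.left, h.right, Finset.sum_image fun x hx y hy hxy => Finset.erase_injOn Z
    (Finset.mem_filter.1 hx).1 (Finset.mem_filter.1 hy).1 hxy, Finset.sum_image fun x hx y hy hxy =>
    Finset.erase_injOn Z (Finset.mem_filter.1 hx).1 (Finset.mem_filter.1 hy).1 hxy]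
  exact he

/-- When `Z` has `n + 2` points, each `Z.erase z` already has the size of a maximal simplex, so
every link is empty. -/
theorem IsWeightedFlip.eq_sdiff (h : IsWeightedFlip T₁ T₂ Z w) (hT₁ : IsTriangulation P T₁)
    (hT₂ : IsTriangulation P T₂) (hn : finrank ℝ (vectorSpan ℝ P) = n) (hZ : Z.card = n + 2) :
    circuitSimplices Z T₁ = T₁ \ T₂ ∧ circuitSimplices Z T₂ = T₂ \ T₁ := by
  have hface : ∀ T, IsTriangulation P T → ∀ σ ∈ circuitSimplices Z T, σ ∈ T := by
    intro T hT σ hσ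
    obtain ⟨⟨z, hz, rfl⟩, τ, hτ, hsub⟩ := mem_circuitSimplices.1 hσ
    have : Z.erase z = τ := Finset.eq_of_subset_of_card_le hsub (by
      rw [hT.card_eq τ hτ, hn, Finset.card_erase_of_mem hz, hZ]; omega)
    rwa [this]
  have hmem : ∀ T σ, σ ∈ T → (∃ z ∈ Z, Z.erase z = σ) → σ ∈ circuitSimplices Z T :=
    fun T σ hσ hz => mem_circuitSimplices.2 ⟨hz, σ, hσ, Finset.Subset.refl _⟩
  have hempty : ∀ T, IsTriangulation P T → ∀ z ∈ Z, ∀ F : Finset V, Disjoint F Z →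
      Z.erase z ∪ F ∈ T → F = ∅ := by
    intro T hT z hz F hF hσ
    have h1 := hT.card_eq _ hσ
    rw [Finset.card_union_of_disjoint (Finset.disjoint_of_subset_left (Finset.erase_subset z Z)
      hF.symm), Finset.card_erase_of_mem hz, hZ, hn] at h1
    exact Finset.card_eq_zero.1 (by omega)
  constructor
  · ext σ
    rw [Finset.mem_sdiff]
    constructor
    · intro hσ
      refine ⟨hface T₁ hT₁ σ hσ, fun hσ₂ => Finset.disjoint_left.1 h.disjoint hσ (hmem T₂ σ hσ₂ ?_)⟩
      exact (mem_circuitSimplices.1 hσ).1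
    · rintro ⟨h1, h2⟩
      refine hmem T₁ σ h1 ?_
      have h4 : ∃ z ∈ Z, 0 < w z ∧ Z.erase z ⊆ σ := by
        by_contra hcon
        push Not at hcon
        exact h2 ((h.mem_iff σ).2 (Or.inl ⟨h1, hcon⟩))
      obtain ⟨z, hz, -, hzσ⟩ := h4
      exact ⟨z, hz, Finset.eq_of_subset_of_card_le hzσ (by
        rw [hT₁.card_eq σ h1, hn, Finset.card_erase_of_mem hz, hZ]; omega)⟩
  · ext σ
    rw [Finset.mem_sdiff]
    constructor
    · intro hσ
      refine ⟨hface T₂ hT₂ σ hσ, fun hσ₁ => Finset.disjoint_left.1 h.disjoint (hmem T₁ σ hσ₁ ?_) hσ⟩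
      exact (mem_circuitSimplices.1 hσ).1
    · rintro ⟨h1, h2⟩
      refine hmem T₂ σ h1 ?_
      rcases (h.mem_iff σ).1 h1 with h4 | ⟨y, hy, hyw, F, hF, rfl, -⟩
      · exact (h2 h4.1).elim
      · rw [hempty T₂ hT₂ y hy F hF h1, Finset.union_empty]
        exact ⟨y, hy, rfl⟩

/-- The general sign formula for `Z ∪ F`, with `F` the link: erasing a point of `Z` from it gives
precisely the removed or added simplices with that link. -/
theorem IsWeightedFlip.link_formula (h : IsWeightedFlip T₁ T₂ Z w) (hP : IsPolytope P)
    (hn : finrank ℝ (vectorSpan ℝ P) = n) (hT₁ : IsTriangulation P T₁)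
    (hZP : (Z : Set V) ⊆ P)
    (o : Orientation ℝ (vectorSpan ℝ P) (Fin n)) {σ₀ : Finset V} (hσ₀ : σ₀ ∈ T₁ \ T₂) {p : ℕ}
    {v : Fin (n + 2) → V} (hv : Function.Injective v)
    (hvZ : v '' {i | (i : ℕ) < p} = (Z : Set V))
    (hvF : v '' {i | p ≤ (i : ℕ)} = ((σ₀ \ Z : Finset V) : Set V)) :
    ∃ e : ℤˣ, (e : ℤ) • partialBoundary p v =
      ∑ s ∈ T₁ \ T₂ with s \ Z = σ₀ \ Z, orientedSymbol o s -
        ∑ u ∈ T₂ \ T₁ with u \ Z = σ₀ \ Z, orientedSymbol o u := by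
  obtain ⟨hσ₁, hσ₂⟩ := Finset.mem_sdiff.1 hσ₀
  set F := σ₀ \ Z with hFdef
  have hF : Disjoint F Z := Finset.sdiff_disjoint
  have hlink := h.exists_link hT₁ hσ₁ hσ₂
  have hR : Set.range v = ((Z ∪ F : Finset V) : Set V) := by
    rw [Finset.coe_union, ← hvZ, ← hvF, ← Set.image_union, ← Set.image_univ]
    congr 1
    ext i
    simpa using lt_or_ge (i : ℕ) p
  have herase : ∀ z ∈ Z, (Z ∪ F).erase z = Z.erase z ∪ F := fun z hz => by
    rw [Finset.erase_union_distrib, Finset.erase_eq_of_notMem (a := z) (s := F)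
      (Finset.disjoint_right.1 hF hz)]
  have hcard : (Z ∪ F).card = n + 2 := card_of_range_eq hv hR
  have hpos : 0 < n := by
    obtain ⟨z, hz, -, hzT⟩ := hlink
    have h1 : (Z.erase z ∪ F).card = n + 1 := by rw [hT₁.card_eq _ hzT, hn]
    have h2 := Finset.card_le_card (Finset.subset_union_left (s₁ := Z.erase z) (s₂ := F))
    rw [Finset.card_erase_of_mem hz, h1] at h2
    have := h.circuit.three_le_card
    omega
  have hRP : ((Z ∪ F : Finset V) : Set V) ⊆ P := by
    rw [Finset.coe_union]
    refine Set.union_subset hZP fun x hx => hT₁.subset hσ₁ ?_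
    exact (Finset.mem_sdiff.1 hx).1
  have := hP.finiteDimensional
  have hlink' := hlink
  obtain ⟨z₀, hz₀, -, hzT⟩ := hlink'
  have hind := hT₁.indep _ hzT
  rw [← herase z₀ hz₀] at hind
  obtain ⟨e, he⟩ := exists_smul_sum_signedFace hn hpos o hv hR hRP Finset.subset_union_left
    h.weight hz₀ hind
  refine ⟨e, ?_⟩
  have hfilt : (Finset.univ.filter fun i => v i ∈ Z) =
      Finset.univ.filter fun i : Fin (n + 2) => (i : ℕ) < p := by
    refine Finset.filter_congr fun i _ => ?_
    rw [← Finset.mem_coe, ← hvZ]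
    exact ⟨fun ⟨j, hj, hji⟩ => hv hji ▸ hj, fun hi => ⟨i, hi, rfl⟩⟩
  rw [partialBoundary_eq, ← hfilt, he, h.removed hT₁ hF hlink, h.added hF hlink,
    Finset.sum_image fun x hx y hy hxy => erase_union_injOn hF
      (Finset.mem_filter.1 hx).1 (Finset.mem_filter.1 hy).1 hxy,
    Finset.sum_image fun x hx y hy hxy => erase_union_injOn hF
      (Finset.mem_filter.1 hx).1 (Finset.mem_filter.1 hy).1 hxy,
    Finset.sum_congr rfl fun z hz => by rw [herase z (Finset.mem_filter.1 hz).1],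
    Finset.sum_congr (s₁ := Z.filter fun z => w z < 0) rfl fun z hz => by
      rw [herase z (Finset.mem_filter.1 hz).1]]

end FlipTheorem

/-! ### Convex cones and symmetric matrices -/

section Cones

variable {n : ℕ}

theorem exists_sum_of_mem_coneHull {S : Set (Matrix (Fin n) (Fin n) ℝ)}
    {A : Matrix (Fin n) (Fin n) ℝ} (h : A ∈ coneHull S) :
    ∃ (m : ℕ) (c : Fin m → ℝ) (g : Fin m → Matrix (Fin n) (Fin n) ℝ), (∀ i, 0 ≤ c i) ∧
      (∀ i, g i ∈ S) ∧ A = ∑ i, c i • g i := by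
  obtain ⟨m, c, g, hA⟩ := Submodule.mem_span_set'.1 h
  exact ⟨m, fun i => c i, fun i => g i, fun i => (c i).2, fun i => (g i).2, hA.symm⟩

theorem sum_mem_coneHull {S : Set (Matrix (Fin n) (Fin n) ℝ)} {ι : Type*} {s : Finset ι}
    {c : ι → ℝ} {g : ι → Matrix (Fin n) (Fin n) ℝ} (hc : ∀ i ∈ s, 0 ≤ c i)
    (hg : ∀ i ∈ s, c i ≠ 0 → g i ∈ coneHull S) : ∑ i ∈ s, c i • g i ∈ coneHull S := by
  refine Submodule.sum_mem (Submodule.span NNReal S) fun i hi => ?_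
  by_cases h : c i = 0
  · rw [h, zero_smul]; exact Submodule.zero_mem _
  · exact Submodule.smul_mem (Submodule.span NNReal S) (⟨c i, hc i hi⟩ : NNReal) (hg i hi h)

theorem subset_coneHull (S : Set (Matrix (Fin n) (Fin n) ℝ)) : S ⊆ coneHull S :=
  Submodule.subset_span

theorem coneHull_le {S S' : Set (Matrix (Fin n) (Fin n) ℝ)} (h : S ⊆ coneHull S') :
    coneHull S ⊆ coneHull S' :=
  Submodule.span_le.2 h

theorem smul_mem_coneHull {S : Set (Matrix (Fin n) (Fin n) ℝ)} {A : Matrix (Fin n) (Fin n) ℝ}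
    {c : ℝ} (hc : 0 ≤ c) (h : A ∈ coneHull S) : c • A ∈ coneHull S :=
  Submodule.smul_mem (Submodule.span NNReal S) (⟨c, hc⟩ : NNReal) h

theorem convex_coneHull (S : Set (Matrix (Fin n) (Fin n) ℝ)) : Convex ℝ (coneHull S) := by
  intro x hx y hy a b ha hb _
  exact Submodule.add_mem (Submodule.span NNReal S) (smul_mem_coneHull ha hx)
    (smul_mem_coneHull hb hy)

/-- Rescaling the generators to height one turns conical coefficients `c i` into convex coefficients
`c i * l (g i)`. -/
theorem coneHull_inter_height {l : Matrix (Fin n) (Fin n) ℝ →ₗ[ℝ] ℝ}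
    {S : Set (Matrix (Fin n) (Fin n) ℝ)} (hS : ∀ x ∈ S, 0 < l x) :
    coneHull S ∩ {A | l A = 1} = convexHull ℝ ((fun x => (l x)⁻¹ • x) '' S) := by
  apply Set.Subset.antisymm
  · rintro A ⟨hA, hl⟩
    obtain ⟨m, c, g, hc, hg, rfl⟩ := exists_sum_of_mem_coneHull hA
    have h1 : ∑ i, c i * l (g i) = 1 := by
      have : l (∑ i, c i • g i) = 1 := hl
      simpa [map_sum] using this
    have h2 : ∑ i, c i • g i = ∑ i, (c i * l (g i)) • ((l (g i))⁻¹ • g i) := by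
      refine Finset.sum_congr rfl fun i _ => ?_
      rw [smul_smul, mul_assoc, mul_inv_cancel₀ (hS _ (hg i)).ne', mul_one]
    rw [h2]
    exact (convex_convexHull ℝ _).sum_mem (fun i _ => mul_nonneg (hc i) (hS _ (hg i)).le) h1
      fun i _ => subset_convexHull ℝ _ ⟨g i, hg i, rfl⟩
  · refine convexHull_min ?_ ((convex_coneHull S).inter ?_)
    · rintro _ ⟨x, hx, rfl⟩
      refine ⟨smul_mem_coneHull (inv_nonneg.2 (hS x hx).le) (subset_coneHull S hx), ?_⟩
      change l ((l x)⁻¹ • x) = 1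
      rw [map_smul, smul_eq_mul, inv_mul_cancel₀ (hS x hx).ne']
    · exact convex_hyperplane l.isLinear 1

theorem finrank_inf_ker {W : Type*} [AddCommGroup W] [Module ℝ W] (S : Submodule ℝ W)
    [FiniteDimensional ℝ S] (ψ : W →ₗ[ℝ] ℝ) {p : W} (hp : p ∈ S) (hψ : ψ p ≠ 0) :
    finrank ℝ (S ⊓ LinearMap.ker ψ : Submodule ℝ W) + 1 = finrank ℝ S := by
  have h1 := LinearMap.finrank_range_add_finrank_ker (ψ.comp S.subtype)
  have h2 : LinearMap.range (ψ.comp S.subtype) = ⊤ := by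
    refine LinearMap.range_eq_top.2 fun r => ⟨(r / ψ p) • ⟨p, hp⟩, ?_⟩
    simp [hψ]
  rw [h2, finrank_top, finrank_self, LinearMap.ker_comp, ← Submodule.finrank_map_subtype_eq,
    Submodule.map_comap_subtype] at h1
  omega

theorem finrank_symmetricMatrices (n : ℕ) :
    finrank ℝ (symmetricMatrices n) = n * (n + 1) / 2 := by
  let e : symmetricMatrices n ≃ₗ[ℝ] (Sym2 (Fin n) → ℝ) :=
    { toFun := fun A s => Sym2.lift ⟨fun i j => A.1 i j, fun i j => (A.2.apply i j).symm⟩ s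
      map_add' := fun A B => by funext s; induction s using Sym2.ind; rfl
      map_smul' := fun c A => by funext s; induction s using Sym2.ind; rfl
      invFun := fun g => ⟨Matrix.of fun i j => g s(i, j), by
        ext i j; simp [Sym2.eq_swap]⟩
      left_inv := fun A => by ext i j; rfl
      right_inv := fun g => by funext s; induction s using Sym2.ind; rfl }
  rw [e.finrank_eq, finrank_fintype_fun_eq_card, Sym2.card, Fintype.card_fin,
    Nat.choose_two_right, mul_comm]
  rfl

end Cones

/-! ### Scaling of sharblies and the map from chains -/

section SharblyAlgebra

variable {n r : ℕ}

theorem basicSharbly_comp_perm (v : Fin r → QVec n) (π : Equiv.Perm (Fin r)) :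
    basicSharbly (v ∘ π) = (Equiv.Perm.sign π : ℤ) • basicSharbly v := by
  have h : Finsupp.single (v ∘ π) (1 : ℚ) -
      Finsupp.single v ((Equiv.Perm.sign π : ℤ) : ℚ) ∈ sharblyRelations n r :=
    Submodule.subset_span (Or.inl (Or.inl ⟨v, π, rfl⟩))
  rw [← Int.cast_smul_eq_zsmul ℚ, basicSharbly, basicSharbly, ← map_smul, ← sub_eq_zero,
    ← map_sub, Finsupp.smul_single, smul_eq_mul, mul_one]
  exact (Submodule.Quotient.mk_eq_zero _).2 h

/-- Scaling is imposed only on the first entry. A transposition moves entry `j` there, and its sign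
cancels on both sides. -/
theorem basicSharbly_smul_apply {v w : Fin r → QVec n} (j : Fin r) {c : ℚ} (hc : c ≠ 0)
    (hj : (w j : Fin n → ℚ) = c • (v j : Fin n → ℚ)) (hne : ∀ i, i ≠ j → w i = v i) :
    basicSharbly w = basicSharbly v := by
  obtain ⟨r, rfl⟩ : ∃ s, r = s + 1 := ⟨r - 1, by have := j.2; omega⟩
  have h1 : basicSharbly (v ∘ Equiv.swap 0 j) = basicSharbly (w ∘ Equiv.swap 0 j) := by
    rw [basicSharbly, basicSharbly, ← sub_eq_zero, ← map_sub]
    refine (Submodule.Quotient.mk_eq_zero _).2 (Submodule.subset_span (Or.inr ⟨_, _, c, hc,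
      fun i hi => ?_, fun i hi => ?_, rfl⟩))
    · have : i = 0 := Fin.ext hi
      simpa [this] using hj
    · have h0 : i ≠ 0 := fun h => hi (by rw [h]; rfl)
      refine hne _ fun h => h0 ?_
      have := congrArg (Equiv.swap 0 j) h
      simpa using this
  rw [basicSharbly_comp_perm, basicSharbly_comp_perm] at h1
  rcases Int.units_eq_one_or (Equiv.Perm.sign (Equiv.swap 0 j)) with hs | hs
  · rw [hs] at h1; simpa using h1.symm
  · rw [hs] at h1; simpa using h1.symm

theorem basicSharbly_smul {v w : Fin r → QVec n} {c : Fin r → ℚ} (hc : ∀ i, c i ≠ 0)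
    (h : ∀ i, (w i : Fin n → ℚ) = c i • (v i : Fin n → ℚ)) :
    basicSharbly w = basicSharbly v := by
  classical
  have key : ∀ s : Finset (Fin r),
      basicSharbly (fun i => if i ∈ s then w i else v i) = basicSharbly v := by
    intro s
    induction s using Finset.induction_on with
    | empty => simp
    | insert j s hj ih =>
      rw [← ih]
      refine basicSharbly_smul_apply j (hc j) ?_ fun i hi => ?_
      · simpa [hj] using h j
      · simp [hi]
  simpa using key Finset.univ

theorem antisymRelations_le_ker {X : Type*} (ρ : X → QVec n) :
    antisymRelations X r ≤ LinearMap.ker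
      (Finsupp.linearCombination ℤ fun a : Fin r → X => basicSharbly (ρ ∘ a)) := by
  refine Submodule.span_le.2 ?_
  rintro _ ⟨a, π, rfl⟩
  rw [SetLike.mem_coe, LinearMap.mem_ker, map_sub, Finsupp.linearCombination_single,
    Finsupp.linearCombination_single, one_smul, ← Function.comp_assoc, basicSharbly_comp_perm,
    sub_self]

/-- The map on chains induced by choosing rational vectors. -/
noncomputable def chainToSharbly {X : Type*} (ρ : X → QVec n) :
    AntisymChains X r →ₗ[ℤ] Sharbly n r :=
  Submodule.liftQ (antisymRelations X r)
    (Finsupp.linearCombination ℤ fun a => basicSharbly (ρ ∘ a)) (antisymRelations_le_ker ρ)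

theorem chainToSharbly_chainSymbol {X : Type*} (ρ : X → QVec n) (a : Fin r → X) :
    chainToSharbly ρ (chainSymbol a) = basicSharbly (ρ ∘ a) := by
  refine (Submodule.liftQ_apply _ _ _).trans ?_
  rw [Finsupp.linearCombination_single, one_smul]

theorem chainToSharbly_partialBoundary {X : Type*} (ρ : X → QVec n) (p : ℕ)
    (v : Fin (r + 1) → X) :
    chainToSharbly ρ (partialBoundary p v) = partialSharblyBoundary p (ρ ∘ v) := by
  rw [partialBoundary, partialSharblyBoundary, map_sum]
  refine Finset.sum_congr rfl fun i _ => ?_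
  rw [map_smul, chainToSharbly_chainSymbol]
  rfl

end SharblyAlgebra

/-! ### Rational rays and their section points -/

section SectionPoints

variable {n : ℕ} {l : Matrix (Fin n) (Fin n) ℝ →ₗ[ℝ] ℝ}

/-- A column `j` with `v' j ≠ 0` shows that the factor is `v j / v' j`, rational even though `c` is
only real. -/
theorem exists_smul_of_rankOne_eq {v v' : QVec n} {c : ℝ} (hc : c ≠ 0)
    (h : rankOne v = c • rankOne v') :
    ∃ r : ℚ, r ≠ 0 ∧ (v : Fin n → ℚ) = r • (v' : Fin n → ℚ) := by
  obtain ⟨j, hj⟩ := Function.ne_iff.1 v'.2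
  have hj' : (v'.1 j : ℝ) ≠ 0 := by exact_mod_cast hj
  have hent : ∀ i k, (v.1 i : ℝ) * v.1 k = c * (v'.1 i * v'.1 k) := fun i k => by
    have := congrFun (congrFun h i) k
    simpa [rankOne, Matrix.vecMulVec_apply] using this
  have hvj : (v.1 j : ℝ) ≠ 0 := by
    intro h0
    have := hent j j
    rw [h0, zero_mul] at this
    exact mul_ne_zero hc (mul_ne_zero hj' hj') this.symm
  have hvjq : v.1 j ≠ 0 := by exact_mod_cast hvj
  refine ⟨v.1 j / v'.1 j, div_ne_zero hvjq hj, ?_⟩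
  funext i
  have h1 : (v.1 i : ℝ) = (v.1 j / v'.1 j) * v'.1 i := by
    have h2 := hent i j
    have h3 := hent j j
    rw [div_mul_eq_mul_div, eq_div_iff hj']
    apply mul_right_cancel₀ hvj
    linear_combination (v'.1 j : ℝ) * h2 - (v'.1 i : ℝ) * h3
  rw [Pi.smul_apply, smul_eq_mul]
  exact_mod_cast h1

theorem rankOne_eq_smul_sectionPoint (hl : IsTransversal l) (v : QVec n) :
    rankOne v = l (rankOne v) • sectionPoint l v := by
  rw [sectionPoint, smul_smul, mul_inv_cancel₀ (hl v).ne', one_smul]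

theorem exists_smul_of_sectionPoint_eq (hl : IsTransversal l) {v v' : QVec n}
    (h : sectionPoint l v = sectionPoint l v') :
    ∃ r : ℚ, r ≠ 0 ∧ (v : Fin n → ℚ) = r • (v' : Fin n → ℚ) := by
  refine exists_smul_of_rankOne_eq (c := l (rankOne v) * (l (rankOne v'))⁻¹)
    (mul_ne_zero (hl v).ne' (inv_ne_zero (hl v').ne')) ?_
  calc rankOne v = l (rankOne v) • sectionPoint l v := rankOne_eq_smul_sectionPoint hl v
    _ = l (rankOne v) • sectionPoint l v' := by rw [h]
    _ = _ := by rw [sectionPoint, smul_smul]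

theorem height_sectionPoint (hl : IsTransversal l) (v : QVec n) :
    l (sectionPoint l v) = 1 := by
  rw [sectionPoint, map_smul, smul_eq_mul, inv_mul_cancel₀ (hl v).ne']

theorem coneHull_rankOne (hl : IsTransversal l) {r : ℕ} (v : Fin r → QVec n) :
    coneHull (Set.range fun i => rankOne (v i)) =
      coneHull (Set.range fun i => sectionPoint l (v i)) := by
  apply Set.Subset.antisymm
  · refine coneHull_le ?_
    rintro _ ⟨i, rfl⟩
    change rankOne (v i) ∈ _
    rw [rankOne_eq_smul_sectionPoint hl]
    exact smul_mem_coneHull (hl _).le (subset_coneHull _ ⟨i, rfl⟩)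
  · refine coneHull_le ?_
    rintro _ ⟨i, rfl⟩
    exact smul_mem_coneHull (inv_nonneg.2 (hl _).le) (subset_coneHull _ ⟨i, rfl⟩)

theorem coneHull_inter_of_height {S : Set (Matrix (Fin n) (Fin n) ℝ)} (hS : ∀ x ∈ S, l x = 1) :
    coneHull S ∩ {A | l A = 1} = convexHull ℝ S := by
  rw [coneHull_inter_height fun x hx => by rw [hS x hx]; exact one_pos]
  congr 1
  ext x
  constructor
  · rintro ⟨y, hy, rfl⟩; simpa [hS y hy] using hy
  · intro hx; exact ⟨x, hx, by simp [hS x hx]⟩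

end SectionPoints

/-! ### Generators, dimension and flipons of a facet -/

section Facets

variable {n : ℕ} {l : Matrix (Fin n) (Fin n) ℝ →ₗ[ℝ] ℝ}

/-- The inner product with `Q`. -/
noncomputable def formPairing (Q : Matrix (Fin n) (Fin n) ℝ) :
    Matrix (Fin n) (Fin n) ℝ →ₗ[ℝ] ℝ :=
  { toFun := fun A => ∑ i, ∑ j, Q i j * A i j
    map_add' := fun A B => by simp only [Matrix.add_apply, mul_add, Finset.sum_add_distrib]
    map_smul' := fun c A => by
      simp only [Matrix.smul_apply, smul_eq_mul, RingHom.id_apply, Finset.mul_sum]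
      exact Finset.sum_congr rfl fun i _ => Finset.sum_congr rfl fun j _ => by ring }

theorem formPairing_rankOne (Q : Matrix (Fin n) (Fin n) ℝ) (v : QVec n) :
    formPairing Q (rankOne v) = quadValue Q v.1 := by
  change ∑ i, ∑ j, Q i j * rankOne v i j = _
  simp only [quadValue, rankOne, Matrix.vecMulVec_apply, dotProduct, Matrix.mulVec,
    Finset.mul_sum]
  refine Finset.sum_congr rfl fun i _ => Finset.sum_congr rfl fun j _ => ?_
  ring

theorem quadValue_pos {Q : Matrix (Fin n) (Fin n) ℝ} (hQ : Q.PosDef) (v : QVec n) :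
    0 < quadValue Q v.1 := by
  have hne : (fun i => (v.1 i : ℝ)) ≠ 0 := by
    obtain ⟨j, hj⟩ := Function.ne_iff.1 v.2
    exact Function.ne_iff.2 ⟨j, by simpa using hj⟩
  simpa [quadValue] using hQ.dotProduct_mulVec_pos hne

/-- The vectors that span a facet: finitely generated data attached to a facet of a tile. -/
structure IsFacetData (F : Set (Matrix (Fin n) (Fin n) ℝ)) (M : Set (QVec n))
    (ψ : Matrix (Fin n) (Fin n) ℝ →ₗ[ℝ] ℝ) (m : ℝ) : Prop where
  eq_coneHull : F = coneHull (rankOne '' M)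
  pos : 0 < m
  const : ∀ v ∈ M, ψ (rankOne v) = m
  finrank_eq : finrank ℝ (Submodule.span ℝ F) + 1 = n * (n + 1) / 2

/-- A nonnegative combination of generators with `φ ≥ 0` lies in the kernel of `φ` only if each
generator actually used does. So `F` is generated by the minimal vectors killed by `φ`, and on these
`Q` takes its common minimum. -/
theorem IsTileFacet.exists_facetData {F : Set (Matrix (Fin n) (Fin n) ℝ)} (hF : IsTileFacet F) :
    ∃ M ψ m, IsFacetData F M ψ m := by
  obtain ⟨Q, ⟨hQ, -⟩, φ, hφ, hFeq, hdim⟩ := hF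
  rw [finrank_symmetricMatrices] at hdim
  set M : Set (QVec n) := {v | v ∈ minimalVectors Q ∧ φ (rankOne v) = 0} with hM
  have hcone : F = coneHull (rankOne '' M) := by
    rw [hFeq]
    apply Set.Subset.antisymm
    · rintro A ⟨hA, hA0⟩
      obtain ⟨m, c, g, hc, hg, rfl⟩ := exists_sum_of_mem_coneHull hA
      have hg0 : ∀ i, 0 ≤ φ (g i) := fun i => hφ _ (subset_coneHull _ (hg i))
      rw [map_sum] at hA0
      simp only [map_smul, smul_eq_mul] at hA0
      have h1 := (Finset.sum_eq_zero_iff_of_nonneg fun i _ => mul_nonneg (hc i) (hg0 i)).1 hA0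
      refine sum_mem_coneHull (fun i _ => hc i) fun i hi hci => ?_
      obtain ⟨v, hv, hvi⟩ := hg i
      refine subset_coneHull _ ⟨v, ⟨hv, ?_⟩, hvi⟩
      rw [hvi]
      exact (mul_eq_zero.1 (h1 i hi)).resolve_left hci
    · intro A hA
      refine ⟨coneHull_le ?_ hA, ?_⟩
      · rintro _ ⟨v, hv, rfl⟩
        exact subset_coneHull _ ⟨v, hv.1, rfl⟩
      · obtain ⟨m, c, g, hc, hg, rfl⟩ := exists_sum_of_mem_coneHull hA
        rw [map_sum]
        refine Finset.sum_eq_zero fun i _ => ?_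
        obtain ⟨v, hv, hvi⟩ := hg i
        rw [map_smul, ← hvi, hv.2, smul_zero]
  rcases M.eq_empty_or_nonempty with hE | ⟨v₀, hv₀⟩
  -- Without generators the constant is arbitrary; one is a positive choice.
  · exact ⟨M, formPairing Q, 1, hcone, one_pos, fun v hv => by rw [hE] at hv; exact hv.elim, hdim⟩
  · refine ⟨M, formPairing Q, quadValue Q v₀.1, hcone, quadValue_pos hQ v₀, fun v hv => ?_, hdim⟩
    rw [formPairing_rankOne]
    exact le_antisymm (hv.1.2 v₀ hv₀.1.1) (hv₀.1.2 v hv.1.1)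

variable {F : Set (Matrix (Fin n) (Fin n) ℝ)} {M : Set (QVec n)}
  {ψ : Matrix (Fin n) (Fin n) ℝ →ₗ[ℝ] ℝ} {m : ℝ}

theorem IsFacetData.inter_eq (h : IsFacetData F M ψ m) (hl : IsTransversal l) :
    F ∩ {A | l A = 1} = convexHull ℝ (sectionPoint l '' M) := by
  rw [h.eq_coneHull, coneHull_inter_height, ← Set.image_comp]
  · rfl
  · rintro _ ⟨v, -, rfl⟩; exact hl v

theorem IsFacetData.convex (h : IsFacetData F M ψ m) (hl : IsTransversal l) :
    Convex ℝ (F ∩ {A | l A = 1}) := by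
  rw [h.inter_eq hl]; exact convex_convexHull ℝ _

theorem IsFacetData.rankOne_mem (h : IsFacetData F M ψ m) {v : QVec n} (hv : v ∈ M) :
    rankOne v ∈ F := by
  rw [h.eq_coneHull]; exact subset_coneHull _ ⟨v, hv, rfl⟩

theorem IsFacetData.sectionPoint_mem (h : IsFacetData F M ψ m) (hl : IsTransversal l) {v : QVec n}
    (hv : v ∈ M) : sectionPoint l v ∈ F ∩ {A | l A = 1} := by
  rw [h.inter_eq hl]; exact subset_convexHull ℝ _ ⟨v, hv, rfl⟩

theorem IsFacetData.exists_of_mem_extremePoints (h : IsFacetData F M ψ m) (hl : IsTransversal l)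
    {x : Matrix (Fin n) (Fin n) ℝ} (hx : x ∈ (F ∩ {A | l A = 1}).extremePoints ℝ) :
    ∃ v ∈ M, sectionPoint l v = x := by
  rw [h.inter_eq hl] at hx
  have h1 : x ∈ sectionPoint l '' M := extremePoints_convexHull_subset hx
  obtain ⟨v, hv, hvx⟩ := h1
  exact ⟨v, hv, hvx⟩

theorem IsFacetData.span_eq (h : IsFacetData F M ψ m) :
    Submodule.span ℝ F = Submodule.span ℝ (rankOne '' M) := by
  apply le_antisymm
  · refine Submodule.span_le.2 fun A hA => ?_
    rw [h.eq_coneHull] at hA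
    obtain ⟨r, c, g, -, hg, rfl⟩ := exists_sum_of_mem_coneHull hA
    exact Submodule.sum_mem _ fun i _ => Submodule.smul_mem _ _ (Submodule.subset_span (hg i))
  · refine Submodule.span_mono ?_
    rw [h.eq_coneHull]; exact subset_coneHull _

/-- For the reverse inclusion, `y ↦ y - l y • sectionPoint l v₀` sends generators into the direction
of the section and is the identity on the kernel of `l`. -/
theorem IsFacetData.vectorSpan_eq (h : IsFacetData F M ψ m) (hl : IsTransversal l) {v₀ : QVec n}
    (hv₀ : v₀ ∈ M) :
    vectorSpan ℝ (F ∩ {A | l A = 1}) = Submodule.span ℝ F ⊓ LinearMap.ker l := by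
  set P := F ∩ {A | l A = 1} with hP
  have hp₀ := h.sectionPoint_mem hl hv₀
  apply le_antisymm
  · rw [vectorSpan_def]
    refine Submodule.span_le.2 ?_
    rintro _ ⟨x, hx, y, hy, rfl⟩
    have h1 : l x = 1 := hx.2
    have h2 : l y = 1 := hy.2
    refine ⟨Submodule.sub_mem _ (Submodule.subset_span hx.1) (Submodule.subset_span hy.1), ?_⟩
    change l (x - y) = 0
    rw [map_sub, h1, h2, sub_self]
  · rintro x ⟨hx, hxl⟩
    have key : ∀ y ∈ Submodule.span ℝ (rankOne '' M),
        y - l y • sectionPoint l v₀ ∈ vectorSpan ℝ P := by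
      intro y hy
      induction hy using Submodule.span_induction with
      | mem y hy =>
        obtain ⟨v, hv, rfl⟩ := hy
        have h3 : rankOne v - l (rankOne v) • sectionPoint l v₀ =
            l (rankOne v) • (sectionPoint l v - sectionPoint l v₀) := by
          rw [smul_sub, ← rankOne_eq_smul_sectionPoint hl]
        rw [h3]
        exact Submodule.smul_mem _ _ (vsub_mem_vectorSpan ℝ (h.sectionPoint_mem hl hv) hp₀)
      | zero => simp
      | add y z _ _ hy hz =>
        have := Submodule.add_mem _ hy hz
        rw [map_add, add_smul]
        convert this using 1
        abel
      | smul c y _ hy =>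
        have := Submodule.smul_mem _ c hy
        rw [map_smul, smul_assoc, ← smul_sub]
        exact this
    have hx' : x ∈ Submodule.span ℝ F := hx
    rw [h.span_eq] at hx'
    have h4 := key x hx'
    have h5 : l x = 0 := hxl
    rwa [h5, zero_smul, sub_zero] at h4

theorem rankOne_mem_symmetricMatrices (v : QVec n) : rankOne v ∈ symmetricMatrices n := by
  change (rankOne v).IsSymm
  ext i j
  simp [rankOne, Matrix.vecMulVec_apply, mul_comm]

/-- The generators of `F` lie on the hyperplane `ψ = m`, which misses the origin because `m > 0`. It
meets the `(d - 1)`-dimensional span of `F` in an affine space of dimension `d - 2`. -/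
theorem IsFacetData.isFlipon (h : IsFacetData F M ψ m) {d : ℕ} (hd : d = n * (n + 1) / 2)
    {v₀ : QVec n} (hv₀ : v₀ ∈ M) {v : Fin d → QVec n} (hv : ∀ i, v i ∈ M) : IsFlipon v := by
  refine ⟨AffineSubspace.mk' (rankOne v₀) (Submodule.span ℝ F ⊓ LinearMap.ker ψ), ?_, ?_, ?_⟩
  · intro A hA
    rw [SetLike.mem_coe, AffineSubspace.mem_mk'] at hA
    have h1 : Submodule.span ℝ F ≤ symmetricMatrices n := by
      rw [h.span_eq]
      refine Submodule.span_le.2 ?_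
      rintro _ ⟨v, -, rfl⟩
      exact rankOne_mem_symmetricMatrices v
    have := Submodule.add_mem _ (h1 hA.1) (rankOne_mem_symmetricMatrices v₀)
    simpa using this
  · rw [AffineSubspace.direction_mk']
    have h1 := finrank_inf_ker (Submodule.span ℝ F) ψ
      (Submodule.subset_span (h.rankOne_mem hv₀)) (by rw [h.const v₀ hv₀]; exact h.pos.ne')
    have h2 := h.finrank_eq
    omega
  · intro i
    rw [AffineSubspace.mem_mk']
    refine ⟨Submodule.sub_mem _ (Submodule.subset_span (h.rankOne_mem (hv i)))
      (Submodule.subset_span (h.rankOne_mem hv₀)), ?_⟩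
    change ψ (rankOne (v i) - rankOne v₀) = 0
    rw [map_sub, h.const _ (hv i), h.const _ hv₀, sub_self]

end Facets

/-! ### Linear coordinates as homogeneous coordinates -/

section LinearCoordinates

variable {V : Type*} [AddCommGroup V] [Module ℝ V] {W : Submodule ℝ V} {k : ℕ}

/-- The coordinates of a basis of `W`, extended along a projection to `W`. -/
noncomputable def basisCoordinates (B : Basis (Fin (k + 1)) ℝ W) (q : V →ₗ[ℝ] W) :
    V →ᵃ[ℝ] (Fin (k + 1) → ℝ) :=
  (B.equivFun.toLinearMap ∘ₗ q).toAffineMap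

/-- The section misses the origin, so linear coordinates on `W` are already homogeneous coordinates,
with `l` as height. -/
theorem isHomogenization_basisCoordinates (B : Basis (Fin (k + 1)) ℝ W) {q : V →ₗ[ℝ] W}
    (hq : ∀ x : W, q x = x) {P : Set V} (hP : P ⊆ W) {l : V →ₗ[ℝ] ℝ} (hl : ∀ x ∈ P, l x = 1) :
    IsHomogenization P (basisCoordinates B q)
      (l ∘ₗ W.subtype ∘ₗ B.equivFun.symm.toLinearMap) where
  height x hx := by
    change l (B.equivFun.symm (B.equivFun (q x))) = 1
    rw [LinearEquiv.symm_apply_apply, hq ⟨x, hP hx⟩]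
    exact hl x hx
  inj x hx h := by
    have h1 : x ∈ W := by
      refine Submodule.span_le.2 ?_ hx
      rintro _ ⟨y, hy, z, hz, rfl⟩
      exact Submodule.sub_mem _ (hP hy) (hP hz)
    have h2 : B.equivFun (q x) = 0 := h
    have h3 : q x = 0 := B.equivFun.map_eq_zero_iff.1 h2
    rw [hq ⟨x, h1⟩] at h3
    exact congrArg Subtype.val h3

theorem det_basisCoordinates (B : Basis (Fin (k + 1)) ℝ W) {q : V →ₗ[ℝ] W}
    (hq : ∀ x : W, q x = x) {a : Fin (k + 1) → V} {c : Fin (k + 1) → W}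
    (hc : ∀ i, (c i : V) = a i) :
    Matrix.detRowAlternating (basisCoordinates B q ∘ a) = B.det c := by
  have h1 : (basisCoordinates B q ∘ a) = (B.toMatrix c).transpose := by
    funext i j
    change B.equivFun (q (a i)) j = B.repr (c i) j
    rw [← hc, hq, Basis.equivFun_apply]
  rw [h1, Basis.det_apply, ← Matrix.det_transpose]
  rfl

/-- The extreme points of `P` in `σ` stay extreme in the smaller hull of `S`, so they belong to
every generating set of it. -/
theorem subset_of_convexHull_eq {P S : Set V} (hP : Convex ℝ P) {σ : Set V}
    (hσ : σ ⊆ P.extremePoints ℝ) (h : convexHull ℝ S = convexHull ℝ σ) : σ ⊆ S := by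
  intro x hx
  have h1 : convexHull ℝ S ⊆ P := by
    rw [h]; exact convexHull_min (hσ.trans extremePoints_subset) hP
  refine extremePoints_convexHull_subset
    (inter_extremePoints_subset_extremePoints_of_subset h1 ⟨?_, hσ hx⟩)
  rw [h]; exact subset_convexHull ℝ _ hx

end LinearCoordinates

/-! ### Sharblies of simplicial cones and the facet identity -/

section ConeSharblies

variable {n k : ℕ} {l : Matrix (Fin n) (Fin n) ℝ →ₗ[ℝ] ℝ}
  {W : Submodule ℝ (Matrix (Fin n) (Fin n) ℝ)}

/-- Replacing section points by rank one matrices multiplies rows by positive scalars, so only the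
sign of `π` matters. -/
theorem det_rankOne_pos_iff (hl : IsTransversal l) (B : Basis (Fin (k + 1)) ℝ W)
    {q : Matrix (Fin n) (Fin n) ℝ →ₗ[ℝ] W} (hq : ∀ x : W, q x = x)
    {a : Fin (k + 1) → Matrix (Fin n) (Fin n) ℝ} {v : Fin (k + 1) → QVec n}
    {π : Equiv.Perm (Fin (k + 1))} (hv : ∀ i, sectionPoint l (v i) = a (π i))
    {c : Fin (k + 1) → W} (hc : ∀ i, (c i : Matrix (Fin n) (Fin n) ℝ) = rankOne (v i)) :
    0 < B.det c ↔ 0 < ((Equiv.Perm.sign π : ℤ) : ℝ) *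
      Matrix.detRowAlternating (basisCoordinates B q ∘ a) := by
  have h1 : basisCoordinates B q ∘ (fun i => rankOne (v i)) =
      fun i => l (rankOne (v i)) • ((basisCoordinates B q ∘ a) ∘ π) i := by
    funext i
    simp only [Function.comp_apply]
    rw [← hv i]
    conv_lhs => rw [rankOne_eq_smul_sectionPoint hl (v i)]
    exact map_smul (B.equivFun.toLinearMap ∘ₗ q) _ _
  rw [← det_basisCoordinates B hq (a := fun i => rankOne (v i)) hc, h1,
    ← zsmul_eq_mul, ← Units.smul_def, ← AlternatingMap.map_perm]
  have h2 := (Matrix.detRowAlternating (n := Fin (k + 1)) (R := ℝ)).toMultilinearMap.map_smul_univ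
    (fun i => l (rankOne (v i))) ((basisCoordinates B q ∘ a) ∘ π)
  have h3 : (0 : ℝ) < ∏ i, l (rankOne (v i)) := Finset.prod_pos fun i _ => hl _
  simp only [AlternatingMap.coe_multilinearMap, smul_eq_mul] at h2
  rw [h2]
  exact mul_pos_iff_of_pos_left h3

/-- A cone determines its vertex rays, so any admissible choice of vectors is `ρ ∘ a` up to a
permutation and rational scalings. Scalings do not change the sharbly, and the orientation fixes the
sign of the permutation. -/
theorem coneSharbly_eq (hk : 1 ≤ k) (hl : IsTransversal l) (B : Basis (Fin (k + 1)) ℝ W)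
    {q : Matrix (Fin n) (Fin n) ℝ →ₗ[ℝ] W} (hq : ∀ x : W, q x = x)
    {P : Set (Matrix (Fin n) (Fin n) ℝ)} (hP : Convex ℝ P) (hPW : P ⊆ W)
    (hPl : ∀ x ∈ P, l x = 1) {σ : Finset (Matrix (Fin n) (Fin n) ℝ)}
    (hσP : (σ : Set (Matrix (Fin n) (Fin n) ℝ)) ⊆ P.extremePoints ℝ)
    {a : Fin (k + 1) → Matrix (Fin n) (Fin n) ℝ} (hinj : Function.Injective a)
    (hσ : Set.range a = (σ : Set (Matrix (Fin n) (Fin n) ℝ)))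
    {ρ : Matrix (Fin n) (Fin n) ℝ → QVec n} (hρ : ∀ x ∈ P.extremePoints ℝ, sectionPoint l (ρ x) = x)
    (hdet : Matrix.detRowAlternating (basisCoordinates B q ∘ a) ≠ 0) :
    coneSharbly B.orientation (coneHull (σ : Set (Matrix (Fin n) (Fin n) ℝ))) =
      (SignType.sign (Matrix.detRowAlternating (basisCoordinates B q ∘ a)) : ℤ) •
        basicSharbly (ρ ∘ a) := by
  classical
  set D := Matrix.detRowAlternating (basisCoordinates B q ∘ a) with hD
  have haP : ∀ i, a i ∈ P.extremePoints ℝ := fun i => hσP (hσ ▸ Set.mem_range_self i)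
  have hσl : ∀ x ∈ (σ : Set (Matrix (Fin n) (Fin n) ℝ)), l x = 1 := fun x hx =>
    hPl x (extremePoints_subset (hσP hx))
  have key : ∀ π : Equiv.Perm (Fin (k + 1)), 0 < ((Equiv.Perm.sign π : ℤ) : ℝ) * D →
      ∃ v : Fin (k + 1) → QVec n, coneHull (σ : Set (Matrix (Fin n) (Fin n) ℝ)) =
        coneHull (Set.range fun i => rankOne (v i)) ∧
      ∃ b : Basis (Fin (k + 1)) ℝ W, b.orientation = B.orientation ∧
        ∀ i, (b i : Matrix (Fin n) (Fin n) ℝ) = rankOne (v i) := by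
    intro π hπ
    have hv : ∀ i, sectionPoint l (ρ (a (π i))) = a (π i) := fun i => hρ _ (haP _)
    refine ⟨fun i => ρ (a (π i)), ?_, ?_⟩
    · rw [coneHull_rankOne hl]
      congr 1
      simp only [hv]
      rw [← hσ]
      exact (π.surjective.range_comp a).symm
    · have hmem : ∀ i, rankOne (ρ (a (π i))) ∈ W := fun i => by
        rw [rankOne_eq_smul_sectionPoint hl, hv]
        exact Submodule.smul_mem _ _ (hPW (extremePoints_subset (haP _)))
      let c : Fin (k + 1) → W := fun i => ⟨_, hmem i⟩
      have hpos : 0 < B.det c := (det_rankOne_pos_iff hl B hq hv (c := c) fun i => rfl).2 hπ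
      obtain ⟨h1, h2⟩ := (Module.Basis.is_basis_iff_det B).2 (isUnit_iff_ne_zero.2 hpos.ne')
      refine ⟨Basis.mk h1 h2.ge, ?_, fun i => by simp [c]⟩
      refine ((Basis.orientation_eq_iff_det_pos B (Basis.mk h1 h2.ge)).2 ?_).symm
      rwa [Basis.coe_mk]
  have hex : ∃ v : Fin (k + 1) → QVec n, coneHull (σ : Set (Matrix (Fin n) (Fin n) ℝ)) =
        coneHull (Set.range fun i => rankOne (v i)) ∧
      ∃ b : Basis (Fin (k + 1)) ℝ W, b.orientation = B.orientation ∧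
        ∀ i, (b i : Matrix (Fin n) (Fin n) ℝ) = rankOne (v i) := by
    rcases lt_or_gt_of_ne hdet with h | h
    · obtain ⟨m, rfl⟩ : ∃ m, k = m + 1 := ⟨k - 1, by omega⟩
      refine key (Equiv.swap 0 1) ?_
      rw [Equiv.Perm.sign_swap (by simp)]
      push_cast
      linarith
    · exact key 1 (by simpa using h)
  rw [coneSharbly, dif_pos hex]
  obtain ⟨hcone, b, hb, hbv⟩ := hex.choose_spec
  set v := hex.choose with hv
  have hhull : convexHull ℝ (Set.range fun i => sectionPoint l (v i)) =
      convexHull ℝ (σ : Set (Matrix (Fin n) (Fin n) ℝ)) := by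
    rw [← coneHull_inter_of_height hσl, hcone, coneHull_rankOne hl, coneHull_inter_of_height]
    rintro _ ⟨i, rfl⟩
    exact height_sectionPoint hl _
  have hsub := subset_of_convexHull_eq hP hσP hhull
  -- The `k + 1` section points include the `k + 1` vertices of `σ`, so there are no others.
  have hrange : Set.range (fun i => sectionPoint l (v i)) = Set.range a := by
    have h1 : σ ⊆ Finset.univ.image fun i => sectionPoint l (v i) := fun x hx => by
      obtain ⟨i, hi⟩ := hsub hx
      exact Finset.mem_image.2 ⟨i, Finset.mem_univ _, hi⟩
    have h2 := Finset.eq_of_subset_of_card_le h1 (by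
      rw [card_of_range_eq hinj hσ]
      exact Finset.card_image_le.trans (by simp))
    rw [hσ, h2]
    simp
  obtain ⟨π, hπ⟩ := exists_perm_of_range_eq hinj hrange
  have hvπ : ∀ i, sectionPoint l (v i) = a (π i) := fun i => congrFun hπ i
  have hr : ∀ i, ∃ r : ℚ, r ≠ 0 ∧ (v i : Fin n → ℚ) = r • (ρ (a (π i)) : Fin n → ℚ) := fun i =>
    exists_smul_of_sectionPoint_eq hl (by rw [hvπ, hρ _ (haP _)])
  choose r hr0 hrv using hr
  have hsharbly : basicSharbly v = (Equiv.Perm.sign π : ℤ) • basicSharbly (ρ ∘ a) := by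
    rw [← basicSharbly_comp_perm]
    exact basicSharbly_smul hr0 hrv
  rw [hsharbly]
  have hpos := (det_rankOne_pos_iff hl B hq hvπ (c := b) hbv).1
    ((Basis.orientation_eq_iff_det_pos B b).1 hb.symm)
  rw [← hD] at hpos
  congr 1
  rcases Int.units_eq_one_or (Equiv.Perm.sign π) with h | h
  · rw [h] at hpos ⊢
    have : 0 < D := by simpa using hpos
    rw [sign_pos this]; rfl
  · rw [h] at hpos ⊢
    have : D < 0 := by simpa using hpos
    rw [sign_neg this]; rfl

/-- Cutting a cone at height one recovers the simplex and its vertices, so a sum over cones is a sum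
over simplices without loss of multiplicity. -/
theorem IsTriangulation.coneHull_injOn {P : Set (Matrix (Fin n) (Fin n) ℝ)}
    {T : Finset (Finset (Matrix (Fin n) (Fin n) ℝ))} (hT : IsTriangulation P T)
    (hP : Convex ℝ P) (hPl : ∀ x ∈ P, l x = 1) :
    Set.InjOn (fun σ : Finset (Matrix (Fin n) (Fin n) ℝ) =>
      coneHull (σ : Set (Matrix (Fin n) (Fin n) ℝ))) T := by
  intro σ hσ τ hτ h
  have h1 : convexHull ℝ (τ : Set (Matrix (Fin n) (Fin n) ℝ)) = convexHull ℝ (σ : Set _) := by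
    rw [← coneHull_inter_of_height fun x hx => hPl x (hT.subset hσ hx),
      ← coneHull_inter_of_height fun x hx => hPl x (hT.subset hτ hx)]
    exact congrArg (· ∩ _) h.symm
  exact Finset.eq_of_subset_of_card_le
    (Finset.coe_subset.1 (subset_of_convexHull_eq hP (hT.vertices σ hσ) h1))
    (by rw [hT.card_eq σ hσ, hT.card_eq τ hτ])

theorem IsTriangulation.sum_coneSharbly {P : Set (Matrix (Fin n) (Fin n) ℝ)}
    {T : Finset (Finset (Matrix (Fin n) (Fin n) ℝ))} (hT : IsTriangulation P T)
    (hP : Convex ℝ P) (hPl : ∀ x ∈ P, l x = 1) {𝒯 : Finset (Set (Matrix (Fin n) (Fin n) ℝ))}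
    (h𝒯 : (𝒯 : Set (Set (Matrix (Fin n) (Fin n) ℝ))) =
      (fun σ : Finset (Matrix (Fin n) (Fin n) ℝ) => coneHull (σ : Set _)) '' T)
    (o : Orientation ℝ W (Fin (k + 1))) :
    ∑ w ∈ 𝒯, coneSharbly o w =
      ∑ σ ∈ T, coneSharbly o (coneHull (σ : Set (Matrix (Fin n) (Fin n) ℝ))) := by
  classical
  have h1 : 𝒯 = T.image fun σ : Finset (Matrix (Fin n) (Fin n) ℝ) => coneHull (σ : Set _) := by
    rw [← Finset.coe_inj, h𝒯, Finset.coe_image]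
  rw [h1, Finset.sum_image (hT.coneHull_injOn hP hPl)]

theorem exists_flipons (hn : 2 ≤ n) (hk : k + 1 = n * (n + 1) / 2) (hl : IsTransversal l)
    {F : Set (Matrix (Fin n) (Fin n) ℝ)} (hF : IsTileFacet F)
    (o : Orientation ℝ (Submodule.span ℝ F) (Fin k))
    {𝒲 𝒴 : Finset (Set (Matrix (Fin n) (Fin n) ℝ))} (h𝒲 : IsRegularConeTriangulation l F 𝒲)
    (h𝒴 : IsRegularConeTriangulation l F 𝒴) :
    ∃ (N : ℕ) (p : Fin N → ℕ) (v : Fin N → Fin (k + 1) → QVec n),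
      (∀ α, IsFlipon (v α) ∧ 3 ≤ p α ∧ p α ≤ k + 1 ∧
        (∀ i, sectionPoint l (v α i) ∈ (F ∩ {A | l A = 1}).extremePoints ℝ) ∧
        Function.Injective (fun i => sectionPoint l (v α i)) ∧
        IsCircuit ((fun i => sectionPoint l (v α i)) '' {i | (i : ℕ) < p α})) ∧
      ∑ α, partialSharblyBoundary (p α) (v α) =
        ∑ w ∈ 𝒲, coneSharbly o w - ∑ y ∈ 𝒴, coneSharbly o y := by
  classical
  obtain ⟨M, ψ, m, hM⟩ := hF.exists_facetData
  obtain ⟨T, ⟨hT, -⟩, hT𝒲⟩ := h𝒲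
  obtain ⟨T', ⟨hT', -⟩, hT𝒴⟩ := h𝒴
  have hk2 : 2 ≤ k := by
    have : 2 * (2 + 1) / 2 ≤ n * (n + 1) / 2 :=
      Nat.div_le_div_right (Nat.mul_le_mul hn (by omega))
    omega
  obtain ⟨k, rfl⟩ : ∃ j, k = j + 1 := ⟨k - 1, by omega⟩
  have hrank : finrank ℝ (Submodule.span ℝ F) = k + 1 := by
    have := hM.finrank_eq
    omega
  obtain ⟨v₀, hv₀⟩ : M.Nonempty := by
    rw [Set.nonempty_iff_ne_empty]
    intro h0
    rw [hM.span_eq, h0, Set.image_empty, Submodule.span_empty, finrank_bot] at hrank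
    omega
  obtain ⟨q, hq⟩ := exists_projection (Submodule.span ℝ F)
  obtain ⟨B, rfl⟩ : ∃ B : Basis (Fin (k + 1)) ℝ (Submodule.span ℝ F), B.orientation = o :=
    ⟨o.someBasis (by simpa using hrank.symm), o.someBasis_orientation _⟩
  set P := F ∩ {A | l A = 1} with hP
  have hPW : P ⊆ Submodule.span ℝ F := fun x hx => Submodule.subset_span hx.1
  have hPl : ∀ x ∈ P, l x = 1 := fun x hx => hx.2
  have hPc : Convex ℝ P := hM.convex hl
  have hf := isHomogenization_basisCoordinates B hq hPW hPl
  have hdim : finrank ℝ (vectorSpan ℝ P) = k := by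
    have h1 := finrank_inf_ker (Submodule.span ℝ F) l
      (Submodule.subset_span (hM.rankOne_mem hv₀)) (hl v₀).ne'
    rw [← hM.vectorSpan_eq hl hv₀, hrank] at h1
    exact Nat.succ.inj h1
  obtain ⟨a, ha, ha'⟩ := hT.exists_isEnumeration hT' hdim
  -- Away from the vertices `ρ` takes the default value `v₀`, so that all its values lie in `M`, as
  -- `isFlipon` requires.
  obtain ⟨ρ, hρM, hρ⟩ : ∃ ρ : Matrix (Fin n) (Fin n) ℝ → QVec n, (∀ x, ρ x ∈ M) ∧
      ∀ x ∈ P.extremePoints ℝ, sectionPoint l (ρ x) = x := by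
    have h1 : ∀ x, ∃ v ∈ M, x ∈ P.extremePoints ℝ → sectionPoint l v = x := fun x => by
      by_cases hx : x ∈ P.extremePoints ℝ
      · obtain ⟨v, hv, hvx⟩ := hM.exists_of_mem_extremePoints hl hx
        exact ⟨v, hv, fun _ => hvx⟩
      · exact ⟨v₀, hv₀, fun h => absurd h hx⟩
    choose ρ h2 h3 using h1
    exact ⟨ρ, h2, h3⟩
  have key : ∀ S, IsTriangulation P S → IsEnumeration S a → ∀ σ ∈ S,
      coneSharbly B.orientation (coneHull (σ : Set (Matrix (Fin n) (Fin n) ℝ))) =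
      (SignType.sign (Matrix.detRowAlternating (basisCoordinates B q ∘ a σ)) : ℤ) •
        basicSharbly (ρ ∘ a σ) := fun S hS haS σ hσ =>
    coneSharbly_eq (by omega) hl B hq hPc hPW hPl (hS.vertices σ hσ) (haS σ hσ).1 (haS σ hσ).2 hρ
      (hS.det_ne_zero hf haS hσ)
  obtain ⟨N, p, v, hv, hsum⟩ := exists_flipTuples hT hT' hPc hf ha ha'
  have hsec : ∀ α i, sectionPoint l (ρ (v α i)) = v α i := fun α i => hρ _ ((hv α).2.1 i)
  refine ⟨N, p, fun α => ρ ∘ v α, fun α => ⟨hM.isFlipon hk hv₀ fun i => hρM _, ?_, (hv α).2.2.1,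
    fun i => ?_, ?_, ?_⟩, ?_⟩
  · exact IsCircuit.three_le (hv α).2.2.2
  · simp only [Function.comp_apply, hsec]; exact (hv α).2.1 i
  · simp only [Function.comp_apply, hsec]; exact (hv α).1
  · simp only [Function.comp_apply, hsec]; exact (hv α).2.2.2
  -- The identity between chains of vertices is carried to sharblies by the linear map that `ρ`
  -- induces.
  · have h1 := congrArg (chainToSharbly ρ) hsum
    simp only [map_sum, map_sub, map_smul, chainToSharbly_partialBoundary,
      chainToSharbly_chainSymbol] at h1
    rw [hT.sum_coneSharbly hPc hPl hT𝒲, hT'.sum_coneSharbly hPc hPl hT𝒴,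
      Finset.sum_congr rfl (key T hT ha), Finset.sum_congr rfl (key T' hT' ha')]
    exact h1

end ConeSharblies

theorem mainTheorem6 :
    -- flips and regular triangulations of an `n`-dimensional polytope
    (∀ (V : Type*) [AddCommGroup V] [Module ℝ V] [DecidableEq V] (P : Set V) (n : ℕ)
        (T₁ T₂ : Finset (Finset V)),
      IsPolytope P → Module.finrank ℝ (vectorSpan ℝ P) = n →
      IsRegularTriangulation P T₁ → IsRegularTriangulation P T₂ →
      -- `T₁` and `T₂` are connected by a flip along the circuit `Z`
      (∀ Z : Finset V, IsFlip P T₁ T₂ Z →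
        -- the identity for the simplices of the circuit `{z_1, …, z_p}`, `p = m + 2`
        (∀ (m : ℕ) (z : Fin (m + 2) → V), Function.Injective z → Set.range z = (Z : Set V) →
          Disjoint (circuitSimplices Z T₁) (circuitSimplices Z T₂) ∧
          circuitSimplices Z T₁ ∪ circuitSimplices Z T₂ = Z.image (fun w => Z.erase w) ∧
          (m = n → circuitSimplices Z T₁ = T₁ \ T₂ ∧ circuitSimplices Z T₂ = T₂ \ T₁) ∧
          ∀ o : Orientation ℝ (vectorSpan ℝ (Z : Set V)) (Fin m),
            ∃ e : ℤˣ,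
              (e : ℤ) • ∑ i : Fin (m + 2), (-1 : ℤ) ^ ((i : ℕ) + 1) •
                  chainSymbol (z ∘ i.succAbove) =
                ∑ s ∈ circuitSimplices Z T₁, orientedSymbol o s -
                  ∑ u ∈ circuitSimplices Z T₂, orientedSymbol o u) ∧
        -- the identity for the maximal simplices of `P` that contain a given face of the link
        (∀ (o : Orientation ℝ (vectorSpan ℝ P) (Fin n)), ∀ σ₀ ∈ T₁ \ T₂,
          ∀ (p : ℕ) (v : Fin (n + 2) → V), Function.Injective v →
            v '' {i | (i : ℕ) < p} = (Z : Set V) →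
            v '' {i | p ≤ (i : ℕ)} = ((σ₀ \ Z : Finset V) : Set V) →
            ∃ e : ℤˣ,
              (e : ℤ) • partialBoundary p v =
                ∑ s ∈ T₁ \ T₂ with s \ Z = σ₀ \ Z, orientedSymbol o s -
                  ∑ u ∈ T₂ \ T₁ with u \ Z = σ₀ \ Z, orientedSymbol o u)) ∧
      -- any two regular triangulations
      (∀ o : Orientation ℝ (vectorSpan ℝ P) (Fin n),
        ∃ (k : ℕ) (p : Fin k → ℕ) (v : Fin k → Fin (n + 2) → V),
          (∀ α, Function.Injective (v α) ∧ (∀ i, v α i ∈ P.extremePoints ℝ) ∧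
            p α ≤ n + 2 ∧ IsCircuit (v α '' {i | (i : ℕ) < p α})) ∧
          ∑ α, partialBoundary (p α) (v α) =
            ∑ w ∈ T₁, orientedSymbol o w - ∑ y ∈ T₂, orientedSymbol o y)) ∧
    -- regular triangulations of a facet of a tile, where `d = k + 1 = n (n + 1) / 2`
    (∀ (n k : ℕ), 2 ≤ n → k + 1 = n * (n + 1) / 2 →
      ∀ l : Matrix (Fin n) (Fin n) ℝ →ₗ[ℝ] ℝ, IsTransversal l →
      ∀ F : Set (Matrix (Fin n) (Fin n) ℝ), IsTileFacet F →
      ∀ (o : Orientation ℝ (Submodule.span ℝ F) (Fin k))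
        (𝒲 𝒴 : Finset (Set (Matrix (Fin n) (Fin n) ℝ))),
        IsRegularConeTriangulation l F 𝒲 → IsRegularConeTriangulation l F 𝒴 →
        ∃ (N : ℕ) (p : Fin N → ℕ) (v : Fin N → Fin (k + 1) → QVec n),
          (∀ α, IsFlipon (v α) ∧ 3 ≤ p α ∧ p α ≤ k + 1 ∧
            (∀ i, sectionPoint l (v α i) ∈ (F ∩ {A | l A = 1}).extremePoints ℝ) ∧
            Function.Injective (fun i => sectionPoint l (v α i)) ∧
            IsCircuit ((fun i => sectionPoint l (v α i)) '' {i | (i : ℕ) < p α})) ∧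
          ∑ α, partialSharblyBoundary (p α) (v α) =
            ∑ w ∈ 𝒲, coneSharbly o w - ∑ y ∈ 𝒴, coneSharbly o y) := by
  refine ⟨fun V _ _ _ P n T₁ T₂ hP hn hT₁ hT₂ => ⟨fun Z hF => ?_, fun o => ?_⟩,
    fun n k hn hk l hl F hF o 𝒲 𝒴 h𝒲 h𝒴 => exists_flipons hn hk hl hF o h𝒲 h𝒴⟩
  · obtain ⟨w, hw⟩ := hF.exists_weightedFlip hT₁.1 hT₂.1
    obtain ⟨Tp, -, hTp, -⟩ := hF.exchange
    refine ⟨fun m z hz hzZ => ⟨hw.disjoint, hw.union, fun hmn => ?_, fun o =>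
      hw.circuit_formula hTp hz hzZ o⟩, fun o σ₀ hσ₀ p v hv hvZ hvF => ?_⟩
    · exact hw.eq_sdiff hT₁.1 hT₂.1 hn (by rw [card_of_range_eq hz hzZ, hmn])
    · exact hw.link_formula hP hn hT₁.1 (hF.vertices.trans extremePoints_subset) o hσ₀ hv hvZ hvF
  · exact exists_flipTuples_of_orientation hP hn hT₁.1 hT₂.1 o
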